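/- Let $N\ge 3$, $n\ge 1$, let $A$ be a real symmetric positive definite $N\times N$ matrix and let $a_1,\dots,a_n\in\mathbb R^N$ be distinct. Let $d\mu=\mu(x)\,dx$ with $\mu(x)=C\,e^{-\frac12\sum_{i=1}^n\langle A(x-a_i),x-a_i\rangle}$, where $C$ makes $\mu$ a probability density, and let $L^2_\mu=L^2(\mathbb R^N,\mu)$ (real valued). Let $H^1_\mu$ be the set of $f\in L^2_\mu$ whose distributional gradient is in $(L^2_\mu)^N$. For $c>0$ put $V(x)=\sum_{i=1}^n\frac{c}{|x-a_i|^2}$ and $$a_c(u,v)=\int\nabla u\cdot\nabla v\,d\mu-c\sum_{i=1}^n\int\frac{uv}{|x-a_i|^2}\,d\mu,\qquad u,v\in D(a_c)=H^1_\mu .$$ Let $L$ be the operator on $L^2_\mu$ such that $-L$ is associated with the form $\int\nabla u\cdot\nabla v\,d\mu$ on $H^1_\mu$, and let $c_o=\left(\frac{N-2}{2}\right)^2$. For $k\ge 0$ put $K=\frac{k+(n+1)c}{r_0^2}+\frac n2\operatorname{Tr}A$ with $r_0=\frac12\min_{i\ne j}|a_i-a_j|$ if $n\ge2$, and $K=\frac12\operatorname{Tr}A$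 if $n=1$. All the integrals above converge for $u,v\in H^1_\mu$, $a_c$ is a symmetric bilinear form on the vector space $H^1_\mu$ for every $c>0$, and $L\varphi=\Delta\varphi-\sum_{i=1}^nA(x-a_i)\cdot\nabla\varphi$ for $\varphi\in C_c^\infty(\mathbb R^N)$. Moreover: (i) $a_c$ is closed if $0<c<c_o$. (ii) $a_{c_o}$ is closable. (iii) For every $c\in(0,c_o]$ there is $k\in[0,\pi^2)$ such that the following hold with the corresponding constant $K$. - $a_c$ is quasi-accretive: $a_c(u,u)\ge-K\|u\|_{L^2_\mu}^2$ for all $u\in H^1_\mu$. - Let $b=a_c$ if $c<c_o$ and $b=\overline{a_{c_o}}$ (the closure) if $c=c_o$; $b$ is a closed symmetric bilinear form. Let $\mathcal A$ be the operator associated with $b$: $u\in D(\mathcal A)$ and $\mathcal Au=v$ if and only if $u\in D(b)$, $v\in L^2_\mu$ and $b(u,\phi)=\int v\phi\,d\mu$ for all $\phi\in D(b)$. Then $-\mathcal A=L+V$ in the sense that, for every $\varphi\in C_c^\infty(\mathbb R^N)$ with $L\varphi+V\varphi\in L^2_\mu$, one has $\varphi\in D(\mathcal A)$ and $-\mathcal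 A\varphi=L\varphi+V\varphi$. - $-\mathcal A$ generates a $C_0$-semigroup $S(t)$ on $L^2_\mu$ which is analytic (its complexification extends to a semigroup on a sector $\{z\neq0:|\arg z|<\theta\}$, $0<\theta\le\pi/2$, which is holomorphic there and strongly continuous at $0$ on each smaller sector), and $\|S(t)\|\le e^{Kt}$ for $t\ge0$. - $S(t)$ is positive: $f\ge0$ implies $S(t)f\ge0$ for all $t\ge 0$. For each $j\in\mathbb N$ the operator $L+\min(V,cj)$ with domain $D(L)$ generates a $C_0$-semigroup $S_j(t)$ on $L^2_\mu$, with $0\le S_j(t)\le S_{j+1}(t)$ (in the sense of positive operators), and $\lim_{j\to\infty}S_j(t)f=S(t)f$ in $L^2_\mu$ for all $f\in L^2_\mu$ and $t\ge0$. -/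

import Mathlib

open MeasureTheory Filter Topology
open scoped ENNReal NNReal ContDiff

noncomputable section

namespace Multipolar

/-! ### The Gaussian measure, the potential and the constants -/

/-- The space `ℝ^N` with its Euclidean structure. -/
abbrev E (N : ℕ) : Type := EuclideanSpace ℝ (Fin N)

/-- The function `exp (-½ ∑ᵢ ⟨A (x - aᵢ), x - aᵢ⟩)`. -/
def gaussExp {N n : ℕ} (A : Matrix (Fin N) (Fin N) ℝ) (a : Fin n → E N) (x : E N) : ℝ :=
  Real.exp (-(1 / 2) * ∑ i, inner ℝ (Matrix.toEuclideanLin A (x - a i)) (x - a i))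

/-- The normalized density `C exp (-½ ∑ᵢ ⟨A (x - aᵢ), x - aᵢ⟩)`, `C = (∫ exp …)⁻¹`. -/
def density {N n : ℕ} (A : Matrix (Fin N) (Fin N) ℝ) (a : Fin n → E N) (x : E N) : ℝ :=
  (∫ y, gaussExp A a y)⁻¹ * gaussExp A a x

/-- The Gaussian measure `dμ = μ(x) dx`. -/
def gaussMeasure {N n : ℕ} (A : Matrix (Fin N) (Fin N) ℝ) (a : Fin n → E N) : Measure (E N) :=
  volume.withDensity fun x => ENNReal.ofReal (density A a x)

/-- The real Hilbert space `L²_μ`. -/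
abbrev L2 {N n : ℕ} (A : Matrix (Fin N) (Fin N) ℝ) (a : Fin n → E N) : Type :=
  Lp ℝ 2 (gaussMeasure A a)

/-- The multipolar inverse square potential `V(x) = ∑ᵢ c / |x - aᵢ|²`. -/
def potential {N n : ℕ} (c : ℝ) (a : Fin n → E N) (x : E N) : ℝ :=
  ∑ i, c / ‖x - a i‖ ^ 2

/-- `c_o(N) = ((N - 2) / 2)²`. -/
def cO (N : ℕ) : ℝ := (((N : ℝ) - 2) / 2) ^ 2

/-- `r₀ = min_{i ≠ j} |aᵢ - aⱼ| / 2` (used for at least two poles). -/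
def poleRadius {N n : ℕ} (a : Fin n → E N) : ℝ :=
  sInf {r : ℝ | ∃ i j, i ≠ j ∧ r = ‖a i - a j‖} / 2

/-- The constant `K = (k + (n + 1) c) / r₀² + (n / 2) Tr A` of the weighted Hardy inequality.
For a single pole the term coming from the distance between the poles is absent. -/
def hardyConst {N n : ℕ} (A : Matrix (Fin N) (Fin N) ℝ) (a : Fin n → E N) (c k : ℝ) : ℝ :=
  (if 2 ≤ n then (k + (n + 1) * c) / poleRadius a ^ 2 else 0) + n / 2 * A.trace

/-- The differential expression `Lφ = Δφ - ∑ᵢ A (x - aᵢ) · ∇φ`, used for smooth `φ`. -/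
def ouOp {N n : ℕ} (A : Matrix (Fin N) (Fin N) ℝ) (a : Fin n → E N) (φ : E N → ℝ) (x : E N) : ℝ :=
  Laplacian.laplacian φ x - ∑ i, inner ℝ (Matrix.toEuclideanLin A (x - a i)) (gradient φ x)

/-! ### The weighted Sobolev space -/

/-- `g` is the distributional gradient of `f`: for every test function `φ` and every direction
`v`, `∫ f ∂_v φ dx = - ∫ φ ⟨g, v⟩ dx`. -/
def IsWeakGradient {N : ℕ} (f : E N → ℝ) (g : E N → E N) : Prop :=
  ∀ φ : E N → ℝ, ContDiff ℝ ∞ φ → HasCompactSupport φ → ∀ v : E N,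
    ∫ x, f x * fderiv ℝ φ x v = -∫ x, φ x * inner ℝ (g x) v

/-- `H¹_μ`: the functions in `L²_μ` whose distributional gradient is in `(L²_μ)^N`. -/
def H1 {N n : ℕ} (A : Matrix (Fin N) (Fin N) ℝ) (a : Fin n → E N) : Set (L2 A a) :=
  {f | ∃ g : Lp (E N) 2 (gaussMeasure A a), IsWeakGradient f g}

open Classical in
/-- The distributional gradient of an element of `H¹_μ` (and `0` off `H¹_μ`). -/
def weakGrad {N n : ℕ} (A : Matrix (Fin N) (Fin N) ℝ) (a : Fin n → E N) (f : L2 A a) :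
    Lp (E N) 2 (gaussMeasure A a) :=
  if h : ∃ g : Lp (E N) 2 (gaussMeasure A a), IsWeakGradient f g then h.choose else 0

/-! ### Forms on a Hilbert space -/

/-- The data of a form on `H`: a domain and the values `val u v`, which have a meaning for `u` and
`v` in the domain only. The algebraic laws are in `FormOn.IsForm`. -/
structure FormOn (H : Type*) where
  domain : Set H
  val : H → H → ℝ

namespace FormOn

variable {H : Type*} [NormedAddCommGroup H] [InnerProductSpace ℝ H]

/-- The domain is a linear subspace, on which the form is bilinear and symmetric. -/
def IsForm (b : FormOn H) : Prop :=
  (0 ∈ b.domain ∧ (∀ u ∈ b.domain, ∀ v ∈ b.domain, u + v ∈ b.domain) ∧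
    ∀ (r : ℝ), ∀ u ∈ b.domain, r • u ∈ b.domain) ∧
  (∀ u ∈ b.domain, ∀ v ∈ b.domain, ∀ w ∈ b.domain, b.val (u + v) w = b.val u w + b.val v w) ∧
  (∀ (r : ℝ), ∀ u ∈ b.domain, ∀ w ∈ b.domain, b.val (r • u) w = r * b.val u w) ∧
  ∀ u ∈ b.domain, ∀ w ∈ b.domain, b.val u w = b.val w u

/-- `uₙ` lies in the domain, `uₙ → x` in `H`, and `b(uₙ - uₘ, uₙ - uₘ) → 0` as `n, m → ∞`. -/
def Approx (b : FormOn H) (u : ℕ → H) (x : H) : Prop :=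
  (∀ n, u n ∈ b.domain) ∧ Tendsto u atTop (𝓝 x) ∧
    Tendsto (fun p : ℕ × ℕ => b.val (u p.1 - u p.2) (u p.1 - u p.2)) atTop (𝓝 0)

/-- Closed form: if `uₙ` converges to `x` in `H` and is Cauchy for the form, then `x` is in the
domain and `b(uₙ - x, uₙ - x) → 0`. -/
def IsClosed (b : FormOn H) : Prop :=
  ∀ (u : ℕ → H) (x : H), b.Approx u x →
    x ∈ b.domain ∧ Tendsto (fun n => b.val (u n - x) (u n - x)) atTop (𝓝 0)

/-- Closable form: if `uₙ` converges to `0` in `H` and is Cauchy for the form, then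
`b(uₙ, uₙ) → 0`. -/
def IsClosable (b : FormOn H) : Prop :=
  ∀ u : ℕ → H, b.Approx u 0 → Tendsto (fun n => b.val (u n) (u n)) atTop (𝓝 0)

/-- `b` is the closure of `a`: the domain of `b` consists of the limits in `H` of the sequences
that are Cauchy for the form `a`, and `b(x, y) = lim a(uₙ, vₙ)` along any such sequences. -/
def IsClosureOf (b a : FormOn H) : Prop :=
  (∀ x, x ∈ b.domain ↔ ∃ u, a.Approx u x) ∧
  ∀ (x y : H) (u v : ℕ → H), a.Approx u x → a.Approx v y →
    Tendsto (fun n => a.val (u n) (v n)) atTop (𝓝 (b.val x y))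

/-- The graph of the operator `𝒜` associated with the form `b`: `u ∈ D(𝒜)` and `𝒜 u = v` if and
only if `u ∈ D(b)` and `b(u, φ) = ⟨v, φ⟩` for every `φ ∈ D(b)`. -/
def Assoc (b : FormOn H) (u v : H) : Prop :=
  u ∈ b.domain ∧ ∀ φ ∈ b.domain, b.val u φ = inner ℝ v φ

end FormOn

/-- The form `a_μ(u, v) = ∫ ∇u · ∇v dμ` with domain `H¹_μ`. -/
def dirichletForm {N n : ℕ} (A : Matrix (Fin N) (Fin N) ℝ) (a : Fin n → E N) :
    FormOn (L2 A a) where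
  domain := H1 A a
  val u v := ∫ x, inner ℝ (weakGrad A a u x) (weakGrad A a v x) ∂(gaussMeasure A a)

/-- The form `a_c(u, v) = ∫ ∇u · ∇v dμ - c ∑ᵢ ∫ u v / |x - aᵢ|² dμ` with domain `H¹_μ`. -/
def hardyForm {N n : ℕ} (A : Matrix (Fin N) (Fin N) ℝ) (a : Fin n → E N) (c : ℝ) :
    FormOn (L2 A a) where
  domain := H1 A a
  val u v := ∫ x, inner ℝ (weakGrad A a u x) (weakGrad A a v x) ∂(gaussMeasure A a) -
    c * ∑ i, ∫ x, u x * v x / ‖x - a i‖ ^ 2 ∂(gaussMeasure A a)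

/-! ### Semigroups -/

/-- A `C₀`-semigroup of bounded operators on a real Banach space. -/
structure C0Semigroup (X : Type*) [NormedAddCommGroup X] [NormedSpace ℝ X] where
  op : ℝ≥0 → X →L[ℝ] X
  op_zero : op 0 = ContinuousLinearMap.id ℝ X
  op_add : ∀ s t, op (s + t) = (op s).comp (op t)
  tendsto_zero : ∀ f, Tendsto (fun t => op t f) (𝓝 0) (𝓝 f)

/-- The graph of the generator: `f` is in its domain and is mapped to `g` if and only if
`(S(t) f - f) / t → g` as `t → 0⁺`. -/
def C0Semigroup.Generator {X : Type*} [NormedAddCommGroup X] [NormedSpace ℝ X]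
    (S : C0Semigroup X) (f g : X) : Prop :=
  Tendsto (fun t : ℝ≥0 => (t : ℝ)⁻¹ • (S.op t f - f)) (𝓝[>] 0) (𝓝 g)

/-- The open sector `{z ≠ 0 : |arg z| < θ}`. -/
def sector (θ : ℝ) : Set ℂ := {z | z ≠ 0 ∧ |z.arg| < θ}

/-- Analyticity of a `C₀`-semigroup on a real `L²` space: on the complexification `L²(ν; ℂ)` it
extends to a semigroup `T` on a sector of some angle `θ ∈ (0, π/2]` that is holomorphic (in
operator norm) there and strongly continuous at `0` on every smaller sector. -/
def IsAnalyticSemigroup {α : Type*} [MeasurableSpace α] {ν : Measure α}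
    (S : C0Semigroup (Lp ℝ 2 ν)) : Prop :=
  ∃ θ : ℝ, 0 < θ ∧ θ ≤ Real.pi / 2 ∧ ∃ T : ℂ → (Lp ℂ 2 ν →L[ℂ] Lp ℂ 2 ν),
    DifferentiableOn ℂ T (sector θ) ∧
    (∀ z ∈ sector θ, ∀ w ∈ sector θ, T (z + w) = (T z).comp (T w)) ∧
    (∀ θ' : ℝ, 0 < θ' → θ' < θ → ∀ f : Lp ℂ 2 ν,
      Tendsto (fun z => T z f) (𝓝[sector θ'] 0) (𝓝 f)) ∧
    ∀ t : ℝ≥0, 0 < t → ∀ f : Lp ℝ 2 ν,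
      T ((t : ℝ) : ℂ) (Complex.ofRealCLM.compLp f) = Complex.ofRealCLM.compLp (S.op t f)

end Multipolar

end

open Multipolar

/-! The analytic core is the weighted Hardy inequality with `k = 8`, which is below π². Write b = ∑
A(x - aᵢ) = -∇ log μ. For a C¹ field F and a test function φ, expanding ∫ |∇φ + φF|² dμ ≥ 0 and
integrating by parts gives ∫ |∇φ|² dμ ≥ ∫ φ² (div F - F·b - |F|²) dμ (`integral_sq_mul_field_le`).
With F = G - b/2 the terms in G·b cancel, and the bracket is div G - |G|² + |b|²/4 - (n/2) Tr A. Now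
G is a sum of regularizations of m(x - aᵢ)/|x - aᵢ|², m = (N-2)/2, each multiplied by the square of
(1 - |x - aᵢ|²/r₀²)₊. The supports meet at most on their boundaries, so only one pole is active at a
time. The cutoff costs at most (8 + 2m²)/r₀², and each of the other n - 1 poles contributes at most
m²/r₀² to the potential; together this is (8 + (n+1)m²)/r₀² (`le_sum_radialField`). A single pole
needs no cutoff. The regularization is removed by Fatou's lemma (`hardy_aux`), and c < c_o follows
by scaling with c/c_o.

Closedness and closability. For c < c_o the inequality leaves a positive multiple of ∫ |∇u|² dμ, so
a_c inherits closedness from the weak gradient. At c = c_o this margin is lost. But points have zero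
capacity when N ≥ 3, so test functions vanishing near the poles are dense in H¹_μ. They lie in the
domain of the operator of the form, and such density forces closability
(`FormOn.isClosable_of_dense_operator_domain`).

Generation. The form plus K + 1 is an inner product whose norm dominates that of L²_μ. The inclusion
J of the resulting Hilbert space gives the resolvent R = J J* = (K + 1 + 𝒜)⁻¹, an injective positive
self-adjoint contraction (`FormOn.exists_resolvent`). The semigroup is exp((K+1)t) exp(-tR⁻¹), where
the last factor is the function exp(-t/r) of the complexified R. Everything about it comes from
scalar estimates on 0 ≤ r ≤ 1: holomorphy on the right half-plane, the bound e^{Kt}, the generator,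
and Euler's formula with an explicit error on the range of R².

Approximation and positivity. The forms with potential min(V, cj) decrease to a_c on H¹_μ. Comparing
the energies minimized by the resolvents gives strong resolvent convergence (`tendsto_of_energy`),
hence convergence of the semigroups (`tendsto_realSg`). A weak maximum principle
(`nonneg_of_weak_solution`) makes the Euler steps of the bounded problems positive and increasing in
j. Euler's formula transfers this to the semigroups, and positivity of S(t) follows in the limit. -/

noncomputable section

set_option linter.unusedSectionVars false

namespace Multipolar

/-! ### Closed and closable forms through their energy space -/

namespace FormOn

variable {H : Type*} [NormedAddCommGroup H] [InnerProductSpace ℝ H]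

/-- The form is bounded below by `-K`. -/
def IsSemibounded (b : FormOn H) (K : ℝ) : Prop :=
  ∀ u ∈ b.domain, -K * ‖u‖ ^ 2 ≤ b.val u u

/-- The domain of a form as a submodule. -/
def IsForm.submodule {b : FormOn H} (h : b.IsForm) : Submodule ℝ H where
  carrier := b.domain
  add_mem' := fun hu hv => h.1.2.1 _ hu _ hv
  zero_mem' := h.1.1
  smul_mem' := fun r _ hu => h.1.2.2 r _ hu

theorem IsForm.sub_mem {b : FormOn H} (h : b.IsForm) {u v : H} (hu : u ∈ b.domain)
    (hv : v ∈ b.domain) : u - v ∈ b.domain :=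
  h.submodule.sub_mem hu hv

/-- The domain of a semibounded form, equipped with the inner product `b + (K + 1)`. -/
def EnergySpace (b : FormOn H) (K : ℝ) (h : b.IsForm) (_ : b.IsSemibounded K) : Type _ :=
  h.submodule

namespace EnergySpace

variable {b : FormOn H} {K : ℝ} {h : b.IsForm} {hK : b.IsSemibounded K}

instance : AddCommGroup (EnergySpace b K h hK) := inferInstanceAs (AddCommGroup h.submodule)
instance : Module ℝ (EnergySpace b K h hK) := inferInstanceAs (Module ℝ h.submodule)

/-- The inclusion of the form domain, as a linear map. -/
def inclₗ : EnergySpace b K h hK →ₗ[ℝ] H := h.submodule.subtype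

theorem inclₗ_mem (x : EnergySpace b K h hK) : inclₗ x ∈ b.domain := x.2

theorem inclₗ_injective : Function.Injective (inclₗ : EnergySpace b K h hK →ₗ[ℝ] H) :=
  Subtype.val_injective

theorem exists_inclₗ_eq {u : H} (hu : u ∈ b.domain) :
    ∃ x : EnergySpace b K h hK, inclₗ x = u := ⟨⟨u, hu⟩, rfl⟩

/-- The inner product `b + (K + 1)` on the form domain. -/
@[reducible] def core : InnerProductSpace.Core ℝ (EnergySpace b K h hK) where
  -- The shift is `K + 1` and not `K`: semiboundedness then makes this norm dominate the norm of
  -- `H`, which yields definiteness and a contractive inclusion.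
  inner x y := b.val (inclₗ x) (inclₗ y) + (K + 1) * inner ℝ (inclₗ x) (inclₗ y)
  conj_inner_symm x y := by
    simp only [conj_trivial]
    rw [h.2.2.2 _ (inclₗ_mem y) _ (inclₗ_mem x), real_inner_comm]
  re_inner_nonneg x := by
    have h1 := hK _ (inclₗ_mem x)
    simp only [RCLike.re_to_real, real_inner_self_eq_norm_sq]
    nlinarith [sq_nonneg ‖inclₗ x‖]
  add_left x y z := by
    simp only [map_add]
    rw [h.2.1 _ (inclₗ_mem x) _ (inclₗ_mem y) _ (inclₗ_mem z), inner_add_left]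
    ring
  smul_left x y r := by
    simp only [map_smul, conj_trivial]
    rw [h.2.2.1 r _ (inclₗ_mem x) _ (inclₗ_mem y), real_inner_smul_left]
    ring
  definite x hx := by
    have h1 := hK _ (inclₗ_mem x)
    simp only [real_inner_self_eq_norm_sq] at hx
    have h2 : ‖inclₗ x‖ ^ 2 ≤ 0 := by nlinarith
    have h3 : ‖inclₗ x‖ = 0 := by nlinarith [norm_nonneg (inclₗ x)]
    exact inclₗ_injective (by simpa using h3)

instance : NormedAddCommGroup (EnergySpace b K h hK) :=
  @InnerProductSpace.Core.toNormedAddCommGroup ℝ _ _ _ _ core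

instance : InnerProductSpace ℝ (EnergySpace b K h hK) :=
  InnerProductSpace.ofCore core.toCore

theorem inner_def (x y : EnergySpace b K h hK) :
    inner ℝ x y = b.val (inclₗ x) (inclₗ y) + (K + 1) * inner ℝ (inclₗ x) (inclₗ y) := rfl

theorem norm_sq (x : EnergySpace b K h hK) :
    ‖x‖ ^ 2 = b.val (inclₗ x) (inclₗ x) + (K + 1) * ‖inclₗ x‖ ^ 2 := by
  rw [← real_inner_self_eq_norm_sq, inner_def, real_inner_self_eq_norm_sq]

theorem norm_inclₗ_le (x : EnergySpace b K h hK) : ‖inclₗ x‖ ≤ ‖x‖ := by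
  have h1 := hK _ (inclₗ_mem x)
  have h2 := norm_sq x
  exact abs_le_of_sq_le_sq' (by nlinarith) (norm_nonneg x) |>.2

/-- The inclusion of the form domain, as a continuous linear map. -/
def incl : EnergySpace b K h hK →L[ℝ] H :=
  inclₗ.mkContinuous 1 fun x => by simpa using norm_inclₗ_le x

@[simp] theorem inclₗ_eq (x : EnergySpace b K h hK) : inclₗ x = incl x := rfl

theorem norm_incl_le (x : EnergySpace b K h hK) : ‖incl x‖ ≤ ‖x‖ := norm_inclₗ_le x

/-- The energy norm squared and `b` differ by `(K + 1) ‖·‖²`, which is negligible along families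
that are null in `H`. -/
theorem tendsto_zero_iff {ι : Type*} {l : Filter ι} {w : ι → EnergySpace b K h hK}
    (hw : Tendsto (fun i => incl (w i)) l (𝓝 0)) :
    Tendsto w l (𝓝 0) ↔ Tendsto (fun i => b.val (incl (w i)) (incl (w i))) l (𝓝 0) := by
  have e : ∀ i, ‖w i‖ ^ 2 = b.val (incl (w i)) (incl (w i)) + (K + 1) * ‖incl (w i)‖ ^ 2 :=
    fun i => norm_sq (w i)
  have hz : Tendsto (fun i => (K + 1) * ‖incl (w i)‖ ^ 2) l (𝓝 0) := by
    simpa using ((hw.norm.pow 2).const_mul (K + 1))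
  rw [tendsto_zero_iff_norm_tendsto_zero]
  constructor
  · intro hn
    have := (hn.pow 2).sub hz
    simpa [e] using this
  · intro hb
    have h2 : Tendsto (fun i => ‖w i‖ ^ 2) l (𝓝 0) := by
      simpa [e] using hb.add hz
    have := h2.sqrt
    simpa using this

/-- Dictionary between `Approx` and Cauchy sequences of the energy space; through it closedness
becomes completeness and closability becomes injectivity of an extended inclusion. -/
theorem cauchySeq_iff {w : ℕ → EnergySpace b K h hK} {x : H}
    (hw : Tendsto (fun i => incl (w i)) atTop (𝓝 x)) :
    CauchySeq w ↔ b.Approx (fun i => incl (w i)) x := by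
  have hd : Tendsto (fun p : ℕ × ℕ => incl (w p.1 - w p.2)) atTop (𝓝 0) := by
    have := (hw.comp tendsto_fst).sub (hw.comp tendsto_snd)
    rw [prod_atTop_atTop_eq] at this
    simpa using this
  have key : CauchySeq w ↔ Tendsto (fun p : ℕ × ℕ => w p.1 - w p.2) atTop (𝓝 0) := by
    rw [cauchySeq_iff_tendsto_dist_atTop_0,
      tendsto_zero_iff_norm_tendsto_zero (f := fun p : ℕ × ℕ => w p.1 - w p.2)]
    simp only [dist_eq_norm]
  rw [key, tendsto_zero_iff hd]
  constructor
  · intro h1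
    exact ⟨fun n => inclₗ_mem _, hw, by simpa using h1⟩
  · intro h1
    simpa using h1.2.2

/-- The sequences approximating `x` are the images of the Cauchy sequences of the energy space. -/
theorem exists_of_approx {u : ℕ → H} {x : H} (hu : b.Approx u x) :
    ∃ w : ℕ → EnergySpace b K h hK, CauchySeq w ∧ (∀ n, incl (w n) = u n) := by
  choose w hw using fun n => exists_inclₗ_eq (h := h) (hK := hK) (hu.1 n)
  have hw' : ∀ n, incl (w n) = u n := hw
  refine ⟨w, (cauchySeq_iff (x := x) ?_).2 ?_, hw'⟩
  · simpa [hw'] using hu.2.1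
  · simpa [hw'] using hu

theorem completeSpace (hb : b.IsClosed) [CompleteSpace H] :
    CompleteSpace (EnergySpace b K h hK) := by
  refine Metric.complete_of_cauchySeq_tendsto fun w hw => ?_
  obtain ⟨x, hx⟩ := cauchySeq_tendsto_of_complete (incl.uniformContinuous.comp_cauchySeq hw)
  have hx' : Tendsto (fun i => incl (w i)) atTop (𝓝 x) := hx
  obtain ⟨hxd, ht⟩ := hb _ x ((cauchySeq_iff hx').1 hw)
  obtain ⟨y, hy⟩ := exists_inclₗ_eq (h := h) (hK := hK) hxd
  rw [inclₗ_eq] at hy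
  refine ⟨y, ?_⟩
  have : Tendsto (fun i => w i - y) atTop (𝓝 0) := by
    rw [tendsto_zero_iff]
    · simpa [hy] using ht
    · simpa [hy] using hx'.sub_const x
  simpa using this.add_const y

end EnergySpace

/-- The resolvent `(K + 1 + 𝒜)⁻¹` of the operator associated with a closed semibounded form. -/
theorem exists_resolvent [CompleteSpace H] {b : FormOn H} {K : ℝ} (h : b.IsForm)
    (hK : b.IsSemibounded K) (hb : b.IsClosed) (hd : Dense b.domain) :
    ∃ R : H →L[ℝ] H, (∀ x y, inner ℝ (R x) y = inner ℝ x (R y)) ∧ (∀ x, 0 ≤ inner ℝ (R x) x) ∧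
      (∀ x, ‖R x‖ ≤ ‖x‖) ∧ Function.Injective R ∧
      ∀ u v, b.Assoc u v ↔ R (v + (K + 1) • u) = u := by
  have : CompleteSpace (EnergySpace b K h hK) := EnergySpace.completeSpace hb
  let J : EnergySpace b K h hK →L[ℝ] H := EnergySpace.incl
  have hJ : ∀ x, ‖J x‖ ≤ ‖x‖ := EnergySpace.norm_incl_le
  have hJn : ‖J‖ ≤ 1 := J.opNorm_le_bound zero_le_one (by simpa using hJ)
  have hA : ∀ x y, inner ℝ (J.adjoint x) y = inner ℝ x (J y) := fun x y =>
    ContinuousLinearMap.adjoint_inner_left J y x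
  -- The choice `R = J J*` is the Riesz representation of the functional `⟨x, J ·⟩`: by `hA`, `b(R
  -- x, ·) + (K + 1)⟨R x, ·⟩ = ⟨x, ·⟩` on the form domain.
  refine ⟨J.comp J.adjoint, fun x y => ?_, fun x => ?_, fun x => ?_, ?_, fun u v => ?_⟩
  · simp only [ContinuousLinearMap.comp_apply]
    rw [← hA, real_inner_comm, ← hA, real_inner_comm]
  · simp only [ContinuousLinearMap.comp_apply]
    rw [real_inner_comm, ← hA]
    exact real_inner_self_nonneg
  · refine (hJ _).trans ((J.adjoint.le_opNorm x).trans ?_)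
    rw [LinearIsometryEquiv.norm_map]
    nlinarith [norm_nonneg x]
  · intro x y hxy
    have h1 : J.adjoint x = J.adjoint y := EnergySpace.inclₗ_injective hxy
    -- Equal adjoint images mean that `x - y` annihilates the form domain, which is dense.
    have h2 : ∀ z ∈ b.domain, inner ℝ (x - y) z = 0 := by
      intro z hz
      obtain ⟨z', rfl⟩ := EnergySpace.exists_inclₗ_eq (h := h) (hK := hK) hz
      change inner ℝ (x - y) (J z') = 0
      rw [← hA, map_sub, h1, sub_self, inner_zero_left]
    have h3 : x - y = 0 := hd.eq_zero_of_inner_left ℝ h2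
    exact sub_eq_zero.1 h3
  · constructor
    · rintro ⟨hu, hv⟩
      obtain ⟨u, rfl⟩ := EnergySpace.exists_inclₗ_eq (h := h) (hK := hK) hu
      simp only [ContinuousLinearMap.comp_apply, EnergySpace.inclₗ_eq]
      congr 1
      refine ext_inner_right ℝ fun z => ?_
      rw [hA, inner_add_left, real_inner_smul_left, EnergySpace.inner_def]
      have := hv _ (EnergySpace.inclₗ_mem z)
      simp only [EnergySpace.inclₗ_eq] at this ⊢
      rw [this]
    · intro hu
      have hu' : J (J.adjoint (v + (K + 1) • u)) = u := hu
      refine ⟨by rw [← hu]; exact EnergySpace.inclₗ_mem (J.adjoint (v + (K + 1) • u)), ?_⟩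
      intro φ hφ
      obtain ⟨z, rfl⟩ := EnergySpace.exists_inclₗ_eq (h := h) (hK := hK) hφ
      have h1 := hA (v + (K + 1) • u) z
      rw [EnergySpace.inner_def, inner_add_left, real_inner_smul_left] at h1
      simp only [EnergySpace.inclₗ_eq] at h1 ⊢
      change b.val (J (J.adjoint (v + (K + 1) • u))) _ +
        (K + 1) * inner ℝ (J (J.adjoint (v + (K + 1) • u))) _ = _ at h1
      rw [hu'] at h1
      change _ = inner ℝ v (J z) + (K + 1) * inner ℝ u (J z) at h1
      change b.val u (J z) = inner ℝ v (J z)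
      have h2 : b.val u (J z) + (K + 1) * inner ℝ u (J z) =
        inner ℝ v (J z) + (K + 1) * inner ℝ u (J z) := h1
      linarith

/-- The closure of a closable semibounded form. -/
theorem exists_closure [CompleteSpace H] {b : FormOn H} {K : ℝ} (h : b.IsForm)
    (hK : b.IsSemibounded K) (hb : b.IsClosable) :
    ∃ c : FormOn H, c.IsClosureOf b ∧ c.IsForm ∧ c.IsClosed := by
  let V := EnergySpace b K h hK
  let C := UniformSpace.Completion V
  let J : V →L[ℝ] H := EnergySpace.incl
  let I : V →L[ℝ] C := (UniformSpace.Completion.toComplₗᵢ (𝕜 := ℝ) (E := V)).toContinuousLinearMap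
  have hI : ∀ x, ‖I x‖ = ‖x‖ := (UniformSpace.Completion.toComplₗᵢ (𝕜 := ℝ) (E := V)).norm_map
  have hIi : IsUniformInducing I :=
    (UniformSpace.Completion.toComplₗᵢ (𝕜 := ℝ) (E := V)).isometry.isUniformInducing
  have hId : DenseRange I := UniformSpace.Completion.denseRange_coe
  -- The closure lives on the image in `H` of the abstract completion of the energy space.
  let Jc : C →L[ℝ] H := J.extend I
  have hJc : ∀ x, Jc (I x) = J x := fun x => J.extend_eq hId hIi x
  have hII : ∀ x y, inner ℝ (I x) (I y) = inner ℝ x y :=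
    (UniformSpace.Completion.toComplₗᵢ (𝕜 := ℝ) (E := V)).inner_map_map
  have hseq : ∀ y : C, ∃ w : ℕ → V, Tendsto (fun n => I (w n)) atTop (𝓝 y) := by
    intro y
    obtain ⟨s, hs, hs'⟩ := mem_closure_iff_seq_limit.1 (hId y)
    choose w hw using hs
    exact ⟨w, by simpa [hw] using hs'⟩
  have happ : ∀ (w : ℕ → V) (y : C), Tendsto (fun n => I (w n)) atTop (𝓝 y) →
      b.Approx (fun n => J (w n)) (Jc y) := by
    intro w y hw
    have h1 : CauchySeq w := by
      have := hw.cauchySeq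
      have h2 : Cauchy (map I (map w atTop)) := by rw [Filter.map_map]; exact this
      exact hIi.cauchy_map_iff.1 h2
    refine (EnergySpace.cauchySeq_iff ?_).1 h1
    have := (Jc.continuous.tendsto y).comp hw
    simpa [Function.comp_def, hJc] using this
  -- This is where closability enters: an element of the kernel is the limit of an energy-Cauchy
  -- sequence tending to zero in `H`, so its energy tends to zero as well.
  have hinj : Function.Injective Jc := by
    rw [injective_iff_map_eq_zero]
    intro y hy
    obtain ⟨w, hw⟩ := hseq y
    have h1 := happ w y hw
    rw [hy] at h1
    have h2 : Tendsto w atTop (𝓝 0) := (EnergySpace.tendsto_zero_iff h1.2.1).2 (hb _ h1)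
    have h3 := (I.continuous.tendsto 0).comp h2
    rw [map_zero] at h3
    exact tendsto_nhds_unique hw h3
  have happ' : ∀ (u : ℕ → H) (x : H), b.Approx u x → ∃ (w : ℕ → V) (y : C),
      Tendsto (fun n => I (w n)) atTop (𝓝 y) ∧ (∀ n, J (w n) = u n) ∧ Jc y = x := by
    intro u x hu
    obtain ⟨w, hw, hwu⟩ := EnergySpace.exists_of_approx (h := h) (hK := hK) hu
    obtain ⟨y, hy⟩ := cauchySeq_tendsto_of_complete (I.uniformContinuous.comp_cauchySeq hw)
    refine ⟨w, y, hy, hwu, ?_⟩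
    have := (Jc.continuous.tendsto y).comp hy
    refine tendsto_nhds_unique this ?_
    have e : (Jc ∘ fun n => I (w n)) = u := by
      funext n
      simp only [Function.comp_apply, hJc]
      exact hwu n
    change Tendsto (Jc ∘ fun n => I (w n)) atTop _
    rw [e]
    exact hu.2.1
  -- Off the range of `Jc` the values of `g` are arbitrary, and the form `c` is only tested on that
  -- range.
  let g : H → C := Function.invFun Jc
  have hg : ∀ y, g (Jc y) = y := Function.leftInverse_invFun hinj
  let c : FormOn H := ⟨Set.range Jc, fun x y => inner ℝ (g x) (g y) - (K + 1) * inner ℝ x y⟩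
  have hcv : ∀ x y, c.val (Jc x) (Jc y) = inner ℝ x y - (K + 1) * inner ℝ (Jc x) (Jc y) := by
    intro x y
    simp only [c, hg]
  refine ⟨c, ⟨fun x => ⟨?_, ?_⟩, ?_⟩, ⟨⟨?_, ?_, ?_⟩, ?_, ?_, ?_⟩, ?_⟩
  · rintro ⟨y, rfl⟩
    obtain ⟨w, hw⟩ := hseq y
    exact ⟨_, happ w y hw⟩
  · rintro ⟨u, hu⟩
    obtain ⟨w, y, -, -, rfl⟩ := happ' u x hu
    exact ⟨y, rfl⟩
  · intro x y u v hu hv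
    obtain ⟨w, x, hw, hwu, rfl⟩ := happ' u x hu
    obtain ⟨z, y, hz, hzv, rfl⟩ := happ' v y hv
    rw [hcv]
    have h1 := (hw.inner (𝕜 := ℝ) hz).sub ((hu.2.1.inner (𝕜 := ℝ) hv.2.1).const_mul (K + 1))
    refine h1.congr fun n => ?_
    rw [hII, EnergySpace.inner_def]
    simp only [EnergySpace.inclₗ_eq]
    rw [← hwu, ← hzv]
    simp only [J]
    ring
  · exact ⟨0, map_zero _⟩
  · rintro _ ⟨x, rfl⟩ _ ⟨y, rfl⟩
    exact ⟨x + y, map_add _ _ _⟩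
  · rintro r _ ⟨x, rfl⟩
    exact ⟨r • x, map_smul _ _ _⟩
  · rintro _ ⟨x, rfl⟩ _ ⟨y, rfl⟩ _ ⟨z, rfl⟩
    rw [← map_add, hcv, hcv, hcv, map_add, inner_add_left, inner_add_left]
    ring
  · rintro r _ ⟨x, rfl⟩ _ ⟨y, rfl⟩
    rw [← map_smul, hcv, hcv, map_smul, real_inner_smul_left, real_inner_smul_left]
    ring
  · rintro _ ⟨x, rfl⟩ _ ⟨y, rfl⟩
    rw [hcv, hcv, real_inner_comm x y, real_inner_comm (Jc x)]
  · intro u x hu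
    choose w hw using hu.1
    obtain rfl : (fun n => Jc (w n)) = u := funext hw
    have hd : Tendsto (fun p : ℕ × ℕ => Jc (w p.1 - w p.2)) atTop (𝓝 0) := by
      have := (hu.2.1.comp tendsto_fst).sub (hu.2.1.comp tendsto_snd)
      rw [prod_atTop_atTop_eq] at this
      simpa using this
    have hn : ∀ y : C, ‖y‖ ^ 2 = c.val (Jc y) (Jc y) + (K + 1) * ‖Jc y‖ ^ 2 := by
      intro y
      rw [hcv, real_inner_self_eq_norm_sq, real_inner_self_eq_norm_sq]
      ring
    have hC : CauchySeq w := by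
      rw [cauchySeq_iff_tendsto_dist_atTop_0]
      have h2 : Tendsto (fun p : ℕ × ℕ => ‖w p.1 - w p.2‖ ^ 2) atTop (𝓝 0) := by
        have := hu.2.2.add ((hd.norm.pow 2).const_mul (K + 1))
        simp only [norm_zero, ne_eq, OfNat.ofNat_ne_zero, not_false_eq_true, zero_pow, mul_zero,
          add_zero] at this
        refine this.congr fun p => ?_
        rw [hn, map_sub]
      have := h2.sqrt
      rw [Real.sqrt_zero] at this
      refine this.congr fun p => ?_
      rw [Real.sqrt_sq (norm_nonneg _), dist_eq_norm]
    obtain ⟨y, hy⟩ := cauchySeq_tendsto_of_complete hC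
    have hy2 := (Jc.continuous.tendsto y).comp hy
    obtain rfl : Jc y = x := tendsto_nhds_unique hy2 hu.2.1
    refine ⟨⟨y, rfl⟩, ?_⟩
    have h3 : Tendsto (fun n => w n - y) atTop (𝓝 0) := by simpa using hy.sub_const y
    have h4 := (h3.norm.pow 2).sub ((((Jc.continuous.tendsto 0).comp h3).norm.pow 2).const_mul (K + 1))
    simp only [map_zero, norm_zero, ne_eq, OfNat.ofNat_ne_zero, not_false_eq_true, zero_pow,
      mul_zero, sub_zero] at h4
    refine h4.congr fun n => ?_
    simp only [Function.comp_apply]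
    rw [hn, map_sub]
    ring

theorem IsClosureOf.isSemibounded {b c : FormOn H} {K : ℝ} (h : c.IsClosureOf b)
    (hK : b.IsSemibounded K) : c.IsSemibounded K := by
  intro x hx
  obtain ⟨u, hu⟩ := (h.1 x).1 hx
  exact le_of_tendsto_of_tendsto' ((hu.2.1.norm.pow 2).const_mul (-K)) (h.2 x x u u hu hu)
    fun n => hK _ (hu.1 n)

theorem approx_const {b : FormOn H} (h : b.IsForm) {x : H} (hx : x ∈ b.domain) :
    b.Approx (fun _ => x) x := by
  refine ⟨fun _ => hx, tendsto_const_nhds, ?_⟩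
  have : b.val (x - x) (x - x) = 0 := by
    have := h.2.2.1 0 x hx (x - x) (h.sub_mem hx hx)
    simpa using this
  simp only [this]
  exact tendsto_const_nhds

theorem IsClosureOf.subset {b c : FormOn H} (h : c.IsClosureOf b) (hb : b.IsForm) :
    b.domain ⊆ c.domain := fun x hx => (h.1 x).2 ⟨_, approx_const hb hx⟩

theorem IsClosureOf.val_eq {b c : FormOn H} (h : c.IsClosureOf b) (hb : b.IsForm) {x y : H}
    (hx : x ∈ b.domain) (hy : y ∈ b.domain) : c.val x y = b.val x y :=
  tendsto_nhds_unique (h.2 x y _ _ (approx_const hb hx) (approx_const hb hy)) tendsto_const_nhds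

/-- A closed semibounded form is its own closure. -/
theorem IsClosed.isClosureOf_self {b : FormOn H} {K : ℝ} (hb : b.IsClosed) (h : b.IsForm)
    (hK : b.IsSemibounded K) : b.IsClosureOf b := by
  have key : ∀ (x : H) (u : ℕ → H), b.Approx u x →
      ∃ (w : ℕ → EnergySpace b K h hK) (y : EnergySpace b K h hK),
      Tendsto w atTop (𝓝 y) ∧ (∀ n, EnergySpace.incl (w n) = u n) ∧ EnergySpace.incl y = x := by
    intro x u hu
    obtain ⟨hx, ht⟩ := hb u x hu
    obtain ⟨w, hw, hwu⟩ := EnergySpace.exists_of_approx (h := h) (hK := hK) hu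
    obtain ⟨y, hy⟩ := EnergySpace.exists_inclₗ_eq (h := h) (hK := hK) hx
    rw [EnergySpace.inclₗ_eq] at hy
    refine ⟨w, y, ?_, hwu, hy⟩
    have : Tendsto (fun i => w i - y) atTop (𝓝 0) := by
      rw [EnergySpace.tendsto_zero_iff]
      · simpa [hy, hwu] using ht
      · simpa [hy, hwu] using hu.2.1.sub_const x
    simpa using this.add_const y
  refine ⟨fun x => ⟨fun hx => ⟨_, approx_const h hx⟩, fun ⟨u, hu⟩ => (hb u x hu).1⟩, ?_⟩
  intro x y u v hu hv
  obtain ⟨w, x, hw, hwu, rfl⟩ := key x u hu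
  obtain ⟨z, y, hz, hzv, rfl⟩ := key y v hv
  have h1 := (hw.inner (𝕜 := ℝ) hz).sub ((hu.2.1.inner (𝕜 := ℝ) hv.2.1).const_mul (K + 1))
  rw [EnergySpace.inner_def] at h1
  simp only [EnergySpace.inclₗ_eq, add_sub_cancel_right] at h1
  refine h1.congr fun n => ?_
  rw [EnergySpace.inner_def]
  simp only [EnergySpace.inclₗ_eq, hwu, hzv]
  ring

/-- A form is closable if a set of elements in the domain of its operator is dense for the form
norm. -/
theorem isClosable_of_dense_operator_domain [CompleteSpace H] {b : FormOn H} {K : ℝ} (h : b.IsForm)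
    (hK : b.IsSemibounded K)
    (hd : ∀ u ∈ b.domain, ∃ w : ℕ → H, (∀ n, ∃ v, b.Assoc (w n) v) ∧
      Tendsto w atTop (𝓝 u) ∧ Tendsto (fun n => b.val (w n - u) (w n - u)) atTop (𝓝 0)) :
    b.IsClosable := by
  intro u hu
  obtain ⟨w, hw, hwu⟩ := EnergySpace.exists_of_approx (h := h) (hK := hK) hu
  -- The sequence is weakly null in the energy space. Against an element of the operator domain the
  -- energy product is an `H` product with `u n`, which tends to zero; density and boundedness of
  -- the sequence give the rest.
  have hzero : ∀ z : EnergySpace b K h hK, Tendsto (fun n => inner ℝ z (w n)) atTop (𝓝 0) := by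
    intro z
    obtain ⟨M, hM⟩ := hw.norm_bddAbove
    have hM' : ∀ n, ‖w n‖ ≤ M := fun n => hM ⟨n, rfl⟩
    have hM0 : 0 ≤ M := (norm_nonneg _).trans (hM' 0)
    rw [Metric.tendsto_atTop]
    intro ε hε
    obtain ⟨q, hq, hq1, hq2⟩ := hd _ (EnergySpace.inclₗ_mem z)
    choose q' hq' using fun n => EnergySpace.exists_inclₗ_eq (h := h) (hK := hK) (hq n).choose_spec.1
    have hq'' : ∀ n, EnergySpace.incl (q' n) = q n := hq'
    have hqz : Tendsto (fun n => q' n - z) atTop (𝓝 0) := by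
      rw [EnergySpace.tendsto_zero_iff]
      · simpa [hq''] using hq2
      · simpa [hq''] using hq1.sub_const (EnergySpace.incl z)
    obtain ⟨N, hN⟩ := (Metric.tendsto_atTop.1 hqz) (ε / (2 * (M + 1))) (by positivity)
    have hN' : ‖q' N - z‖ < ε / (2 * (M + 1)) := by simpa using hN N le_rfl
    obtain ⟨v, hv⟩ := hq N
    have hin : ∀ n, inner ℝ (q' N) (w n) = inner ℝ (v + (K + 1) • q N) (u n) := by
      intro n
      rw [EnergySpace.inner_def, inner_add_left, real_inner_smul_left]
      simp only [EnergySpace.inclₗ_eq, hq'', hwu]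
      rw [hv.2 _ (hu.1 n)]
    have ht : Tendsto (fun n => inner ℝ (q' N) (w n)) atTop (𝓝 0) := by
      simp only [hin]
      have := (tendsto_const_nhds (x := v + (K + 1) • q N)).inner (𝕜 := ℝ) hu.2.1
      simpa using this
    obtain ⟨N', hN'2⟩ := (Metric.tendsto_atTop.1 ht) (ε / 2) (by positivity)
    refine ⟨N', fun n hn => ?_⟩
    have h1 := hN'2 n hn
    rw [Real.dist_eq, sub_zero] at h1 ⊢
    have h2 : inner ℝ z (w n) = inner ℝ (q' N) (w n) - inner ℝ (q' N - z) (w n) := by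
      rw [inner_sub_left]; ring
    have h3 : |inner ℝ (q' N - z) (w n)| ≤ ‖q' N - z‖ * ‖w n‖ := abs_real_inner_le_norm _ _
    have h4 : ‖q' N - z‖ * ‖w n‖ ≤ ε / (2 * (M + 1)) * (M + 1) := by
      gcongr
      linarith [hM' n]
    have h5 : ε / (2 * (M + 1)) * (M + 1) = ε / 2 := by field_simp
    rw [h2]
    calc _ ≤ |inner ℝ (q' N) (w n)| + |inner ℝ (q' N - z) (w n)| := abs_sub _ _
      _ < ε := by linarith
  -- A Cauchy sequence that is weakly null is null: `‖w n‖² = ⟨w n, w k⟩ + ⟨w n, w n - w k⟩`, where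
  -- the second term is small uniformly for large `n`, `k` and the first vanishes as `k → ∞`.
  have hlim : Tendsto w atTop (𝓝 0) := by
    rw [Metric.tendsto_atTop]
    intro ε hε
    obtain ⟨M, hM⟩ := hw.norm_bddAbove
    have hM' : ∀ n, ‖w n‖ ≤ M := fun n => hM ⟨n, rfl⟩
    have hM0 : 0 ≤ M := (norm_nonneg _).trans (hM' 0)
    obtain ⟨N, hN⟩ := Metric.cauchySeq_iff.1 hw (ε ^ 2 / (2 * (M + 1))) (by positivity)
    refine ⟨N, fun n hn => ?_⟩
    have h1 : ‖w n‖ ^ 2 ≤ ε ^ 2 / 2 := by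
      refine le_of_tendsto_of_tendsto (f := fun _ : ℕ => ‖w n‖ ^ 2)
        (g := fun k => inner ℝ (w n) (w k) + ε ^ 2 / 2) (b := atTop) tendsto_const_nhds
        (by simpa using (hzero (w n)).add_const (ε ^ 2 / 2)) ?_
      filter_upwards [eventually_ge_atTop N] with k hk
      have h2 := hN n hn k hk
      rw [dist_eq_norm] at h2
      have h3 : ‖w n‖ ^ 2 = inner ℝ (w n) (w k) + inner ℝ (w n) (w n - w k) := by
        rw [← inner_add_right, add_sub_cancel, real_inner_self_eq_norm_sq]
      have h4 := real_inner_le_norm (w n) (w n - w k)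
      have h5 : ‖w n‖ * ‖w n - w k‖ ≤ (M + 1) * (ε ^ 2 / (2 * (M + 1))) := by
        gcongr
        linarith [hM' n]
      have h6 : (M + 1) * (ε ^ 2 / (2 * (M + 1))) = ε ^ 2 / 2 := by field_simp
      linarith
    rw [dist_zero_right]
    refine lt_of_pow_lt_pow_left₀ 2 hε.le ?_
    have : 0 < ε ^ 2 := by positivity
    linarith
  have h0 : Tendsto (fun i => EnergySpace.incl (w i)) atTop (𝓝 0) := by
    simpa [hwu] using hu.2.1
  simpa [hwu] using (EnergySpace.tendsto_zero_iff h0).1 hlim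

end FormOn

/-! ### Scalar estimates for the functional calculus of the resolvent -/

/-- The function `r ↦ exp (-z / r)` on the positive half line, extended by zero. -/
def expInv (z : ℂ) (r : ℝ) : ℂ := if 0 < r then Complex.exp (-(z / r)) else 0

theorem norm_expInv {z : ℂ} {r : ℝ} (hr : 0 < r) : ‖expInv z r‖ = Real.exp (-(z.re / r)) := by
  rw [expInv, if_pos hr, Complex.norm_exp, Complex.neg_re, Complex.div_ofReal_re]

theorem expInv_of_nonpos {z : ℂ} {r : ℝ} (hr : r ≤ 0) : expInv z r = 0 := if_neg hr.not_gt

theorem norm_expInv_le {z : ℂ} (hz : 0 ≤ z.re) {r : ℝ} (hr : r ≤ 1) :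
    ‖expInv z r‖ ≤ Real.exp (-z.re) := by
  rcases le_or_gt r 0 with h | h
  · rw [expInv_of_nonpos h, norm_zero]
    positivity
  · rw [norm_expInv h, Real.exp_le_exp, neg_le_neg_iff, le_div_iff₀ h]
    nlinarith

theorem expInv_add (z w : ℂ) (r : ℝ) : expInv (z + w) r = expInv z r * expInv w r := by
  rcases le_or_gt r 0 with h | h
  · simp [expInv_of_nonpos h]
  · simp only [expInv, if_pos h, ← Complex.exp_add]
    congr 1
    ring

theorem sq_mul_exp_neg_le {s ρ : ℝ} (hs : 0 ≤ s) (hρ : 0 < ρ) :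
    s ^ 2 * Real.exp (-(ρ * s)) ≤ 2 / ρ ^ 2 := by
  have h1 := Real.quadratic_le_exp_of_nonneg (x := ρ * s) (by positivity)
  rw [Real.exp_neg, ← div_eq_mul_inv, div_le_div_iff₀ (Real.exp_pos _) (by positivity)]
  nlinarith [mul_nonneg hρ.le hs]

/-- Quadratic vanishing at `r = 0` gives continuity of both `expInv z` and its `z`-derivative there,
as the continuous functional calculus requires. -/
theorem norm_expInv_le_mul_sq {z : ℂ} (hz : 0 < z.re) (r : ℝ) :
    ‖expInv z r‖ ≤ 2 / z.re ^ 2 * r ^ 2 := by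
  rcases le_or_gt r 0 with h | h
  · rw [expInv_of_nonpos h, norm_zero]
    positivity
  · rw [norm_expInv h]
    have := sq_mul_exp_neg_le (s := 1 / r) (by positivity) hz
    rw [div_pow, one_pow, one_div_mul_eq_div, div_le_iff₀ (by positivity), mul_one_div] at this
    exact this

theorem continuous_expInv {z : ℂ} (hz : 0 < z.re) : Continuous (expInv z) := by
  rw [continuous_iff_continuousAt]
  intro r
  rcases lt_trichotomy r 0 with h | h | h
  · refine (continuousAt_const (y := (0 : ℂ))).congr ?_
    filter_upwards [gt_mem_nhds h] with s hs using (expInv_of_nonpos (le_of_lt hs)).symm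
  · subst h
    rw [ContinuousAt, expInv_of_nonpos le_rfl]
    refine squeeze_zero_norm (fun r => norm_expInv_le_mul_sq hz r) ?_
    have : Continuous fun r : ℝ => 2 / z.re ^ 2 * r ^ 2 := by fun_prop
    simpa using this.tendsto 0
  · have : ContinuousAt (fun s : ℝ => Complex.exp (-(z / s))) r := by
      have : (r : ℂ) ≠ 0 := by exact_mod_cast h.ne'
      fun_prop (disch := assumption)
    refine this.congr ?_
    filter_upwards [lt_mem_nhds h] with s hs using (if_pos hs).symm

theorem norm_exp_sub_one_le_of_re_nonpos {w : ℂ} (hw : w.re ≤ 0) : ‖Complex.exp w - 1‖ ≤ ‖w‖ := by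
  have h := Convex.norm_image_sub_le_of_norm_hasDerivWithin_le (f := Complex.exp)
    (f' := Complex.exp) (s := {z : ℂ | z.re ≤ 0}) (x := 0) (y := w) (C := 1)
    (fun x _ => (Complex.hasDerivAt_exp x).hasDerivWithinAt)
    (fun x hx => by rw [Complex.norm_exp]; exact Real.exp_le_one_iff.2 hx)
    (convex_halfSpace_re_le 0) (by simp) hw
  simpa using h

/-- The factor `r` absorbs the singularity of `z / r`; in operator terms, convergence at time zero
is quantitative on the range of `R`. -/
theorem norm_expInv_sub_one_mul_le {z : ℂ} (hz : 0 ≤ z.re) {r : ℝ} (hr : 0 ≤ r) :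
    ‖(expInv z r - 1) * r‖ ≤ ‖z‖ := by
  rcases hr.eq_or_lt with rfl | h
  · simp
  · rw [norm_mul, expInv, if_pos h]
    have h1 := norm_exp_sub_one_le_of_re_nonpos (w := -(z / r))
      (by rw [Complex.neg_re, Complex.div_ofReal_re, neg_nonpos]; positivity)
    rw [norm_neg, norm_div, Complex.norm_real, Real.norm_of_nonneg hr] at h1
    rw [Complex.norm_real, Real.norm_of_nonneg hr]
    calc _ ≤ ‖z‖ / r * r := by gcongr
      _ = ‖z‖ := by field_simp

theorem abs_exp_neg_sub_one_add_le {y : ℝ} (hy : 0 ≤ y) : |Real.exp (-y) - 1 + y| ≤ y ^ 2 := by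
  have h1 := Real.add_one_le_exp (-y)
  have h2 := Real.add_one_le_exp y
  have h3 : Real.exp (-y) * Real.exp y = 1 := by rw [← Real.exp_add]; simp
  have h4 : Real.exp (-y) ≤ 1 / (1 + y) := by
    rw [le_div_iff₀ (by positivity)]
    nlinarith [Real.exp_pos (-y)]
  have h5 : 1 / (1 + y) ≤ 1 - y + y ^ 2 := by
    rw [div_le_iff₀ (by positivity)]
    nlinarith [pow_nonneg hy 3]
  rw [abs_le]
  constructor <;> nlinarith [sq_nonneg y]

theorem abs_inv_sub_exp_neg_le {y : ℝ} (hy : 0 ≤ y) :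
    |1 / (1 + y) - Real.exp (-y)| ≤ y ^ 2 := by
  have h1 := Real.add_one_le_exp (-y)
  have h2 := Real.add_one_le_exp y
  have h3 : Real.exp (-y) * Real.exp y = 1 := by rw [← Real.exp_add]; simp
  have h4 : Real.exp (-y) ≤ 1 / (1 + y) := by
    rw [le_div_iff₀ (by positivity)]
    nlinarith [Real.exp_pos (-y)]
  have h5 : 1 / (1 + y) ≤ 1 - y + y ^ 2 := by
    rw [div_le_iff₀ (by positivity)]
    nlinarith [pow_nonneg hy 3]
  rw [abs_le]
  constructor <;> nlinarith [sq_nonneg y]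

theorem expInv_ofReal {t r : ℝ} (hr : 0 < r) : expInv t r = (Real.exp (-(t / r)) : ℝ) := by
  rw [expInv, if_pos hr]
  push_cast
  rfl

/-- Second order Taylor error of `exp (-t / r)`; the factor `r²` makes it uniform in `r`, so the
generator can be computed on the range of `R²`. -/
theorem norm_expInv_generator_le {t r : ℝ} (ht : 0 < t) (hr : 0 ≤ r) :
    ‖(t : ℂ)⁻¹ * (expInv t r - 1) * r ^ 2 + r‖ ≤ t := by
  rcases hr.eq_or_lt with rfl | h
  · simpa using ht.le
  · rw [expInv_ofReal h]
    have h1 := abs_exp_neg_sub_one_add_le (y := t / r) (by positivity)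
    have h2 : (t : ℂ)⁻¹ * ((Real.exp (-(t / r)) : ℝ) - 1) * r ^ 2 + r =
        ((t⁻¹ * r ^ 2 * (Real.exp (-(t / r)) - 1 + t / r) : ℝ) : ℂ) := by
      have : (t : ℂ) ≠ 0 := by exact_mod_cast ht.ne'
      have : (r : ℂ) ≠ 0 := by exact_mod_cast h.ne'
      push_cast
      field_simp
    rw [h2, Complex.norm_real, norm_mul, Real.norm_of_nonneg (by positivity), Real.norm_eq_abs]
    calc _ ≤ t⁻¹ * r ^ 2 * (t / r) ^ 2 := by gcongr
      _ = t := by field_simp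

/-- One implicit Euler step: with `y = s / r`, the numbers `1 / (1 + y)` and `exp (-y)` agree to
first order. -/
theorem norm_euler_sub_expInv_le {s r : ℝ} (hs : 0 < s) (hr : 0 ≤ r) :
    ‖((r / (r + s) : ℝ) - expInv s r) * r ^ 2‖ ≤ s ^ 2 := by
  rcases hr.eq_or_lt with rfl | h
  · simp [sq_nonneg]
  · rw [expInv_ofReal h]
    have h1 := abs_inv_sub_exp_neg_le (y := s / r) (by positivity)
    have h2 : r / (r + s) = 1 / (1 + s / r) := by field_simp
    rw [h2, ← Complex.ofReal_sub, norm_mul, Complex.norm_real, Real.norm_eq_abs, norm_pow,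
      Complex.norm_real, Real.norm_of_nonneg hr]
    calc _ ≤ (s / r) ^ 2 * r ^ 2 := by gcongr
      _ = s ^ 2 := by field_simp

theorem norm_pow_sub_pow_le {a b : ℂ} (ha : ‖a‖ ≤ 1) (hb : ‖b‖ ≤ 1) (n : ℕ) :
    ‖a ^ n - b ^ n‖ ≤ n * ‖a - b‖ := by
  induction n with
  | zero => simp
  | succ n ih =>
    have : a ^ (n + 1) - b ^ (n + 1) = a * (a ^ n - b ^ n) + (a - b) * b ^ n := by ring
    rw [this]
    refine (norm_add_le _ _).trans ?_
    rw [norm_mul, norm_mul, norm_pow]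
    have h1 : ‖b‖ ^ n ≤ 1 := pow_le_one₀ (norm_nonneg _) hb
    have h2 : ‖a‖ * ‖a ^ n - b ^ n‖ ≤ 1 * (n * ‖a - b‖) := by gcongr
    have h3 : ‖a - b‖ * ‖b‖ ^ n ≤ ‖a - b‖ * 1 := by gcongr
    push_cast
    linarith

/-- Both one-step factors have modulus at most one, so the errors of `n` steps of length `t / n` add
up to at most `n (t / n)²`. -/
theorem norm_euler_pow_sub_expInv_le {t r : ℝ} (ht : 0 < t) (hr : 0 ≤ r) {n : ℕ} (hn : 0 < n) :
    ‖(((r / (r + t / n) : ℝ) : ℂ) ^ n - expInv t r) * r ^ 2‖ ≤ t ^ 2 / n := by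
  have hs : 0 < t / n := by positivity
  -- The case `m = 0` is exceptional because of the default value: at `r = 0`, `expInv 0 0` is `0`
  -- while the empty product is `1`.
  have h0 : ∀ m : ℕ, expInv ((m * (t / n) : ℝ)) r = expInv ((t / n : ℝ)) r ^ m ∨ m = 0 := by
    intro m
    induction m with
    | zero => simp
    | succ m ih =>
      left
      rcases ih with h | rfl
      · have : (((m + 1 : ℕ) * (t / n) : ℝ) : ℂ) = ((m * (t / n) : ℝ) : ℂ) + ((t / n : ℝ) : ℂ) := by
          push_cast; ring
        rw [this, expInv_add, h, pow_succ]
      · simp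
  have h1 : expInv t r = expInv ((t / n : ℝ)) r ^ n := by
    have h2 := (h0 n).resolve_right hn.ne'
    have h3 : (n : ℝ) * (t / n) = t := by field_simp
    rwa [h3] at h2
  have hE : ‖expInv ((t / n : ℝ)) r‖ ≤ 1 := by
    rcases hr.eq_or_lt with rfl | h
    · simp [expInv]
    · rw [norm_expInv h, Real.exp_le_one_iff, Complex.ofReal_re, neg_nonpos]
      positivity
  have hQ : ‖((r / (r + t / n) : ℝ) : ℂ)‖ ≤ 1 := by
    rw [Complex.norm_real, Real.norm_of_nonneg (by positivity)]
    exact div_le_one_of_le₀ (by linarith) (by positivity)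
  rw [h1, norm_mul]
  have h2 := norm_pow_sub_pow_le hQ hE n
  have h3 := norm_euler_sub_expInv_le hs hr
  rw [norm_mul] at h3
  calc _ ≤ n * ‖((r / (r + t / n) : ℝ) : ℂ) - expInv ((t / n : ℝ)) r‖ * ‖(r : ℂ) ^ 2‖ := by gcongr
    _ ≤ n * (t / n) ^ 2 := by
      rw [mul_assoc]
      gcongr
    _ = t ^ 2 / n := by field_simp

/-- The derivative of `z ↦ exp (-z / r)`. -/
def expInvDeriv (z : ℂ) (r : ℝ) : ℂ := if 0 < r then -(1 / r) * Complex.exp (-(z / r)) else 0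

theorem expInvDeriv_eq (z : ℂ) (r : ℝ) : expInvDeriv z r = -(1 / r) * expInv z r := by
  simp [expInvDeriv, expInv]

theorem continuous_expInvDeriv {z : ℂ} (hz : 0 < z.re) : Continuous (expInvDeriv z) := by
  rw [continuous_iff_continuousAt]
  intro r
  rcases eq_or_ne r 0 with rfl | h
  · rw [ContinuousAt, expInvDeriv, if_neg (lt_irrefl _)]
    refine squeeze_zero_norm (a := fun r : ℝ => 2 / z.re ^ 2 * |r|) (fun r => ?_) ?_
    · rw [expInvDeriv_eq, norm_mul, norm_neg, norm_div, norm_one, Complex.norm_real,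
        Real.norm_eq_abs]
      rcases eq_or_ne r 0 with rfl | h
      · simp
      · have h1 := norm_expInv_le_mul_sq hz r
        have h2 : 0 < |r| := abs_pos.2 h
        rw [one_div_mul_eq_div, div_le_iff₀ h2]
        calc _ ≤ _ := h1
          _ = _ := by rw [← sq_abs r]; ring
    · have : Continuous fun r : ℝ => 2 / z.re ^ 2 * |r| := by fun_prop
      simpa using this.tendsto 0
  · have h' : (r : ℂ) ≠ 0 := by exact_mod_cast h
    have e : expInvDeriv z = fun r : ℝ => -(1 / (r : ℂ)) * expInv z r :=
      funext fun r => expInvDeriv_eq z r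
    rw [e]
    have := (continuous_expInv hz).continuousAt (x := r)
    fun_prop (disch := assumption)

/-- Half of the decay `exp (-z.re / r)` absorbs the growth of `exp (‖h‖ / r)`, and the other half
the factor `1 / r²` of the remainder. The bound is uniform in `r`. -/
theorem norm_expInv_taylor_le {z h : ℂ} (hz : 0 < z.re) (hh : ‖h‖ ≤ z.re / 2) (r : ℝ) :
    ‖expInv (z + h) r - expInv z r - h * expInvDeriv z r‖ ≤ 8 / z.re ^ 2 * ‖h‖ ^ 2 := by
  rcases le_or_gt r 0 with hr | hr
  · simp only [expInv, expInvDeriv, if_neg hr.not_gt]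
    simp only [sub_self, mul_zero, norm_zero]
    positivity
  · have h1 := Complex.norm_exp_sub_sum_le_norm_mul_exp (-(h / r)) 2
    simp only [Finset.sum_range_succ, Finset.range_zero, Finset.sum_empty, pow_zero,
      Nat.factorial_zero, Nat.cast_one, div_one, pow_one, zero_add, Nat.factorial_one] at h1
    have h2 : expInv (z + h) r - expInv z r - h * expInvDeriv z r =
        expInv z r * (Complex.exp (-(h / r)) - (1 + -(h / r))) := by
      rw [expInvDeriv_eq, expInv_add]
      have : expInv h r = Complex.exp (-(h / r)) := if_pos hr
      rw [this]
      ring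
    rw [h2, norm_mul, norm_expInv hr]
    rw [norm_neg, norm_div, Complex.norm_real, Real.norm_of_nonneg hr.le] at h1
    have h3 := sq_mul_exp_neg_le (s := 1 / r) (by positivity) (half_pos hz)
    calc _ ≤ Real.exp (-(z.re / r)) * ((‖h‖ / r) ^ 2 * Real.exp (‖h‖ / r)) := by gcongr
      _ ≤ Real.exp (-(z.re / r)) * ((‖h‖ / r) ^ 2 * Real.exp (z.re / 2 / r)) := by gcongr
      _ = ‖h‖ ^ 2 * ((1 / r) ^ 2 * Real.exp (-(z.re / 2 * (1 / r)))) := by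
        have : Real.exp (-(z.re / 2 * (1 / r))) =
          Real.exp (-(z.re / r)) * Real.exp (z.re / 2 / r) := by
          rw [← Real.exp_add]
          congr 1
          field_simp
          ring
        rw [this]
        ring
      _ ≤ ‖h‖ ^ 2 * (2 / (z.re / 2) ^ 2) := by gcongr
      _ = _ := by field_simp; ring

/-! ### The holomorphic semigroup of a positive contraction -/

section Complex

variable {X : Type*} [NormedAddCommGroup X] [InnerProductSpace ℂ X] [CompleteSpace X]

/-- A self-adjoint operator with spectrum in the unit interval. -/
structure IsPositiveContraction (R : X →L[ℂ] X) : Prop where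
  isStarNormal : IsStarNormal R
  eq_re : ∀ x ∈ spectrum ℂ R, x = (x.re : ℂ)
  nonneg : ∀ x ∈ spectrum ℂ R, 0 ≤ x.re
  le_one : ∀ x ∈ spectrum ℂ R, x.re ≤ 1

open ComplexOrder in
theorem isPositiveContraction_of_isPositive {R : X →L[ℂ] X} (hR : R.IsPositive) (h1 : ‖R‖ ≤ 1) :
    IsPositiveContraction R where
  isStarNormal := hR.isSelfAdjoint.isStarNormal
  eq_re x hx := hR.isSelfAdjoint.mem_spectrum_eq_re hx
  nonneg x hx := by
    have := spectrum_nonneg_of_nonneg ((ContinuousLinearMap.nonneg_iff_isPositive R).2 hR) hx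
    exact (Complex.le_def.1 this).1
  le_one x hx := by
    have h2 := spectrum.norm_le_norm_mul_of_mem hx
    have h3 : ‖(1 : X →L[ℂ] X)‖ ≤ 1 := ContinuousLinearMap.norm_id_le
    have h4 := Complex.re_le_norm x
    have h5 : ‖R‖ * ‖(1 : X →L[ℂ] X)‖ ≤ 1 * 1 := by gcongr
    linarith

namespace IsPositiveContraction

variable {R : X →L[ℂ] X} (hR : IsPositiveContraction R)

/-- The function `f` of the operator `R`. -/
def fc (R : X →L[ℂ] X) (f : ℝ → ℂ) : X →L[ℂ] X := cfc (fun x : ℂ => f x.re) R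

theorem norm_fc_le (hR : IsPositiveContraction R) {f : ℝ → ℂ} {C : ℝ} (hC : 0 ≤ C)
    (h : ∀ r, 0 ≤ r → r ≤ 1 → ‖f r‖ ≤ C) : ‖fc R f‖ ≤ C :=
  norm_cfc_le hC fun x hx => h _ (hR.nonneg x hx) (hR.le_one x hx)

theorem fc_mul {f g : ℝ → ℂ} (hf : ContinuousOn f (Set.Icc 0 1))
    (hg : ContinuousOn g (Set.Icc 0 1)) (hR : IsPositiveContraction R) :
    fc R (fun r => f r * g r) = fc R f * fc R g :=
  cfc_mul _ _ R (hf.comp Complex.continuous_re.continuousOn fun x hx =>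
      ⟨hR.nonneg x hx, hR.le_one x hx⟩)
    (hg.comp Complex.continuous_re.continuousOn fun x hx => ⟨hR.nonneg x hx, hR.le_one x hx⟩)

theorem fc_sub {f g : ℝ → ℂ} (hf : ContinuousOn f (Set.Icc 0 1))
    (hg : ContinuousOn g (Set.Icc 0 1)) (hR : IsPositiveContraction R) :
    fc R (fun r => f r - g r) = fc R f - fc R g :=
  cfc_sub _ _ R (hf.comp Complex.continuous_re.continuousOn fun x hx =>
      ⟨hR.nonneg x hx, hR.le_one x hx⟩)
    (hg.comp Complex.continuous_re.continuousOn fun x hx => ⟨hR.nonneg x hx, hR.le_one x hx⟩)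

theorem fc_const_mul (c : ℂ) {f : ℝ → ℂ} (hf : ContinuousOn f (Set.Icc 0 1))
    (hR : IsPositiveContraction R) : fc R (fun r => c * f r) = c • fc R f :=
  cfc_const_mul c _ R (hf.comp Complex.continuous_re.continuousOn fun x hx =>
      ⟨hR.nonneg x hx, hR.le_one x hx⟩)

theorem fc_pow {f : ℝ → ℂ} (hf : ContinuousOn f (Set.Icc 0 1)) (hR : IsPositiveContraction R)
    (n : ℕ) : fc R (fun r => f r ^ n) = fc R f ^ n :=
  cfc_pow _ n R (hf.comp Complex.continuous_re.continuousOn fun x hx =>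
      ⟨hR.nonneg x hx, hR.le_one x hx⟩) hR.isStarNormal

theorem fc_id (hR : IsPositiveContraction R) : fc R (fun r => (r : ℂ)) = R := by
  have h := hR.isStarNormal
  have : fc R (fun r => (r : ℂ)) = cfc (fun x : ℂ => x) R :=
    cfc_congr fun x hx => (hR.eq_re x hx).symm
  rw [this, cfc_id' ℂ R]

theorem fc_one (hR : IsPositiveContraction R) : fc R (fun _ => 1) = 1 :=
  cfc_const_one ℂ R hR.isStarNormal

theorem fc_congr (hR : IsPositiveContraction R) {f g : ℝ → ℂ} (h : ∀ r, 0 ≤ r → r ≤ 1 → f r = g r) :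
    fc R f = fc R g :=
  cfc_congr fun x hx => h _ (hR.nonneg x hx) (hR.le_one x hx)

/-- The holomorphic semigroup `exp (-z R⁻¹)`. -/
def sg (R : X →L[ℂ] X) (z : ℂ) : X →L[ℂ] X := fc R (expInv z)

theorem sg_add (hR : IsPositiveContraction R) {z w : ℂ} (hz : 0 < z.re) (hw : 0 < w.re) :
    sg R (z + w) = (sg R z).comp (sg R w) := by
  rw [sg, hR.fc_congr (g := fun r => expInv z r * expInv w r) fun r _ _ => expInv_add z w r,
    fc_mul (continuous_expInv hz).continuousOn (continuous_expInv hw).continuousOn hR]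
  rfl

theorem norm_sg_le (hR : IsPositiveContraction R) {z : ℂ} (hz : 0 ≤ z.re) :
    ‖sg R z‖ ≤ Real.exp (-z.re) :=
  hR.norm_fc_le (Real.exp_pos _).le fun _ _ h => norm_expInv_le hz h

theorem norm_sg_le_one (hR : IsPositiveContraction R) {z : ℂ} (hz : 0 ≤ z.re) : ‖sg R z‖ ≤ 1 :=
  (hR.norm_sg_le hz).trans (Real.exp_le_one_iff.2 (by simpa using hz))

theorem norm_sg_sub_apply_le (hR : IsPositiveContraction R) {z : ℂ} (hz : 0 < z.re) (f : X) :
    ‖sg R z (R f) - R f‖ ≤ ‖z‖ * ‖f‖ := by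
  have h1 : fc R (fun r => (expInv z r - 1) * r) = (sg R z - 1) * R := by
    have he := continuous_expInv hz
    rw [fc_mul (f := fun r => expInv z r - 1) (by fun_prop)
      Complex.continuous_ofReal.continuousOn hR, fc_sub (continuous_expInv hz).continuousOn continuousOn_const hR, hR.fc_id, hR.fc_one]
    rfl
  have h2 : ‖(sg R z - 1) * R‖ ≤ ‖z‖ := by
    rw [← h1]
    exact hR.norm_fc_le (norm_nonneg _) fun r hr _ => norm_expInv_sub_one_mul_le hz.le hr
  exact ((sg R z - 1) * R).le_of_opNorm_le h2 f

/-- On vectors `R (R f)` the difference quotient tends to `-R f` at rate `t`: the scalar bound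
`norm_expInv_generator_le` pushed through the calculus. -/
theorem norm_sg_generator_le (hR : IsPositiveContraction R) {t : ℝ} (ht : 0 < t) (f : X) :
    ‖(t : ℂ)⁻¹ • (sg R t (R (R f)) - R (R f)) + R f‖ ≤ t * ‖f‖ := by
  have hz : 0 < (t : ℂ).re := ht
  have hc : ContinuousOn (fun r : ℝ => (r : ℂ)) (Set.Icc 0 1) :=
    Complex.continuous_ofReal.continuousOn
  have he := (continuous_expInv hz).continuousOn (s := Set.Icc 0 1)
  have h1 : fc R (fun r => (t : ℂ)⁻¹ * ((expInv t r - 1) * r ^ 2) - (-1) * r) =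
      (t : ℂ)⁻¹ • ((sg R t - 1) * R ^ 2) - (-1 : ℂ) • R := by
    rw [fc_sub (by fun_prop) (by fun_prop) hR, fc_const_mul _ (by fun_prop) hR,
      fc_const_mul _ hc hR, fc_mul (by fun_prop) (by fun_prop) hR,
      fc_sub he continuousOn_const hR, fc_pow hc hR, hR.fc_id, hR.fc_one]
    rfl
  have h2 : ‖(t : ℂ)⁻¹ • ((sg R t - 1) * R ^ 2) - (-1 : ℂ) • R‖ ≤ t := by
    rw [← h1]
    refine hR.norm_fc_le ht.le fun r hr _ => ?_
    have := norm_expInv_generator_le ht hr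
    convert this using 2
    ring
  have h3 := ((t : ℂ)⁻¹ • ((sg R t - 1) * R ^ 2) - (-1 : ℂ) • R).le_of_opNorm_le h2 f
  have e : ((t : ℂ)⁻¹ • ((sg R t - 1) * R ^ 2) - (-1 : ℂ) • R : X →L[ℂ] X) f =
      (t : ℂ)⁻¹ • (sg R t (R (R f)) - R (R f)) + R f := by simp [pow_two]
  rwa [e] at h3

/-- The equation for `Q` forces `Q = R (R + s)⁻¹`, that is the function `r / (r + s)` of `R`, with
`s = t / n`. Hence the scalar Euler estimate applies to `Q ^ n`. -/
theorem norm_sg_sub_pow_le (hR : IsPositiveContraction R) {t : ℝ} (ht : 0 < t) {n : ℕ}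
    (hn : 0 < n) {Q : X →L[ℂ] X} (hQ : R * Q + ((t / n : ℝ) : ℂ) • Q = R) (f : X) :
    ‖sg R t (R (R f)) - (Q ^ n) (R (R f))‖ ≤ t ^ 2 / n * ‖f‖ := by
  have hs : 0 < t / n := by positivity
  set s := t / n with hs'
  have hz : 0 < (t : ℂ).re := ht
  have hc : ContinuousOn (fun r : ℝ => (r : ℂ)) (Set.Icc 0 1) :=
    Complex.continuous_ofReal.continuousOn
  have he := (continuous_expInv hz).continuousOn (s := Set.Icc 0 1)
  have hi : ContinuousOn (fun r : ℝ => ((1 / (r + s) : ℝ) : ℂ)) (Set.Icc 0 1) := by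
    refine Complex.continuous_ofReal.comp_continuousOn ?_
    refine continuousOn_const.div (by fun_prop) fun r hr => ?_
    have := hr.1
    positivity
  have hq : ContinuousOn (fun r : ℝ => ((r / (r + s) : ℝ) : ℂ)) (Set.Icc 0 1) := by
    refine (hi.mul hc).congr fun r _ => ?_
    simp only [Pi.mul_apply]
    push_cast
    ring
  have hQ' : fc R (fun r => ((r / (r + s) : ℝ) : ℂ)) = Q := by
    have e1 : fc R (fun r => ((1 / (r + s) : ℝ) : ℂ)) * (R + (s : ℂ) • 1) = 1 := by
      have : R + (s : ℂ) • 1 = fc R (fun r => (r : ℂ) - (-(s : ℂ)) * 1) := by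
        rw [fc_sub hc continuousOn_const hR, fc_const_mul _ continuousOn_const hR, hR.fc_id,
          hR.fc_one]
        simp
      rw [this, ← fc_mul hi (by fun_prop) hR, ← hR.fc_one]
      refine hR.fc_congr fun r hr _ => ?_
      have : (r : ℂ) + s ≠ 0 := by
        norm_cast
        positivity
      push_cast
      rw [mul_one, sub_neg_eq_add]
      field_simp
    have e2 : fc R (fun r => ((r / (r + s) : ℝ) : ℂ)) =
        fc R (fun r => ((1 / (r + s) : ℝ) : ℂ)) * R := by
      have h := fc_mul hi hc hR
      rw [hR.fc_id] at h
      rw [← h]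
      refine hR.fc_congr fun r hr _ => ?_
      push_cast
      ring
    have e3 : R * Q + (s : ℂ) • Q = (R + (s : ℂ) • 1) * Q := by simp [add_mul]
    rw [e3] at hQ
    rw [e2]
    calc _ = fc R (fun r => ((1 / (r + s) : ℝ) : ℂ)) * ((R + (s : ℂ) • 1) * Q) := by rw [hQ]
      _ = Q := by rw [← mul_assoc, e1, one_mul]
  have h1 : fc R (fun r => ((((r / (r + s) : ℝ) : ℂ) ^ n - expInv t r) * r ^ 2)) =
      (Q ^ n - sg R t) * R ^ 2 := by
    rw [fc_mul (by fun_prop) (by fun_prop) hR, fc_sub (by fun_prop) he hR, fc_pow hc hR, hR.fc_id,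
      fc_pow hq hR, hQ']
    rfl
  have h2 : ‖(Q ^ n - sg R t) * R ^ 2‖ ≤ t ^ 2 / n := by
    rw [← h1]
    exact hR.norm_fc_le (by positivity) fun r hr _ => norm_euler_pow_sub_expInv_le ht hr hn
  have h3 := ((Q ^ n - sg R t) * R ^ 2).le_of_opNorm_le h2 f
  have e : ((Q ^ n - sg R t) * R ^ 2) f = (Q ^ n) (R (R f)) - sg R t (R (R f)) := by
    simp [pow_two]
  rwa [e, norm_sub_rev] at h3

/-- The Taylor remainder is quadratic in `h` uniformly on the spectrum, so the derivative exists in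
operator norm. -/
theorem hasDerivAt_sg (hR : IsPositiveContraction R) {z : ℂ} (hz : 0 < z.re) :
    HasDerivAt (sg R) (fc R (expInvDeriv z)) z := by
  rw [hasDerivAt_iff_isLittleO_nhds_zero]
  refine Asymptotics.IsBigO.trans_isLittleO (g := fun h : ℂ => ‖h‖ ^ 2) ?_ ?_
  · refine Asymptotics.IsBigO.of_bound (8 / z.re ^ 2) ?_
    filter_upwards [Metric.closedBall_mem_nhds (0 : ℂ) (half_pos hz)] with h hh
    rw [mem_closedBall_zero_iff] at hh
    have hzh : 0 < (z + h).re := by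
      have := (abs_le.1 (Complex.abs_re_le_norm h)).1
      rw [Complex.add_re]
      linarith
    have e : sg R (z + h) - sg R z - h • fc R (expInvDeriv z) =
        fc R (fun r => expInv (z + h) r - expInv z r - h * expInvDeriv z r) := by
      have c1 := (continuous_expInv hzh).continuousOn (s := Set.Icc 0 1)
      have c2 := (continuous_expInv hz).continuousOn (s := Set.Icc 0 1)
      have c3 := (continuous_expInvDeriv hz).continuousOn (s := Set.Icc 0 1)
      rw [fc_sub (by fun_prop) (by fun_prop) hR, fc_sub c1 c2 hR, fc_const_mul _ c3 hR]
      rfl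
    rw [e, norm_pow, norm_norm]
    exact hR.norm_fc_le (by positivity) fun r _ _ => norm_expInv_taylor_le hz hh r
  · have := (Asymptotics.isLittleO_norm_pow_id (E' := ℂ) (n := 2) one_lt_two)
    simpa using this

end IsPositiveContraction

end Complex

/-! ### Complexification of real operators on L² -/

section Complexification

variable {α : Type*} [MeasurableSpace α] {ν : Measure α}

variable (ν) in
/-- The embedding of the real `L²` space into the complex one. -/
def ofRealL : Lp ℝ 2 ν →L[ℝ] Lp ℂ 2 ν := Complex.ofRealCLM.compLpL 2 ν

variable (ν) in
/-- The real part on `L²`. -/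
def reL : Lp ℂ 2 ν →L[ℝ] Lp ℝ 2 ν := Complex.reCLM.compLpL 2 ν

variable (ν) in
/-- The imaginary part on `L²`. -/
def imL : Lp ℂ 2 ν →L[ℝ] Lp ℝ 2 ν := Complex.imCLM.compLpL 2 ν

theorem coeFn_ofRealL (f : Lp ℝ 2 ν) : ofRealL ν f =ᵐ[ν] fun x => (f x : ℂ) :=
  Complex.ofRealCLM.coeFn_compLp f

theorem coeFn_reL (f : Lp ℂ 2 ν) : reL ν f =ᵐ[ν] fun x => (f x).re :=
  Complex.reCLM.coeFn_compLp f

theorem coeFn_imL (f : Lp ℂ 2 ν) : imL ν f =ᵐ[ν] fun x => (f x).im :=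
  Complex.imCLM.coeFn_compLp f

@[simp] theorem reL_ofRealL (f : Lp ℝ 2 ν) : reL ν (ofRealL ν f) = f := by
  apply Lp.ext
  filter_upwards [coeFn_reL (ofRealL ν f), coeFn_ofRealL f] with x h1 h2
  rw [h1, h2, Complex.ofReal_re]

@[simp] theorem imL_ofRealL (f : Lp ℝ 2 ν) : imL ν (ofRealL ν f) = 0 := by
  apply Lp.ext
  filter_upwards [coeFn_imL (ofRealL ν f), coeFn_ofRealL f, Lp.coeFn_zero ℝ 2 ν] with x h1 h2 h3
  rw [h1, h2, h3, Complex.ofReal_im, Pi.zero_apply]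

theorem reL_smul (c : ℂ) (f : Lp ℂ 2 ν) : reL ν (c • f) = c.re • reL ν f - c.im • imL ν f := by
  apply Lp.ext
  filter_upwards [coeFn_reL (c • f), coeFn_reL f, coeFn_imL f, Lp.coeFn_smul c f,
    Lp.coeFn_sub (c.re • reL ν f) (c.im • imL ν f), Lp.coeFn_smul c.re (reL ν f),
    Lp.coeFn_smul c.im (imL ν f)] with x h1 h2 h3 h4 h5 h6 h7
  simp only [h1, h2, h3, h4, h5, h6, h7, Pi.smul_apply, Pi.sub_apply, smul_eq_mul, Complex.mul_re]

theorem imL_smul (c : ℂ) (f : Lp ℂ 2 ν) : imL ν (c • f) = c.re • imL ν f + c.im • reL ν f := by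
  apply Lp.ext
  filter_upwards [coeFn_imL (c • f), coeFn_reL f, coeFn_imL f, Lp.coeFn_smul c f,
    Lp.coeFn_add (c.re • imL ν f) (c.im • reL ν f), Lp.coeFn_smul c.im (reL ν f),
    Lp.coeFn_smul c.re (imL ν f)] with x h1 h2 h3 h4 h5 h6 h7
  simp only [h1, h2, h3, h4, h5, h6, h7, Pi.smul_apply, Pi.add_apply, smul_eq_mul, Complex.mul_im]

theorem ofRealL_smul (c : ℝ) (f : Lp ℝ 2 ν) : ofRealL ν (c • f) = (c : ℂ) • ofRealL ν f := by
  rw [map_smul]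
  exact RCLike.real_smul_eq_coe_smul (K := ℂ) c _

theorem eq_ofRealL_add (f : Lp ℂ 2 ν) :
    f = ofRealL ν (reL ν f) + Complex.I • ofRealL ν (imL ν f) := by
  apply Lp.ext
  filter_upwards [coeFn_reL f, coeFn_imL f, coeFn_ofRealL (reL ν f), coeFn_ofRealL (imL ν f),
    Lp.coeFn_add (ofRealL ν (reL ν f)) (Complex.I • ofRealL ν (imL ν f)),
    Lp.coeFn_smul Complex.I (ofRealL ν (imL ν f))] with x h1 h2 h3 h4 h5 h6
  simp only [h5, h6, h3, h4, h1, h2, Pi.add_apply, Pi.smul_apply, smul_eq_mul]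
  rw [mul_comm, Complex.re_add_im]

theorem inner_ofRealL (f g : Lp ℝ 2 ν) :
    inner ℂ (ofRealL ν f) (ofRealL ν g) = ((inner ℝ f g : ℝ) : ℂ) := by
  rw [L2.inner_def, L2.inner_def, ← integral_complex_ofReal]
  refine integral_congr_ae ?_
  filter_upwards [coeFn_ofRealL f, coeFn_ofRealL g] with x h1 h2
  rw [h1, h2]
  simp [mul_comm]

theorem norm_ofRealL (f : Lp ℝ 2 ν) : ‖ofRealL ν f‖ = ‖f‖ := by
  have h := inner_ofRealL f f
  rw [inner_self_eq_norm_sq_to_K, real_inner_self_eq_norm_sq] at h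
  have h' : ‖ofRealL ν f‖ ^ 2 = ‖f‖ ^ 2 := Complex.ofReal_injective (by simpa using h)
  exact (sq_eq_sq₀ (norm_nonneg _) (norm_nonneg _)).1 h'

theorem norm_sq_eq_re_add_im (f : Lp ℂ 2 ν) : ‖f‖ ^ 2 = ‖reL ν f‖ ^ 2 + ‖imL ν f‖ ^ 2 := by
  have h : (inner ℂ f f : ℂ).re = ‖f‖ ^ 2 := by
    rw [inner_self_eq_norm_sq_to_K]
    norm_cast
  rw [← h]
  conv_lhs => rw [eq_ofRealL_add f]
  simp only [inner_add_left, inner_add_right, inner_smul_left, inner_smul_right, inner_ofRealL,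
    real_inner_self_eq_norm_sq]
  simp only [Complex.conj_I, Complex.add_re, Complex.mul_re, Complex.ofReal_re, Complex.ofReal_im,
    Complex.I_re, Complex.I_im, Complex.neg_re, Complex.neg_im, Complex.mul_im, Complex.add_im]
  ring

/-- The complexification of a real operator. -/
def complexify (R : Lp ℝ 2 ν →L[ℝ] Lp ℝ 2 ν) : Lp ℂ 2 ν →L[ℂ] Lp ℂ 2 ν where
  toFun f := ofRealL ν (R (reL ν f)) + Complex.I • ofRealL ν (R (imL ν f))
  map_add' f g := by
    simp only [map_add, smul_add]
    abel
  map_smul' c f := by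
    have hc : c = c.re + c.im * Complex.I := (Complex.re_add_im c).symm
    have h1 : c * Complex.I = Complex.I * c.re - c.im := by
      conv_lhs => rw [hc]
      ring_nf
      rw [Complex.I_sq]
      ring
    have h2 : ∀ g : Lp ℂ 2 ν, c • g = (c.re : ℂ) • g + (c.im * Complex.I) • g := fun g => by
      rw [← add_smul, ← hc]
    rw [RingHom.id_apply, smul_add, smul_smul, h1, h2 (ofRealL ν (R (reL ν f)))]
    simp only [reL_smul, imL_smul, map_add, map_sub, map_smul]
    simp only [RCLike.real_smul_eq_coe_smul (K := ℂ), RCLike.ofReal_eq_complex_ofReal]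
    module
  cont := by fun_prop

theorem complexify_apply (R : Lp ℝ 2 ν →L[ℝ] Lp ℝ 2 ν) (f : Lp ℂ 2 ν) :
    complexify R f = ofRealL ν (R (reL ν f)) + Complex.I • ofRealL ν (R (imL ν f)) := rfl

@[simp] theorem complexify_ofRealL (R : Lp ℝ 2 ν →L[ℝ] Lp ℝ 2 ν) (f : Lp ℝ 2 ν) :
    complexify R (ofRealL ν f) = ofRealL ν (R f) := by
  simp [complexify_apply]

theorem norm_sq_complexify (R : Lp ℝ 2 ν →L[ℝ] Lp ℝ 2 ν) (f : Lp ℂ 2 ν) :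
    ‖complexify R f‖ ^ 2 = ‖R (reL ν f)‖ ^ 2 + ‖R (imL ν f)‖ ^ 2 := by
  rw [norm_sq_eq_re_add_im]
  simp [complexify_apply, reL_smul, imL_smul]

theorem inner_complexify (R : Lp ℝ 2 ν →L[ℝ] Lp ℝ 2 ν) (f g : Lp ℂ 2 ν) :
    inner ℂ (complexify R f) g =
      (((inner ℝ (R (reL ν f)) (reL ν g) + inner ℝ (R (imL ν f)) (imL ν g) : ℝ)) : ℂ) +
      Complex.I * ((inner ℝ (R (reL ν f)) (imL ν g) - inner ℝ (R (imL ν f)) (reL ν g) : ℝ)) := by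
  conv_lhs => rw [eq_ofRealL_add g]
  simp only [complexify_apply, inner_add_left, inner_add_right, inner_smul_left, inner_smul_right,
    inner_ofRealL, Complex.conj_I]
  push_cast
  ring_nf
  rw [Complex.I_sq]
  ring

theorem isPositiveContraction_complexify {R : Lp ℝ 2 ν →L[ℝ] Lp ℝ 2 ν}
    (hs : ∀ x y, inner ℝ (R x) y = inner ℝ x (R y)) (hp : ∀ x, 0 ≤ inner ℝ (R x) x)
    (h1 : ∀ x, ‖R x‖ ≤ ‖x‖) : IsPositiveContraction (complexify R) := by
  refine isPositiveContraction_of_isPositive ⟨fun f g => ?_, fun f => ?_⟩ ?_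
  · simp only [ContinuousLinearMap.coe_coe]
    rw [← inner_conj_symm f, inner_complexify, inner_complexify]
    simp only [map_add, map_mul, Complex.conj_ofReal, Complex.conj_I]
    rw [hs (reL ν g), hs (imL ν g), hs (reL ν g), hs (imL ν g), real_inner_comm (R (reL ν f)),
      real_inner_comm (R (imL ν f)), real_inner_comm (R (imL ν f)), real_inner_comm (R (reL ν f))]
    push_cast
    ring
  · rw [ContinuousLinearMap.reApplyInnerSelf, inner_complexify]
    have h2 := hp (reL ν f)
    have h3 := hp (imL ν f)
    have : RCLike.re ((((inner ℝ (R (reL ν f)) (reL ν f) +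
      inner ℝ (R (imL ν f)) (imL ν f) : ℝ)) : ℂ) +
      Complex.I * ((inner ℝ (R (reL ν f)) (imL ν f) - inner ℝ (R (imL ν f)) (reL ν f) : ℝ))) =
      inner ℝ (R (reL ν f)) (reL ν f) + inner ℝ (R (imL ν f)) (imL ν f) := by
      simp only [RCLike.re_eq_complex_re, Complex.add_re, Complex.ofReal_re, Complex.mul_re,
        Complex.I_re, Complex.I_im, Complex.ofReal_im]
      ring
    rw [this]
    positivity
  · refine ContinuousLinearMap.opNorm_le_bound _ zero_le_one fun f => ?_
    rw [one_mul]
    refine (sq_le_sq₀ (norm_nonneg _) (norm_nonneg _)).1 ?_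
    rw [norm_sq_complexify, norm_sq_eq_re_add_im f]
    gcongr <;> exact h1 _

end Complexification

/-! ### Implicit Euler steps -/

section Resolvent

variable {H : Type*} [NormedAddCommGroup H] [InnerProductSpace ℝ H]

/-- The operator `R (R + s)⁻¹`. -/
theorem exists_euler_operator [CompleteSpace H] {R : H →L[ℝ] H} (hp : ∀ x, 0 ≤ inner ℝ (R x) x)
    {s : ℝ} (hs : 0 < s) : ∃ Q : H →L[ℝ] H, ∀ f, R (Q f) + s • Q f = R f := by
  let B : H →L[ℝ] H →L[ℝ] ℝ := (innerSL ℝ).comp (R + s • ContinuousLinearMap.id ℝ H)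
  have hB : ∀ x y, B x y = inner ℝ (R x + s • x) y := fun x y => rfl
  have hc : IsCoercive B := by
    refine ⟨s, hs, fun u => ?_⟩
    rw [hB, inner_add_left, real_inner_smul_left, real_inner_self_eq_norm_sq]
    nlinarith [hp u]
  let G : H ≃L[ℝ] H := hc.continuousLinearEquivOfBilin
  have hG : ∀ x, G x = R x + s • x := fun x =>
    ext_inner_right ℝ fun y => by rw [← hB]; exact hc.continuousLinearEquivOfBilin_apply x y
  refine ⟨R.comp G.symm.toContinuousLinearMap, fun f => ?_⟩
  have := hG (G.symm f)
  rw [ContinuousLinearEquiv.apply_symm_apply] at this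
  simp only [ContinuousLinearMap.comp_apply, ContinuousLinearEquiv.coe_coe]
  conv_rhs => rw [this]
  rw [map_add, map_smul]

theorem eq_of_add_smul_eq {R : H →L[ℝ] H} (hp : ∀ x, 0 ≤ inner ℝ (R x) x) {s : ℝ} (hs : 0 < s)
    {x y : H} (h : R x + s • x = R y + s • y) : x = y := by
  have h1 : R (x - y) + s • (x - y) = 0 := by
    rw [map_sub, smul_sub]
    have := sub_eq_zero.2 h
    rw [← this]
    abel
  have h2 : inner ℝ (R (x - y) + s • (x - y)) (x - y) = 0 := by rw [h1, inner_zero_left]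
  rw [inner_add_left, real_inner_smul_left, real_inner_self_eq_norm_sq] at h2
  have h3 := hp (x - y)
  have h4 : ‖x - y‖ ^ 2 ≤ 0 := by
    by_contra hcon
    push Not at hcon
    have := mul_pos hs hcon
    linarith
  have h5 : ‖x - y‖ = 0 := by nlinarith [norm_nonneg (x - y)]
  exact sub_eq_zero.1 (norm_eq_zero.1 h5)

/-- Every vector is `R g + s g` for some `g`, and `Q` maps it to `R g`; positivity of `R` makes the
cross term in `‖R g + s g‖²` nonnegative. -/
theorem norm_euler_operator_le [CompleteSpace H] {R Q : H →L[ℝ] H}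
    (hp : ∀ x, 0 ≤ inner ℝ (R x) x)
    {s : ℝ} (hs : 0 < s) (hQ : ∀ f, R (Q f) + s • Q f = R f) (f : H) : ‖Q f‖ ≤ ‖f‖ := by
  let B : H →L[ℝ] H →L[ℝ] ℝ := (innerSL ℝ).comp (R + s • ContinuousLinearMap.id ℝ H)
  have hB : ∀ x y, B x y = inner ℝ (R x + s • x) y := fun x y => rfl
  have hc : IsCoercive B := by
    refine ⟨s, hs, fun u => ?_⟩
    rw [hB, inner_add_left, real_inner_smul_left, real_inner_self_eq_norm_sq]
    nlinarith [hp u]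
  let G : H ≃L[ℝ] H := hc.continuousLinearEquivOfBilin
  have hG : ∀ x, G x = R x + s • x := fun x =>
    ext_inner_right ℝ fun y => by rw [← hB]; exact hc.continuousLinearEquivOfBilin_apply x y
  obtain ⟨g, rfl⟩ := G.surjective f
  have h1 : Q (G g) = R g := by
    refine eq_of_add_smul_eq hp hs ?_
    rw [hQ, hG, map_add, map_smul]
  rw [h1, hG]
  refine (sq_le_sq₀ (norm_nonneg _) (norm_nonneg _)).1 ?_
  rw [norm_add_sq_real, real_inner_smul_right]
  nlinarith [mul_nonneg hs.le (hp g), sq_nonneg ‖s • g‖]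

end Resolvent

/-! ### Abstract resolvents and strong convergence -/

section Semigroup

variable {α : Type*} [MeasurableSpace α] {ν : Measure α}

/-- A bounded positive injective operator `R` on `L²`, to be thought of as the resolvent
`(λ + 𝒜)⁻¹`. -/
structure IsResolvent {H : Type*} [NormedAddCommGroup H] [InnerProductSpace ℝ H]
    (R : H →L[ℝ] H) : Prop where
  symm : ∀ x y, inner ℝ (R x) y = inner ℝ x (R y)
  nonneg : ∀ x, 0 ≤ inner ℝ (R x) x
  norm_le : ∀ x, ‖R x‖ ≤ ‖x‖
  injective : Function.Injective R

/-- For a symmetric operator the orthogonal complement of the range is the kernel. -/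
theorem IsResolvent.denseRange {H : Type*} [NormedAddCommGroup H] [InnerProductSpace ℝ H]
    [CompleteSpace H] {R : H →L[ℝ] H} (hR : IsResolvent R) : DenseRange R := by
  have h1 : (LinearMap.range R.toLinearMap).topologicalClosure = ⊤ := by
    rw [Submodule.topologicalClosure_eq_top_iff, Submodule.eq_bot_iff]
    intro x hx
    apply hR.injective
    rw [map_zero]
    refine ext_inner_right ℝ fun y => ?_
    rw [hR.symm, inner_zero_left, real_inner_comm]
    exact hx _ ⟨y, rfl⟩
  have := (Submodule.dense_iff_topologicalClosure_eq_top).2 h1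
  exact this

theorem IsResolvent.denseRange_sq {H : Type*} [NormedAddCommGroup H] [InnerProductSpace ℝ H]
    [CompleteSpace H] {R : H →L[ℝ] H} (hR : IsResolvent R) : DenseRange fun x => R (R x) :=
  hR.denseRange.comp hR.denseRange R.continuous

/-- Strong convergence of uniformly bounded operators may be checked on a dense set. -/
theorem tendsto_of_denseRange {𝕜 X Y Z ι : Type*} [NontriviallyNormedField 𝕜]
    [NormedAddCommGroup X] [NormedSpace 𝕜 X]
    [NormedAddCommGroup Y] [NormedSpace 𝕜 Y] {l : Filter ι} {T : ι → X →L[𝕜] Y} {T₀ : X →L[𝕜] Y}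
    {C : ℝ} (hT : ∀ᶠ i in l, ∀ x, ‖T i x‖ ≤ C * ‖x‖) (hT₀ : ∀ x, ‖T₀ x‖ ≤ C * ‖x‖)
    {g : Z → X} (hg : DenseRange g)
    (h : ∀ z, Tendsto (fun i => T i (g z)) l (𝓝 (T₀ (g z)))) (x : X) :
    Tendsto (fun i => T i x) l (𝓝 (T₀ x)) := by
  rcases l.eq_or_neBot with rfl | hl
  · exact tendsto_bot
  rw [Metric.tendsto_nhds]
  intro ε hε
  have hC : 0 ≤ |C| := abs_nonneg C
  obtain ⟨_, hy, z, rfl⟩ := Metric.dense_iff.1 hg x (ε / (4 * (|C| + 1))) (by positivity)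
  rw [Metric.mem_ball, dist_eq_norm] at hy
  have hb : C * ‖g z - x‖ ≤ ε / 4 := by
    calc C * ‖g z - x‖ ≤ (|C| + 1) * (ε / (4 * (|C| + 1))) := by
          gcongr
          linarith [le_abs_self C]
      _ = ε / 4 := by field_simp
  filter_upwards [hT, (Metric.tendsto_nhds.1 (h z)) (ε / 2) (by positivity)] with i hi hi2
  rw [dist_eq_norm] at hi2 ⊢
  have e : T i x - T₀ x = (T i (g z) - T₀ (g z)) - T i (g z - x) + T₀ (g z - x) := by
    simp only [map_sub]
    abel
  rw [e]
  have h1 := hi (g z - x)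
  have h2 := hT₀ (g z - x)
  have h3 := norm_add_le ((T i (g z) - T₀ (g z)) - T i (g z - x)) (T₀ (g z - x))
  have h4 := norm_sub_le (T i (g z) - T₀ (g z)) (T i (g z - x))
  linarith

end Semigroup

/-! ### The real semigroup: generator, Euler formula, convergence, comparison -/

section RealSemigroup

variable {α : Type*} [MeasurableSpace α] {ν : Measure α} {R : Lp ℝ 2 ν →L[ℝ] Lp ℝ 2 ν}

theorem IsResolvent.isPositiveContraction (hR : IsResolvent R) :
    IsPositiveContraction (complexify R) :=
  isPositiveContraction_complexify hR.symm hR.nonneg hR.norm_le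

/-- The real semigroup `exp (-t R⁻¹)`. -/
def realSg (R : Lp ℝ 2 ν →L[ℝ] Lp ℝ 2 ν) (t : ℝ) : Lp ℝ 2 ν →L[ℝ] Lp ℝ 2 ν :=
  (reL ν).comp (((IsPositiveContraction.sg (complexify R) t).restrictScalars ℝ).comp (ofRealL ν))

theorem complexify_pow_ofRealL (Q : Lp ℝ 2 ν →L[ℝ] Lp ℝ 2 ν) (n : ℕ) (f : Lp ℝ 2 ν) :
    (complexify Q ^ n) (ofRealL ν f) = ofRealL ν ((Q ^ n) f) := by
  induction n with
  | zero => simp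
  | succ n ih => simp [pow_succ', ih]

theorem norm_sg_sub_ofRealL_le (hR : IsResolvent R) {t : ℝ} (ht : 0 < t) {n : ℕ} (hn : 0 < n)
    {Q : Lp ℝ 2 ν →L[ℝ] Lp ℝ 2 ν} (hQ : ∀ f, R (Q f) + (t / n) • Q f = R f) (f : Lp ℝ 2 ν) :
    ‖IsPositiveContraction.sg (complexify R) t (ofRealL ν (R (R f))) -
      ofRealL ν ((Q ^ n) (R (R f)))‖ ≤ t ^ 2 / n * ‖f‖ := by
  have hQC : complexify R * complexify Q + ((t / n : ℝ) : ℂ) • complexify Q = complexify R := by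
    ext1 g
    have h1 : ∀ f, ofRealL ν (R (Q f)) + ((t / n : ℝ) : ℂ) • ofRealL ν (Q f) = ofRealL ν (R f) := by
      intro f
      rw [← hQ f, map_add, ← ofRealL_smul]
    rw [eq_ofRealL_add g]
    simp only [map_add, map_smul, add_apply, smul_apply, mul_apply_eq_comp,
      complexify_ofRealL]
    rw [← h1 (reL ν g), ← h1 (imL ν g)]
  have := hR.isPositiveContraction.norm_sg_sub_pow_le ht hn hQC (ofRealL ν f)
  rwa [complexify_ofRealL, complexify_ofRealL, complexify_pow_ofRealL, norm_ofRealL] at this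

/-- Reality of the semigroup comes from Euler's formula: on the dense range of `R²` it is a limit of
powers of complexified real operators, which preserve real functions. -/
theorem sg_ofRealL (hR : IsResolvent R) {t : ℝ} (ht : 0 < t) (f : Lp ℝ 2 ν) :
    IsPositiveContraction.sg (complexify R) t (ofRealL ν f) = ofRealL ν (realSg R t f) := by
  have key : imL ν (IsPositiveContraction.sg (complexify R) t (ofRealL ν f)) = 0 := by
    have hcl : IsClosed {f | imL ν (IsPositiveContraction.sg (complexify R) t (ofRealL ν f)) = 0} :=
      isClosed_eq (by fun_prop) continuous_const
    refine hR.denseRange_sq.induction_on (p := fun f =>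
      imL ν (IsPositiveContraction.sg (complexify R) t (ofRealL ν f)) = 0) f hcl fun g => ?_
    choose Q hQ using fun n : ℕ => exists_euler_operator hR.nonneg
      (s := t / (n + 1 : ℕ)) (by positivity)
    have hlim : Tendsto (fun n => ofRealL ν ((Q n ^ (n + 1)) (R (R g)))) atTop
        (𝓝 (IsPositiveContraction.sg (complexify R) t (ofRealL ν (R (R g))))) := by
      rw [tendsto_iff_norm_sub_tendsto_zero]
      refine squeeze_zero (fun _ => norm_nonneg _) (fun n => ?_)
        (g := fun n : ℕ => t ^ 2 / (n + 1 : ℕ) * ‖g‖) ?_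
      · rw [norm_sub_rev]
        exact norm_sg_sub_ofRealL_le hR ht n.succ_pos (hQ n) g
      · have := (tendsto_const_div_atTop_nhds_zero_nat (t ^ 2)).comp (tendsto_add_atTop_nat 1)
        simpa using this.mul_const ‖g‖
    have h2 := ((imL ν).continuous.tendsto _).comp hlim
    refine tendsto_nhds_unique h2 ?_
    simp [Function.comp_def]
  conv_lhs => rw [eq_ofRealL_add (IsPositiveContraction.sg (complexify R) t (ofRealL ν f))]
  rw [key, map_zero, smul_zero, add_zero]
  rfl

theorem norm_realSg_sub_le (hR : IsResolvent R) {t : ℝ} (ht : 0 < t) {n : ℕ} (hn : 0 < n)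
    {Q : Lp ℝ 2 ν →L[ℝ] Lp ℝ 2 ν} (hQ : ∀ f, R (Q f) + (t / n) • Q f = R f) (f : Lp ℝ 2 ν) :
    ‖realSg R t (R (R f)) - (Q ^ n) (R (R f))‖ ≤ t ^ 2 / n * ‖f‖ := by
  have := norm_sg_sub_ofRealL_le hR ht hn hQ f
  rwa [sg_ofRealL hR ht, ← map_sub, norm_ofRealL] at this

theorem norm_realSg_le (hR : IsResolvent R) {t : ℝ} (ht : 0 < t) (f : Lp ℝ 2 ν) :
    ‖realSg R t f‖ ≤ Real.exp (-t) * ‖f‖ := by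
  rw [← norm_ofRealL, ← sg_ofRealL hR ht, ← norm_ofRealL f]
  exact (IsPositiveContraction.sg (complexify R) t).le_of_opNorm_le
    (hR.isPositiveContraction.norm_sg_le (z := t) ht.le) _

theorem norm_realSg_le' (hR : IsResolvent R) {t : ℝ} (ht : 0 < t) (f : Lp ℝ 2 ν) :
    ‖realSg R t f‖ ≤ ‖f‖ := by
  refine (norm_realSg_le hR ht f).trans (mul_le_of_le_one_left (norm_nonneg _) ?_)
  exact Real.exp_le_one_iff.2 (by linarith)

theorem realSg_add (hR : IsResolvent R) {s t : ℝ} (hs : 0 < s) (ht : 0 < t) (f : Lp ℝ 2 ν) :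
    realSg R (s + t) f = realSg R s (realSg R t f) := by
  have : ofRealL ν (realSg R (s + t) f) = ofRealL ν (realSg R s (realSg R t f)) := by
    rw [← sg_ofRealL hR (by positivity), ← sg_ofRealL hR hs, ← sg_ofRealL hR ht,
      Complex.ofReal_add, hR.isPositiveContraction.sg_add (by simpa) (by simpa)]
    rfl
  have h2 := congrArg (reL ν) this
  simpa using h2

theorem norm_realSg_sub_self_le (hR : IsResolvent R) {t : ℝ} (ht : 0 < t) (f : Lp ℝ 2 ν) :
    ‖realSg R t (R f) - R f‖ ≤ t * ‖f‖ := by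
  have := hR.isPositiveContraction.norm_sg_sub_apply_le (z := t) (by simpa) (ofRealL ν f)
  rwa [complexify_ofRealL, sg_ofRealL hR ht, ← map_sub, norm_ofRealL, norm_ofRealL,
    Complex.norm_real, Real.norm_of_nonneg ht.le] at this

theorem norm_realSg_generator_le (hR : IsResolvent R) {t : ℝ} (ht : 0 < t) (f : Lp ℝ 2 ν) :
    ‖t⁻¹ • (realSg R t (R (R f)) - R (R f)) + R f‖ ≤ t * ‖f‖ := by
  have := hR.isPositiveContraction.norm_sg_generator_le ht (ofRealL ν f)
  rwa [complexify_ofRealL, complexify_ofRealL, sg_ofRealL hR ht, ← map_sub, ← Complex.ofReal_inv,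
    ← ofRealL_smul, ← map_add, norm_ofRealL, norm_ofRealL] at this

theorem realSg_comm (hR : IsResolvent R) {t : ℝ} (ht : 0 < t) (f : Lp ℝ 2 ν) :
    realSg R t (R f) = R (realSg R t f) := by
  have h1 : Commute (IsPositiveContraction.sg (complexify R) t) (complexify R) := by
    have := hR.isPositiveContraction.isStarNormal
    have h := cfc_commute_cfc (fun x : ℂ => expInv t x.re) (fun x => x) (complexify R)
    rwa [cfc_id' ℂ (complexify R)] at h
  have : ofRealL ν (realSg R t (R f)) = ofRealL ν (R (realSg R t f)) := by
    rw [← sg_ofRealL hR ht, ← complexify_ofRealL, ← complexify_ofRealL, ← sg_ofRealL hR ht]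
    exact DFunLike.congr_fun h1.eq (ofRealL ν f)
  have h2 := congrArg (reL ν) this
  simpa using h2

/-- The generator of `exp (-t R⁻¹)` is `-R⁻¹`. -/
theorem tendsto_realSg_generator_iff (hR : IsResolvent R) (u w : Lp ℝ 2 ν) :
    Tendsto (fun t : ℝ => t⁻¹ • (realSg R t u - u)) (𝓝[>] 0) (𝓝 w) ↔ R (-w) = u := by
  -- The domain of the generator contains the range of `R`: the operators `t⁻¹ (S(t) - 1) R` are
  -- bounded by one, and they converge on the range of `R`.
  have hA : ∀ g, Tendsto (fun t : ℝ => t⁻¹ • (realSg R t (R g) - R g)) (𝓝[>] 0) (𝓝 (-g)) := by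
    let T : ℝ → Lp ℝ 2 ν →L[ℝ] Lp ℝ 2 ν := fun t =>
      t⁻¹ • ((realSg R t - ContinuousLinearMap.id ℝ _).comp R)
    have hT : ∀ t g, T t g = t⁻¹ • (realSg R t (R g) - R g) := fun t g => rfl
    intro g
    refine (tendsto_of_denseRange (T := T) (T₀ := -ContinuousLinearMap.id ℝ _) (C := 1)
      ?_ (fun x => by simp) hR.denseRange (fun z => ?_) g)
    · filter_upwards [self_mem_nhdsWithin] with t ht x
      have ht' : 0 < t := ht
      rw [hT, norm_smul, norm_inv, Real.norm_of_nonneg ht'.le, one_mul,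
        inv_mul_le_iff₀ ht']
      exact norm_realSg_sub_self_le hR ht' x
    · rw [tendsto_iff_norm_sub_tendsto_zero]
      refine squeeze_zero' (Eventually.of_forall fun _ => norm_nonneg _)
        (g := fun t => t * ‖z‖) ?_ ?_
      · filter_upwards [self_mem_nhdsWithin] with t ht
        have := norm_realSg_generator_le hR ht z
        simpa [hT] using this
      · have : Tendsto (fun t : ℝ => t * ‖z‖) (𝓝 0) (𝓝 (0 * ‖z‖)) :=
          tendsto_id.mul_const ‖z‖
        rw [zero_mul] at this
        exact this.mono_left nhdsWithin_le_nhds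
  constructor
  · intro h
    -- Conversely, applying `R` to the difference quotients of `u` gives those of `R u`, whose limit
    -- `-u` is known from `hA`.
    have h1 := (R.continuous.tendsto w).comp h
    have h2 : Tendsto (fun t : ℝ => t⁻¹ • (realSg R t (R u) - R u)) (𝓝[>] 0) (𝓝 (R w)) := by
      refine h1.congr' ?_
      filter_upwards [self_mem_nhdsWithin] with t ht
      simp only [Function.comp_apply, map_smul, map_sub, realSg_comm hR ht]
    rw [map_neg, tendsto_nhds_unique h2 (hA u), neg_neg]
  · rintro rfl
    simpa using hA (-w)

theorem tendsto_realSg_zero (hR : IsResolvent R) (f : Lp ℝ 2 ν) :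
    Tendsto (fun t : ℝ => realSg R t f) (𝓝[>] 0) (𝓝 f) := by
  refine tendsto_of_denseRange (T := realSg R) (T₀ := ContinuousLinearMap.id ℝ _) (C := 1)
      ?_ (fun x => by simp) hR.denseRange (fun z => ?_) f
  · filter_upwards [self_mem_nhdsWithin] with t ht x
    simpa using norm_realSg_le' hR ht x
  · rw [tendsto_iff_norm_sub_tendsto_zero]
    refine squeeze_zero' (Eventually.of_forall fun _ => norm_nonneg _)
      (g := fun t => t * ‖z‖) ?_ ?_
    · filter_upwards [self_mem_nhdsWithin] with t ht
      exact norm_realSg_sub_self_le hR ht z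
    · have : Tendsto (fun t : ℝ => t * ‖z‖) (𝓝 0) (𝓝 (0 * ‖z‖)) :=
        tendsto_id.mul_const ‖z‖
      rw [zero_mul] at this
      exact this.mono_left nhdsWithin_le_nhds

/-- The semigroup `exp (-t (R⁻¹ - lam))`. -/
def IsResolvent.semigroup (hR : IsResolvent R) (lam : ℝ) : C0Semigroup (Lp ℝ 2 ν) where
  op t := if t = 0 then ContinuousLinearMap.id ℝ _ else Real.exp (lam * t) • realSg R t
  op_zero := if_pos rfl
  op_add s t := by
    by_cases hs : s = 0
    · simp [hs]
    by_cases ht : t = 0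
    · simp [ht]
    have hs' : (0 : ℝ) < s := by exact_mod_cast pos_iff_ne_zero.2 hs
    have ht' : (0 : ℝ) < t := by exact_mod_cast pos_iff_ne_zero.2 ht
    rw [if_neg hs, if_neg ht, if_neg (by simp [hs])]
    ext1 f
    simp only [ContinuousLinearMap.comp_apply, smul_apply, map_smul, NNReal.coe_add]
    rw [realSg_add hR hs' ht', smul_smul, ← Real.exp_add, mul_add, add_comm]
  tendsto_zero f := by
    have h1 : Tendsto (fun t : ℝ => Real.exp (lam * t) • realSg R t f) (𝓝[>] 0) (𝓝 f) := by
      have h2 : Tendsto (fun t : ℝ => Real.exp (lam * t)) (𝓝[>] 0) (𝓝 1) := by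
        have : Continuous fun t : ℝ => Real.exp (lam * t) := by fun_prop
        have := this.tendsto 0
        simp only [mul_zero, Real.exp_zero] at this
        exact this.mono_left nhdsWithin_le_nhds
      simpa using h2.smul (tendsto_realSg_zero hR f)
    have h3 : Tendsto ((↑) : ℝ≥0 → ℝ) (𝓝[≠] 0) (𝓝[>] 0) := by
      refine tendsto_nhdsWithin_iff.2 ⟨?_, ?_⟩
      · exact (NNReal.continuous_coe.tendsto 0).mono_left nhdsWithin_le_nhds
      · filter_upwards [self_mem_nhdsWithin] with t ht
        exact_mod_cast pos_iff_ne_zero.2 ht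
    have h4 : ContinuousAt (fun t : ℝ≥0 => (if t = 0 then ContinuousLinearMap.id ℝ _ else
        Real.exp (lam * t) • realSg R t : Lp ℝ 2 ν →L[ℝ] Lp ℝ 2 ν) f) 0 := by
      rw [continuousAt_iff_punctured_nhds]
      refine Tendsto.congr' ?_ (by simpa using h1.comp h3)
      filter_upwards [self_mem_nhdsWithin] with t ht
      have ht' : t ≠ 0 := ht
      rw [if_neg ht']
      rfl
    simpa [ContinuousAt] using h4

theorem IsResolvent.semigroup_op (hR : IsResolvent R) (lam : ℝ) {t : ℝ≥0} (ht : 0 < t) :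
    (hR.semigroup lam).op t = Real.exp (lam * t) • realSg R t := if_neg ht.ne'

/-- The product rule for `exp (lam t) S(t)`: the generator is `lam - R⁻¹`, written without an
inverse. -/
theorem IsResolvent.semigroup_generator_iff (hR : IsResolvent R) (lam : ℝ) (u w : Lp ℝ 2 ν) :
    (hR.semigroup lam).Generator u w ↔ R (lam • u - w) = u := by
  have hmap : map ((↑) : ℝ≥0 → ℝ) (𝓝[>] 0) = 𝓝[>] 0 := by
    have h1 := NNReal.isEmbedding_coe.map_nhdsWithin_eq (Set.Ioi 0) 0
    have h2 : ((↑) : ℝ≥0 → ℝ) '' Set.Ioi 0 = Set.Ioi 0 := by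
      ext x
      refine ⟨?_, fun hx => ⟨⟨x, le_of_lt hx⟩, by exact_mod_cast hx, rfl⟩⟩
      rintro ⟨y, hy, rfl⟩
      exact_mod_cast hy
    rwa [h2] at h1
  have h0 : (hR.semigroup lam).Generator u w ↔
      Tendsto (fun t : ℝ => t⁻¹ • (Real.exp (lam * t) • realSg R t u - u)) (𝓝[>] 0) (𝓝 w) := by
    rw [C0Semigroup.Generator, ← hmap, tendsto_map'_iff]
    refine tendsto_congr' ?_
    filter_upwards [self_mem_nhdsWithin] with t ht
    rw [hR.semigroup_op lam ht]
    rfl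
  have hexp : Tendsto (fun t : ℝ => Real.exp (lam * t)) (𝓝[>] 0) (𝓝 1) := by
    have : Continuous fun t : ℝ => Real.exp (lam * t) := by fun_prop
    have := this.tendsto 0
    simp only [mul_zero, Real.exp_zero] at this
    exact this.mono_left nhdsWithin_le_nhds
  have hder : Tendsto (fun t : ℝ => t⁻¹ * (Real.exp (lam * t) - 1)) (𝓝[>] 0) (𝓝 lam) := by
    have h1 : HasDerivAt (fun t : ℝ => Real.exp (lam * t)) lam 0 := by
      have := ((hasDerivAt_id (0 : ℝ)).const_mul lam).exp
      simpa using this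
    have h2 := h1.tendsto_slope_zero_right
    simpa using h2
  have hid : ∀ t : ℝ, t⁻¹ • (Real.exp (lam * t) • realSg R t u - u) =
      Real.exp (lam * t) • (t⁻¹ • (realSg R t u - u)) +
        (t⁻¹ * (Real.exp (lam * t) - 1)) • u := by
    intro t
    module
  rw [h0, ← neg_sub w (lam • u), ← tendsto_realSg_generator_iff hR]
  constructor
  · intro h
    have h1 := (hexp.inv₀ one_ne_zero).smul (h.sub (hder.smul_const u))
    rw [inv_one, one_smul] at h1
    refine h1.congr fun t => ?_
    rw [hid, add_sub_cancel_right, smul_smul, inv_mul_cancel₀ (Real.exp_pos _).ne', one_smul]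
  · intro h
    have h1 := (hexp.smul h).add (hder.smul_const u)
    rw [one_smul, sub_add_cancel] at h1
    exact h1.congr fun t => (hid t).symm

theorem re_pos_of_mem_sector {z : ℂ} (hz : z ∈ sector (Real.pi / 2)) : 0 < z.re :=
  (Complex.abs_arg_lt_pi_div_two_iff.1 hz.2).resolve_right hz.1

/-- The angle is the full `π / 2`, since `R` has real nonnegative spectrum and `exp (-z / r)` stays
bounded by one for `Re z > 0`. Strong continuity at zero holds on the dense range of the
complexified resolvent, with error at most `‖z‖ ‖g‖`. -/
theorem IsResolvent.isAnalyticSemigroup (hR : IsResolvent R) (lam : ℝ) :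
    IsAnalyticSemigroup (hR.semigroup lam) := by
  have hC := hR.isPositiveContraction
  refine ⟨Real.pi / 2, by positivity, le_rfl,
    fun z => Complex.exp (lam * z) • IsPositiveContraction.sg (complexify R) z, ?_, ?_, ?_, ?_⟩
  · intro z hz
    have h1 := hC.hasDerivAt_sg (re_pos_of_mem_sector hz)
    refine DifferentiableAt.differentiableWithinAt ?_
    refine DifferentiableAt.fun_smul (by fun_prop) h1.differentiableAt
  · intro z hz w hw
    ext1 f
    simp only [hC.sg_add (re_pos_of_mem_sector hz) (re_pos_of_mem_sector hw),
      ContinuousLinearMap.comp_apply, smul_apply, map_smul]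
    rw [smul_smul, ← Complex.exp_add, mul_add, add_comm]
  · intro θ' _ hθ' f
    have hsub : sector θ' ⊆ sector (Real.pi / 2) := fun z hz => ⟨hz.1, hz.2.trans hθ'⟩
    have hlim : Tendsto (fun z => IsPositiveContraction.sg (complexify R) z f)
        (𝓝[sector (Real.pi / 2)] 0) (𝓝 f) := by
      have hdense : DenseRange (complexify R) := by
        intro g
        rw [eq_ofRealL_add g]
        refine mem_closure_iff_seq_limit.2 ?_
        obtain ⟨x, hx, hx'⟩ := mem_closure_iff_seq_limit.1 (hR.denseRange (reL ν g))
        obtain ⟨y, hy, hy'⟩ := mem_closure_iff_seq_limit.1 (hR.denseRange (imL ν g))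
        choose x' hx2 using hx
        choose y' hy2 using hy
        refine ⟨fun n => complexify R (ofRealL ν (x' n) + Complex.I • ofRealL ν (y' n)),
          fun n => ⟨_, rfl⟩, ?_⟩
        simp only [map_add, map_smul, complexify_ofRealL, hx2, hy2]
        exact (((ofRealL ν).continuous.tendsto _).comp hx').add
          ((((ofRealL ν).continuous.tendsto _).comp hy').const_smul Complex.I)
      refine tendsto_of_denseRange (T := IsPositiveContraction.sg (complexify R))
        (T₀ := ContinuousLinearMap.id ℂ _) (C := 1) ?_ (fun x => by simp) hdense (fun g => ?_) f
      · filter_upwards [self_mem_nhdsWithin] with z hz x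
        exact (IsPositiveContraction.sg (complexify R) z).le_of_opNorm_le
          (hC.norm_sg_le_one (re_pos_of_mem_sector hz).le) x
      · rw [tendsto_iff_norm_sub_tendsto_zero]
        refine squeeze_zero' (Eventually.of_forall fun _ => norm_nonneg _)
          (g := fun z => ‖z‖ * ‖g‖) ?_ ?_
        · filter_upwards [self_mem_nhdsWithin] with z hz
          exact hC.norm_sg_sub_apply_le (re_pos_of_mem_sector hz) g
        · have : Tendsto (fun z : ℂ => ‖z‖ * ‖g‖) (𝓝 0) (𝓝 (‖(0 : ℂ)‖ * ‖g‖)) :=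
            (tendsto_id.norm).mul_const ‖g‖
          rw [norm_zero, zero_mul] at this
          exact this.mono_left nhdsWithin_le_nhds
    have hexp : Tendsto (fun z : ℂ => Complex.exp (lam * z)) (𝓝[sector θ'] 0) (𝓝 1) := by
      have : Continuous fun z : ℂ => Complex.exp (lam * z) := by fun_prop
      have := this.tendsto 0
      simp only [mul_zero, Complex.exp_zero] at this
      exact this.mono_left nhdsWithin_le_nhds
    simpa using hexp.smul (hlim.mono_left (nhdsWithin_mono 0 hsub))
  · intro t ht f
    have ht' : (0 : ℝ) < t := ht
    change (Complex.exp (lam * ((t : ℝ) : ℂ)) •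
      IsPositiveContraction.sg (complexify R) ((t : ℝ) : ℂ)) (ofRealL ν f) = ofRealL ν ((hR.semigroup lam).op t f)
    rw [hR.semigroup_op lam ht, smul_apply, smul_apply, sg_ofRealL hR ht', ofRealL_smul]
    push_cast
    rfl

theorem IsResolvent.norm_semigroup_le (hR : IsResolvent R) (lam : ℝ) (t : ℝ≥0) :
    ‖(hR.semigroup lam).op t‖ ≤ Real.exp ((lam - 1) * t) := by
  rcases eq_or_ne t 0 with rfl | ht
  · rw [(hR.semigroup lam).op_zero]
    simp only [NNReal.coe_zero, mul_zero, Real.exp_zero]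
    exact ContinuousLinearMap.norm_id_le
  · have ht' : 0 < t := pos_iff_ne_zero.2 ht
    rw [hR.semigroup_op lam ht', norm_smul, Real.norm_of_nonneg (Real.exp_pos _).le]
    have h2 : ‖realSg R t‖ ≤ Real.exp (-t) :=
      ContinuousLinearMap.opNorm_le_bound _ (Real.exp_pos _).le
        (norm_realSg_le hR (NNReal.coe_pos.2 ht'))
    calc _ ≤ Real.exp (lam * t) * Real.exp (-t) := by gcongr
      _ = _ := by
        rw [← Real.exp_add]
        congr 1
        ring

theorem norm_pow_apply_le {H : Type*} [NormedAddCommGroup H] [NormedSpace ℝ H]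
    {Q : H →L[ℝ] H} (hQ : ∀ f, ‖Q f‖ ≤ ‖f‖) (n : ℕ) (f : H) : ‖(Q ^ n) f‖ ≤ ‖f‖ := by
  induction n with
  | zero => simp
  | succ n ih =>
    rw [pow_succ', mul_apply_eq_comp]
    exact (hQ _).trans ih

/-- The exponential formula `exp (-t R⁻¹) = lim (1 + t / n R⁻¹)⁻ⁿ`. -/
theorem tendsto_euler (hR : IsResolvent R) {t : ℝ} (ht : 0 < t)
    {Q : ℕ → Lp ℝ 2 ν →L[ℝ] Lp ℝ 2 ν}
    (hQ : ∀ n f, R (Q n f) + (t / (n + 1 : ℕ)) • Q n f = R f) (f : Lp ℝ 2 ν) :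
    Tendsto (fun n => (Q n ^ (n + 1)) f) atTop (𝓝 (realSg R t f)) := by
  refine tendsto_of_denseRange (T := fun n => Q n ^ (n + 1)) (T₀ := realSg R t) (C := 1)
    (Eventually.of_forall fun n x => ?_) (fun x => ?_) hR.denseRange_sq (fun z => ?_) f
  · rw [one_mul]
    exact norm_pow_apply_le (norm_euler_operator_le hR.nonneg (by positivity) (hQ n)) _ x
  · rw [one_mul]
    exact norm_realSg_le' hR ht x
  · rw [tendsto_iff_norm_sub_tendsto_zero]
    refine squeeze_zero (fun _ => norm_nonneg _) (fun n => ?_)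
      (g := fun n : ℕ => t ^ 2 / (n + 1 : ℕ) * ‖z‖) ?_
    · rw [norm_sub_rev]
      exact norm_realSg_sub_le hR ht n.succ_pos (hQ n) z
    · have := (tendsto_const_div_atTop_nhds_zero_nat (t ^ 2)).comp (tendsto_add_atTop_nat 1)
      simpa using this.mul_const ‖z‖

/-- Strong convergence of the resolvents implies strong convergence of the semigroups. -/
theorem tendsto_realSg {Rs : ℕ → Lp ℝ 2 ν →L[ℝ] Lp ℝ 2 ν} (hRs : ∀ j, IsResolvent (Rs j))
    (hR : IsResolvent R) (h : ∀ f, Tendsto (fun j => Rs j f) atTop (𝓝 (R f))) {t : ℝ} (ht : 0 < t)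
    (f : Lp ℝ 2 ν) : Tendsto (fun j => realSg (Rs j) t f) atTop (𝓝 (realSg R t f)) := by
  refine tendsto_of_denseRange (T := fun j => realSg (Rs j) t) (T₀ := realSg R t) (C := 1)
    (Eventually.of_forall fun n x => ?_) (fun x => ?_) hR.denseRange_sq (fun z => ?_) f
  · rw [one_mul]
    exact norm_realSg_le' (hRs n) ht x
  · rw [one_mul]
    exact norm_realSg_le' hR ht x
  · have hsq : Tendsto (fun j => Rs j (Rs j z)) atTop (𝓝 (R (R z))) := by
      have h1 : Tendsto (fun j => Rs j (R z) - Rs j (R z - Rs j z)) atTop (𝓝 (R (R z) - 0)) := by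
        refine (h (R z)).sub (squeeze_zero_norm (fun j => (hRs j).norm_le _) ?_)
        have := ((h z).const_sub (R z)).norm
        simpa using this
      rw [sub_zero] at h1
      refine h1.congr fun j => ?_
      rw [map_sub]
      abel
    have hQex : ∀ n : ℕ, 0 < n → ∃ (Q : Lp ℝ 2 ν →L[ℝ] Lp ℝ 2 ν)
        (Qs : ℕ → Lp ℝ 2 ν →L[ℝ] Lp ℝ 2 ν), (∀ f, R (Q f) + (t / n) • Q f = R f) ∧
        (∀ j f, Rs j (Qs j f) + (t / n) • Qs j f = Rs j f) := by
      intro n hn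
      obtain ⟨Q, hQ⟩ := exists_euler_operator hR.nonneg (s := t / n) (by positivity)
      choose Qs hQs using fun j => exists_euler_operator (hRs j).nonneg (s := t / n) (by positivity)
      exact ⟨Q, Qs, hQ, hQs⟩
    have hQlim : ∀ n : ℕ, 0 < n → ∀ (Q : Lp ℝ 2 ν →L[ℝ] Lp ℝ 2 ν)
        (Qs : ℕ → Lp ℝ 2 ν →L[ℝ] Lp ℝ 2 ν), (∀ f, R (Q f) + (t / n) • Q f = R f) →
        (∀ j f, Rs j (Qs j f) + (t / n) • Qs j f = Rs j f) → ∀ (m : ℕ) (g : Lp ℝ 2 ν),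
        Tendsto (fun j => (Qs j ^ m) g) atTop (𝓝 ((Q ^ m) g)) := by
      intro n hn Q Qs hQ hQs
      have hs : 0 < t / n := by positivity
      have hone : ∀ g, Tendsto (fun j => Qs j g) atTop (𝓝 (Q g)) := by
        intro g
        rw [tendsto_iff_norm_sub_tendsto_zero]
        refine squeeze_zero (fun _ => norm_nonneg _)
          (g := fun j => (t / n)⁻¹ * ‖(Rs j (g - Q g) - R (g - Q g))‖) (fun j => ?_) ?_
        · have e : Rs j (Qs j g - Q g) + (t / n) • (Qs j g - Q g) =
              Rs j (g - Q g) - R (g - Q g) := by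
            simp only [map_sub, smul_sub]
            rw [← hQs j g, ← hQ g]
            abel
          have h1 : inner ℝ (Rs j (g - Q g) - R (g - Q g)) (Qs j g - Q g) ≥
              (t / n) * ‖Qs j g - Q g‖ ^ 2 := by
            rw [← e, inner_add_left, real_inner_smul_left, real_inner_self_eq_norm_sq]
            linarith [(hRs j).nonneg (Qs j g - Q g)]
          have h2 := real_inner_le_norm (Rs j (g - Q g) - R (g - Q g)) (Qs j g - Q g)
          rw [le_inv_mul_iff₀ hs]
          rcases (norm_nonneg (Qs j g - Q g)).eq_or_lt with h0 | h0
          · rw [← h0]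
            simp
          · refine le_of_mul_le_mul_right ?_ h0
            calc _ = (t / n) * ‖Qs j g - Q g‖ ^ 2 := by ring
              _ ≤ _ := h1.le.trans h2
        · have := ((h (g - Q g)).sub_const (R (g - Q g))).norm.const_mul (t / n)⁻¹
          simpa using this
      intro m
      induction m with
      | zero => intro g; simp
      | succ m ih =>
        intro g
        have h1 : Tendsto (fun j => (Qs j ^ m) (Q g) - (Qs j ^ m) (Q g - Qs j g)) atTop
            (𝓝 ((Q ^ m) (Q g) - 0)) := by
          refine (ih (Q g)).sub (squeeze_zero_norm (fun j => norm_pow_apply_le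
            (norm_euler_operator_le (hRs j).nonneg hs (hQs j)) m _) ?_)
          have := ((hone g).const_sub (Q g)).norm
          simpa using this
        rw [sub_zero] at h1
        simp only [pow_succ, mul_apply_eq_comp]
        refine h1.congr fun j => ?_
        rw [map_sub]
        abel
    rw [Metric.tendsto_atTop]
    intro ε hε
    obtain ⟨n, hn⟩ : ∃ n : ℕ, t ^ 2 / (n + 1 : ℕ) * ‖z‖ < ε / 8 := by
      have := ((tendsto_const_div_atTop_nhds_zero_nat (t ^ 2)).comp
        (tendsto_add_atTop_nat 1)).mul_const ‖z‖
      rw [zero_mul] at this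
      exact ((tendsto_order.1 this).2 (ε / 8) (by positivity)).exists
    obtain ⟨Q, Qs, hQ, hQs⟩ := hQex (n + 1) n.succ_pos
    have hl := hQlim (n + 1) n.succ_pos Q Qs hQ hQs (n + 1) (R (R z))
    obtain ⟨N₁, hN₁⟩ := Metric.tendsto_atTop.1 hl (ε / 8) (by positivity)
    obtain ⟨N₂, hN₂⟩ := Metric.tendsto_atTop.1 hsq (ε / 8) (by positivity)
    refine ⟨max N₁ N₂, fun j hj => ?_⟩
    have h1 := hN₁ j (le_of_max_le_left hj)
    have h2 := hN₂ j (le_of_max_le_right hj)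
    rw [dist_eq_norm] at h1 h2 ⊢
    have h3 := norm_realSg_sub_le hR ht n.succ_pos hQ z
    have h4 := norm_realSg_sub_le (hRs j) ht n.succ_pos (hQs j) z
    have h5 := norm_realSg_le' (hRs j) ht (Rs j (Rs j z) - R (R z))
    have h6 := norm_pow_apply_le (norm_euler_operator_le (hRs j).nonneg
      (by positivity) (hQs j)) (n + 1) (Rs j (Rs j z) - R (R z))
    -- The errors of `n + 1` Euler steps are uniform in `j`, so `n` is fixed first; the remaining
    -- terms tend to zero as `j → ∞`.
    have e : realSg (Rs j) t (R (R z)) - realSg R t (R (R z)) =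
        (realSg (Rs j) t (Rs j (Rs j z)) - (Qs j ^ (n + 1)) (Rs j (Rs j z))) -
        realSg (Rs j) t (Rs j (Rs j z) - R (R z)) +
        (Qs j ^ (n + 1)) (Rs j (Rs j z) - R (R z)) +
        ((Qs j ^ (n + 1)) (R (R z)) - (Q ^ (n + 1)) (R (R z))) -
        (realSg R t (R (R z)) - (Q ^ (n + 1)) (R (R z))) := by
      simp only [map_sub]
      abel
    rw [e]
    have t1 := norm_sub_le ((realSg (Rs j) t (Rs j (Rs j z)) -
        (Qs j ^ (n + 1)) (Rs j (Rs j z))) - realSg (Rs j) t (Rs j (Rs j z) - R (R z)) +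
        (Qs j ^ (n + 1)) (Rs j (Rs j z) - R (R z)) +
        ((Qs j ^ (n + 1)) (R (R z)) - (Q ^ (n + 1)) (R (R z))))
        (realSg R t (R (R z)) - (Q ^ (n + 1)) (R (R z)))
    have t2 := norm_add_le ((realSg (Rs j) t (Rs j (Rs j z)) -
        (Qs j ^ (n + 1)) (Rs j (Rs j z))) - realSg (Rs j) t (Rs j (Rs j z) - R (R z)) +
        (Qs j ^ (n + 1)) (Rs j (Rs j z) - R (R z)))
        ((Qs j ^ (n + 1)) (R (R z)) - (Q ^ (n + 1)) (R (R z)))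
    have t3 := norm_add_le ((realSg (Rs j) t (Rs j (Rs j z)) -
        (Qs j ^ (n + 1)) (Rs j (Rs j z))) - realSg (Rs j) t (Rs j (Rs j z) - R (R z)))
        ((Qs j ^ (n + 1)) (Rs j (Rs j z) - R (R z)))
    have t4 := norm_sub_le (realSg (Rs j) t (Rs j (Rs j z)) -
        (Qs j ^ (n + 1)) (Rs j (Rs j z))) (realSg (Rs j) t (Rs j (Rs j z) - R (R z)))
    linarith

theorem IsResolvent.tendsto_semigroup {Rs : ℕ → Lp ℝ 2 ν →L[ℝ] Lp ℝ 2 ν}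
    (hRs : ∀ j, IsResolvent (Rs j)) (hR : IsResolvent R)
    (h : ∀ f, Tendsto (fun j => Rs j f) atTop (𝓝 (R f))) (lam : ℝ) (t : ℝ≥0) (f : Lp ℝ 2 ν) :
    Tendsto (fun j => ((hRs j).semigroup lam).op t f) atTop (𝓝 ((hR.semigroup lam).op t f)) := by
  rcases eq_or_ne t 0 with rfl | ht
  · simp only [C0Semigroup.op_zero]
    exact tendsto_const_nhds
  · have ht' : 0 < t := pos_iff_ne_zero.2 ht
    simp only [IsResolvent.semigroup_op _ _ ht']
    exact (tendsto_realSg hRs hR h (NNReal.coe_pos.2 ht') f).const_smul (Real.exp (lam * t))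

/-- Comparison of semigroups via comparison of the resolvents. -/
theorem IsResolvent.semigroup_mono {R' : Lp ℝ 2 ν →L[ℝ] Lp ℝ 2 ν} (hR : IsResolvent R)
    (hR' : IsResolvent R') {s₀ : ℝ} (hs₀ : 0 < s₀)
    (h : ∀ s, 0 < s → s < s₀ → ∀ u u' f f' : Lp ℝ 2 ν, R u + s • u = R f →
      R' u' + s • u' = R' f' → 0 ≤ f → f ≤ f' → 0 ≤ u ∧ u ≤ u') (lam : ℝ) (t : ℝ≥0)
    {f : Lp ℝ 2 ν} (hf : 0 ≤ f) :
    0 ≤ (hR.semigroup lam).op t f ∧ (hR.semigroup lam).op t f ≤ (hR'.semigroup lam).op t f := by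
  rcases eq_or_ne t 0 with rfl | ht
  · simp only [C0Semigroup.op_zero]
    exact ⟨hf, le_rfl⟩
  · have ht' : 0 < t := pos_iff_ne_zero.2 ht
    have htr : (0 : ℝ) < t := ht'
    choose Q hQ using fun n : ℕ => exists_euler_operator hR.nonneg
      (s := t / (n + 1 : ℕ)) (by positivity)
    choose Q' hQ' using fun n : ℕ => exists_euler_operator hR'.nonneg
      (s := t / (n + 1 : ℕ)) (by positivity)
    have hlim := tendsto_euler hR htr hQ f
    have hlim' := tendsto_euler hR' htr hQ' f
    -- Order is assumed for small steps only, which is enough because Euler's formula uses steps of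
    -- length `t / (n + 1)`.
    have hev : ∀ᶠ n : ℕ in atTop, (t : ℝ) / (n + 1 : ℕ) < s₀ := by
      have := (tendsto_const_div_atTop_nhds_zero_nat (t : ℝ)).comp (tendsto_add_atTop_nat 1)
      exact (tendsto_order.1 this).2 s₀ hs₀
    have key : ∀ᶠ n in atTop, 0 ≤ (Q n ^ (n + 1)) f ∧ (Q n ^ (n + 1)) f ≤ (Q' n ^ (n + 1)) f := by
      filter_upwards [hev] with n hn
      have : ∀ m : ℕ, 0 ≤ (Q n ^ m) f ∧ (Q n ^ m) f ≤ (Q' n ^ m) f := by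
        intro m
        induction m with
        | zero => simpa using hf
        | succ m ih =>
          simp only [pow_succ', mul_apply_eq_comp]
          exact h _ (by positivity) hn _ _ _ _ (hQ n _) (hQ' n _) ih.1 ih.2
      exact this (n + 1)
    have h1 : 0 ≤ realSg R t f := ge_of_tendsto hlim (key.mono fun n hn => hn.1)
    have h2 : realSg R t f ≤ realSg R' t f :=
      le_of_tendsto_of_tendsto hlim hlim' (key.mono fun n hn => hn.2)
    rw [hR.semigroup_op _ ht', hR'.semigroup_op _ ht']
    have hsm : ∀ (c : ℝ) (g : Lp ℝ 2 ν), 0 ≤ c → 0 ≤ g → 0 ≤ c • g := by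
      intro c g hc hg
      rw [← Lp.coeFn_nonneg] at hg ⊢
      filter_upwards [hg, Lp.coeFn_smul c g] with x hx hx2
      rw [hx2]
      exact mul_nonneg hc hx
    refine ⟨hsm _ _ (Real.exp_pos _).le h1, ?_⟩
    rw [← sub_nonneg] at h2 ⊢
    have := hsm (Real.exp (lam * t)) _ (Real.exp_pos _).le h2
    rwa [smul_sub] at this

end RealSemigroup

/-! ### The Gaussian weight -/

section Weight

variable {N n : ℕ} {A : Matrix (Fin N) (Fin N) ℝ} {a : Fin n → E N}

variable (A) in
/-- The linear map of the matrix `A`. -/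
def matCLM : E N →L[ℝ] E N := (Matrix.toEuclideanLin A).toContinuousLinearMap

theorem toEuclideanLin_eq_matCLM (x : E N) : Matrix.toEuclideanLin A x = matCLM A x := rfl

variable (A a) in
/-- The quadratic exponent of the density. -/
def quadExp (x : E N) : ℝ := ∑ i, inner ℝ (matCLM A (x - a i)) (x - a i)

variable (A a) in
/-- The drift `∑ᵢ A (x - aᵢ)`. -/
def drift (x : E N) : E N := ∑ i, matCLM A (x - a i)

theorem gaussExp_eq (x : E N) : gaussExp A a x = Real.exp (-(1 / 2) * quadExp A a x) := rfl

variable [hA : Fact A.PosDef]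

theorem matCLM_inner_pos {x : E N} (hx : x ≠ 0) : 0 < inner ℝ (matCLM A x) x := by
  have h := hA.out.dotProduct_mulVec_pos (x := x.ofLp) (by simpa using hx)
  rw [← toEuclideanLin_eq_matCLM, real_inner_comm, EuclideanSpace.inner_eq_star_dotProduct,
    dotProduct_comm]
  simpa [Matrix.toLpLin_apply] using h

theorem matCLM_inner_nonneg (x : E N) : 0 ≤ inner ℝ (matCLM A x) x := by
  rcases eq_or_ne x 0 with rfl | hx
  · simp
  · exact (matCLM_inner_pos hx).le

theorem matCLM_symm (x y : E N) : inner ℝ (matCLM A x) y = inner ℝ x (matCLM A y) :=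
  Matrix.isSymmetric_toEuclideanLin_iff.2 hA.out.1 x y

variable (A) in
theorem exists_matCLM_coercive : ∃ c : ℝ, 0 < c ∧ ∀ x : E N, c * ‖x‖ ^ 2 ≤ inner ℝ (matCLM A x) x := by
  rcases (Metric.sphere (0 : E N) 1).eq_empty_or_nonempty with he | hne
  · refine ⟨1, one_pos, fun x => ?_⟩
    rcases eq_or_ne x 0 with rfl | hx
    · simp
    · have : ‖x‖⁻¹ • x ∈ Metric.sphere (0 : E N) 1 := by
        rw [mem_sphere_zero_iff_norm, norm_smul, norm_inv, norm_norm,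
          inv_mul_cancel₀ (norm_ne_zero_iff.2 hx)]
      rw [he] at this
      exact this.elim
  · obtain ⟨y, hy, hmin⟩ := (isCompact_sphere (0 : E N) 1).exists_isMinOn hne
      (f := fun x => inner ℝ (matCLM A x) x)
      ((matCLM A).continuous.inner (𝕜 := ℝ) continuous_id).continuousOn
    have hy0 : y ≠ 0 := by
      rintro rfl
      simp at hy
    refine ⟨inner ℝ (matCLM A y) y, matCLM_inner_pos hy0, fun x => ?_⟩
    rcases eq_or_ne x 0 with rfl | hx
    · simp
    · have hx' : 0 < ‖x‖ := norm_pos_iff.2 hx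
      have : ‖x‖⁻¹ • x ∈ Metric.sphere (0 : E N) 1 := by
        rw [mem_sphere_zero_iff_norm, norm_smul, norm_inv, norm_norm,
          inv_mul_cancel₀ hx'.ne']
      have h := hmin this
      simp only [Set.mem_ofPred_eq, map_smul, real_inner_smul_left, real_inner_smul_right] at h
      calc _ ≤ (‖x‖⁻¹ * (‖x‖⁻¹ * inner ℝ (matCLM A x) x)) * ‖x‖ ^ 2 := by gcongr
        _ = _ := by field_simp

theorem quadExp_nonneg (x : E N) : 0 ≤ quadExp A a x :=
  Finset.sum_nonneg fun _ _ => matCLM_inner_nonneg _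

theorem contDiff_quadExp : ContDiff ℝ ∞ (quadExp A a) := by
  unfold quadExp
  refine ContDiff.sum fun i _ => ContDiff.inner ℝ ?_ ?_ <;> fun_prop

theorem hasFDerivAt_quadExp (x : E N) :
    HasFDerivAt (quadExp A a) (2 • innerSL ℝ (drift A a x)) x := by
  have h : ∀ i ∈ Finset.univ, HasFDerivAt (fun y => inner ℝ (matCLM A (y - a i)) (y - a i))
      (2 • innerSL ℝ (matCLM A (x - a i))) x := by
    intro i _
    have h1 : HasFDerivAt (fun y : E N => y - a i) (ContinuousLinearMap.id ℝ (E N)) x :=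
      (hasFDerivAt_id x).sub_const (a i)
    have h2 : HasFDerivAt (fun y : E N => matCLM A (y - a i)) (matCLM A) x := by
      exact ((matCLM A).hasFDerivAt (x := x - a i)).comp x h1
    refine (h2.inner ℝ h1).congr_fderiv ?_
    ext v
    simp only [ContinuousLinearMap.comp_apply, ContinuousLinearMap.prod_apply,
      fderivInnerCLM_apply, smul_apply, innerSL_apply_apply, ContinuousLinearMap.id_apply]
    rw [matCLM_symm v, real_inner_comm v, two_smul]
  refine (HasFDerivAt.fun_sum h).congr_fderiv ?_
  rw [drift, map_sum, Finset.smul_sum]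

variable [NeZero n]

variable (A a) in
theorem integrable_gaussExp : Integrable (gaussExp A a) := by
  obtain ⟨c, hc, h⟩ := exists_matCLM_coercive A
  have h1 : Integrable (fun x : E N => Real.exp (-(c / 2) * ‖x‖ ^ 2)) := by
    have := (GaussianFourier.integrable_cexp_neg_mul_sq_norm_add (V := E N) (b := (c / 2 : ℝ))
      (by simpa using hc) 0 0).re
    refine this.congr (Eventually.of_forall fun x => ?_)
    simp only [zero_mul, add_zero, RCLike.re_eq_complex_re]
    rw [← Complex.ofReal_re (Real.exp _)]
    congr 1
    push_cast
    rfl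
  have h2 := h1.comp_sub_right (a 0)
  refine h2.mono' ?_ (Eventually.of_forall fun x => ?_)
  · have : Continuous (gaussExp A a) := by
      have := (contDiff_quadExp (A := A) (a := a)).continuous
      exact Real.continuous_exp.comp (continuous_const.mul this)
    exact this.aestronglyMeasurable
  · rw [gaussExp_eq, Real.norm_of_nonneg (Real.exp_pos _).le, Real.exp_le_exp]
    have h3 : inner ℝ (matCLM A (x - a 0)) (x - a 0) ≤ quadExp A a x :=
      Finset.single_le_sum (f := fun i => inner ℝ (matCLM A (x - a i)) (x - a i))
        (fun i _ => matCLM_inner_nonneg _) (Finset.mem_univ 0)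
    have h4 := h (x - a 0)
    linarith

variable (A a) in
theorem integral_gaussExp_pos : 0 < ∫ x, gaussExp A a x :=
  integral_exp_pos (f := fun x => -(1 / 2) * quadExp A a x) (integrable_gaussExp A a)

theorem density_pos (x : E N) : 0 < density A a x :=
  mul_pos (inv_pos.2 (integral_gaussExp_pos A a)) (Real.exp_pos _)

theorem density_le (x : E N) : density A a x ≤ (∫ x, gaussExp A a x)⁻¹ := by
  refine mul_le_of_le_one_right (inv_pos.2 (integral_gaussExp_pos A a)).le ?_
  rw [gaussExp_eq, Real.exp_le_one_iff]
  have := quadExp_nonneg (A := A) (a := a) x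
  linarith

theorem contDiff_density : ContDiff ℝ ∞ (density A a) :=
  contDiff_const.mul (Real.contDiff_exp.comp (contDiff_const.mul contDiff_quadExp))

theorem continuous_density : Continuous (density A a) := contDiff_density.continuous

theorem hasFDerivAt_density (x : E N) :
    HasFDerivAt (density A a) (-density A a x • innerSL ℝ (drift A a x)) x := by
  have h := (((hasFDerivAt_quadExp (A := A) (a := a) x).const_mul (-(1 / 2))).exp).const_mul
    (∫ y, gaussExp A a y)⁻¹
  refine h.congr_fderiv ?_
  ext v
  simp only [smul_apply, smul_eq_mul, density, gaussExp_eq]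
  simp
  ring

theorem integrable_density : Integrable (density A a) := (integrable_gaussExp A a).const_mul _

instance : IsFiniteMeasure (gaussMeasure A a) :=
  isFiniteMeasure_withDensity_ofReal integrable_density.2

theorem measurable_ofReal_density : Measurable fun x => ENNReal.ofReal (density A a x) :=
  continuous_density.measurable.ennreal_ofReal

variable (A a) in
theorem gaussMeasure_ac : gaussMeasure A a ≪ volume := withDensity_absolutelyContinuous _ _

variable (A a) in
theorem ac_gaussMeasure : (volume : Measure (E N)) ≪ gaussMeasure A a :=
  withDensity_absolutelyContinuous' measurable_ofReal_density.aemeasurable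
    (Eventually.of_forall fun x => (ENNReal.ofReal_pos.2 (density_pos x)).ne')

theorem ae_gaussMeasure_iff {p : E N → Prop} : (∀ᵐ x ∂gaussMeasure A a, p x) ↔ ∀ᵐ x, p x :=
  ⟨fun h => (ac_gaussMeasure A a).ae_le h, fun h => (gaussMeasure_ac A a).ae_le h⟩

theorem integral_gaussMeasure {F : Type*} [NormedAddCommGroup F] [NormedSpace ℝ F] (f : E N → F) :
    ∫ x, f x ∂gaussMeasure A a = ∫ x, density A a x • f x := by
  rw [gaussMeasure, integral_withDensity_eq_integral_toReal_smul measurable_ofReal_density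
    (Eventually.of_forall fun x => ENNReal.ofReal_lt_top)]
  simp only [ENNReal.toReal_ofReal (density_pos _).le]

theorem integrable_gaussMeasure_iff {F : Type*} [NormedAddCommGroup F] [NormedSpace ℝ F]
    {f : E N → F} : Integrable f (gaussMeasure A a) ↔ Integrable fun x => density A a x • f x := by
  rw [gaussMeasure, integrable_withDensity_iff_integrable_smul' measurable_ofReal_density
    (Eventually.of_forall fun x => ENNReal.ofReal_lt_top)]
  simp only [ENNReal.toReal_ofReal (density_pos _).le]

/-- The density is continuous and positive, hence bounded below on compact sets. -/
theorem locallyIntegrable_of_integrable {F : Type*} [NormedAddCommGroup F] [NormedSpace ℝ F]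
    {f : E N → F} (hf : Integrable f (gaussMeasure A a)) : LocallyIntegrable f volume := by
  rw [locallyIntegrable_iff]
  intro k hk
  have h1 := (integrable_gaussMeasure_iff.1 hf).integrableOn (s := k)
  have h2 : IntegrableOn (fun x => (density A a x)⁻¹ • density A a x • f x) k := by
    refine h1.continuousOn_smul ?_ hk
    exact (continuous_density.inv₀ fun x => (density_pos x).ne').continuousOn
  refine h2.congr_fun (fun x _ => ?_) hk.measurableSet
  simp only [smul_smul, inv_mul_cancel₀ (density_pos x).ne', one_smul]

theorem locallyIntegrable_Lp {F : Type*} [NormedAddCommGroup F] [NormedSpace ℝ F]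
    (f : Lp F 2 (gaussMeasure A a)) : LocallyIntegrable f volume :=
  locallyIntegrable_of_integrable ((Lp.memLp f).integrable one_le_two)

/-- The element of `L²_μ` representing the functional `f ↦ ∫ ⟨η, f⟩ dx`. -/
theorem memLp_inv_density_smul {F : Type*} [NormedAddCommGroup F] [NormedSpace ℝ F]
    {η : E N → F} (hη : Continuous η) (hc : HasCompactSupport η) :
    MemLp (fun x => (density A a x)⁻¹ • η x) 2 (gaussMeasure A a) :=
  ((continuous_density.inv₀ fun x => (density_pos x).ne').smul hη).memLp_of_hasCompactSupport
    (hc.smul_left)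

theorem inner_toLp_inv_density_smul {F : Type*} [NormedAddCommGroup F] [InnerProductSpace ℝ F]
    {η : E N → F} (hη : Continuous η) (hc : HasCompactSupport η)
    (f : Lp F 2 (gaussMeasure A a)) :
    inner ℝ ((memLp_inv_density_smul hη hc).toLp _) f = ∫ x, inner ℝ (η x) (f x) := by
  rw [L2.inner_def, integral_gaussMeasure]
  refine integral_congr_ae ?_
  have h := (memLp_inv_density_smul (A := A) (a := a) hη hc).coeFn_toLp
  filter_upwards [(ac_gaussMeasure A a).ae_le h] with x hx
  rw [hx, real_inner_smul_left, smul_eq_mul, mul_inv_cancel_left₀ (density_pos x).ne']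

end Weight

/-! ### The weighted Sobolev space and the Ornstein-Uhlenbeck operator -/

section WeakGradient

variable {N n : ℕ} {A : Matrix (Fin N) (Fin N) ℝ} {a : Fin n → E N} [hA : Fact A.PosDef] [NeZero n]

theorem IsWeakGradient.congr {f f' : E N → ℝ} {g g' : E N → E N} (h : IsWeakGradient f g)
    (hf : f =ᵐ[volume] f') (hg : g =ᵐ[volume] g') : IsWeakGradient f' g' := by
  intro φ hφ hc v
  rw [integral_congr_ae (g := fun x => f x * fderiv ℝ φ x v)
      (by filter_upwards [hf] with x hx; rw [hx]),
    integral_congr_ae (f := fun x => φ x * inner ℝ (g' x) v) (g := fun x => φ x * inner ℝ (g x) v)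
      (by filter_upwards [hg] with x hx; rw [hx])]
  exact h φ hφ hc v

theorem continuous_fderiv_apply {φ : E N → ℝ} (hφ : ContDiff ℝ ∞ φ) (v : E N) :
    Continuous fun x => fderiv ℝ φ x v :=
  (hφ.continuous_fderiv (by simp)).clm_apply continuous_const

theorem hasCompactSupport_fderiv_apply {φ : E N → ℝ} (hc : HasCompactSupport φ) (v : E N) :
    HasCompactSupport fun x => fderiv ℝ φ x v :=
  hc.fderiv_apply (𝕜 := ℝ) v

/-- Dividing the test functions by the density turns Lebesgue pairings into inner products of
`L²_μ`. The graph of the gradient is thus an intersection of kernels of continuous functionals, so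
it is linear and closed. -/
theorem isWeakGradient_iff_inner (u : L2 A a) (g : Lp (E N) 2 (gaussMeasure A a)) :
    IsWeakGradient u g ↔ ∀ (φ : E N → ℝ) (hφ : ContDiff ℝ ∞ φ) (hc : HasCompactSupport φ) (v : E N),
      inner ℝ ((memLp_inv_density_smul (A := A) (a := a) (continuous_fderiv_apply hφ v)
        (hasCompactSupport_fderiv_apply hc v)).toLp _) u +
      inner ℝ ((memLp_inv_density_smul (A := A) (a := a) (η := fun x => φ x • v)
        (hφ.continuous.smul continuous_const) hc.smul_right).toLp _) g = 0 := by
  refine forall_congr' fun φ => forall_congr' fun hφ => forall_congr' fun hc =>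
    forall_congr' fun v => ?_
  rw [inner_toLp_inv_density_smul (continuous_fderiv_apply hφ v)
    (hasCompactSupport_fderiv_apply hc v), inner_toLp_inv_density_smul (η := fun x => φ x • v)
    (hφ.continuous.smul continuous_const) hc.smul_right, eq_neg_iff_add_eq_zero]
  simp only [RCLike.inner_apply, conj_trivial, real_inner_smul_left]
  simp only [real_inner_comm v]

theorem IsWeakGradient.add {u v : L2 A a} {g h : Lp (E N) 2 (gaussMeasure A a)}
    (hu : IsWeakGradient u g) (hv : IsWeakGradient v h) :
    IsWeakGradient (u + v : L2 A a) (g + h : Lp (E N) 2 (gaussMeasure A a)) := by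
  rw [isWeakGradient_iff_inner] at *
  intro φ hφ hc w
  have h1 := hu φ hφ hc w
  have h2 := hv φ hφ hc w
  rw [inner_add_right, inner_add_right]
  linarith

theorem IsWeakGradient.smul (r : ℝ) {u : L2 A a} {g : Lp (E N) 2 (gaussMeasure A a)}
    (hu : IsWeakGradient u g) :
    IsWeakGradient (r • u : L2 A a) (r • g : Lp (E N) 2 (gaussMeasure A a)) := by
  rw [isWeakGradient_iff_inner] at *
  intro φ hφ hc w
  have h1 := hu φ hφ hc w
  rw [real_inner_smul_right, real_inner_smul_right, ← mul_add, h1, mul_zero]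

theorem isWeakGradient_zero :
    IsWeakGradient (0 : L2 A a) (0 : Lp (E N) 2 (gaussMeasure A a)) := by
  rw [isWeakGradient_iff_inner]
  intro φ hφ hc v
  rw [inner_zero_right, inner_zero_right, add_zero]

variable (A a) in
/-- The graph of the distributional gradient. -/
def gradGraph : Submodule ℝ (L2 A a × Lp (E N) 2 (gaussMeasure A a)) where
  carrier := {p | IsWeakGradient p.1 p.2}
  add_mem' := IsWeakGradient.add
  zero_mem' := isWeakGradient_zero
  smul_mem' r _ := IsWeakGradient.smul r

theorem isClosed_gradGraph : IsClosed (gradGraph A a : Set (L2 A a × Lp (E N) 2 (gaussMeasure A a))) := by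
  have : (gradGraph A a : Set (L2 A a × Lp (E N) 2 (gaussMeasure A a))) =
      ⋂ (φ : E N → ℝ) (hφ : ContDiff ℝ ∞ φ) (hc : HasCompactSupport φ) (v : E N),
      {p | inner ℝ ((memLp_inv_density_smul (A := A) (a := a) (continuous_fderiv_apply hφ v)
        (hasCompactSupport_fderiv_apply hc v)).toLp _) p.1 +
      inner ℝ ((memLp_inv_density_smul (A := A) (a := a) (η := fun x => φ x • v)
        (hφ.continuous.smul continuous_const) hc.smul_right).toLp _) p.2 = 0} := by
    ext p
    simp only [Set.mem_iInter]
    exact isWeakGradient_iff_inner p.1 p.2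
  rw [this]
  refine isClosed_iInter fun φ => isClosed_iInter fun hφ => isClosed_iInter fun hc =>
    isClosed_iInter fun v => isClosed_eq (by fun_prop) continuous_const

theorem IsWeakGradient.unique {u : E N → ℝ} {g g' : E N → E N} (hg : LocallyIntegrable g)
    (hg' : LocallyIntegrable g') (h : IsWeakGradient u g) (h' : IsWeakGradient u g') :
    g =ᵐ[volume] g' := by
  refine ae_eq_of_integral_contDiff_smul_eq hg hg' fun φ hφ hc => ?_
  refine ext_inner_right ℝ fun v => ?_
  have h1 := h φ hφ hc v
  have h2 := h' φ hφ hc v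
  rw [h1, neg_inj] at h2
  have i1 := hg.integrable_smul_left_of_hasCompactSupport hφ.continuous hc
  have i2 := hg'.integrable_smul_left_of_hasCompactSupport hφ.continuous hc
  rw [real_inner_comm, ← integral_inner i1, real_inner_comm, ← integral_inner i2]
  simp only [real_inner_smul_right]
  simp only [real_inner_comm _ v]
  exact h2

/-- Uniqueness of weak gradients makes the choice in `weakGrad` harmless. -/
theorem weakGrad_eq {u : L2 A a} {g : Lp (E N) 2 (gaussMeasure A a)} (h : IsWeakGradient u g) :
    weakGrad A a u = g := by
  have hex : ∃ g : Lp (E N) 2 (gaussMeasure A a), IsWeakGradient u g := ⟨g, h⟩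
  rw [weakGrad, dif_pos hex]
  apply Lp.ext
  rw [EventuallyEq, ae_gaussMeasure_iff]
  exact hex.choose_spec.unique (locallyIntegrable_Lp _) (locallyIntegrable_Lp _) h

theorem isWeakGradient_weakGrad {u : L2 A a} (h : u ∈ H1 A a) :
    IsWeakGradient u (weakGrad A a u) := by
  obtain ⟨g, hg⟩ := h
  rwa [weakGrad_eq hg]

theorem add_mem_H1 {u v : L2 A a} (hu : u ∈ H1 A a) (hv : v ∈ H1 A a) : u + v ∈ H1 A a :=
  ⟨_, (isWeakGradient_weakGrad hu).add (isWeakGradient_weakGrad hv)⟩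

theorem weakGrad_add {u v : L2 A a} (hu : u ∈ H1 A a) (hv : v ∈ H1 A a) :
    weakGrad A a (u + v) = weakGrad A a u + weakGrad A a v :=
  weakGrad_eq ((isWeakGradient_weakGrad hu).add (isWeakGradient_weakGrad hv))

theorem smul_mem_H1 (r : ℝ) {u : L2 A a} (hu : u ∈ H1 A a) : r • u ∈ H1 A a :=
  ⟨_, (isWeakGradient_weakGrad hu).smul r⟩

theorem weakGrad_smul (r : ℝ) {u : L2 A a} (hu : u ∈ H1 A a) :
    weakGrad A a (r • u) = r • weakGrad A a u :=
  weakGrad_eq ((isWeakGradient_weakGrad hu).smul r)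

theorem zero_mem_H1 : (0 : L2 A a) ∈ H1 A a := ⟨0, isWeakGradient_zero⟩

theorem IsWeakGradient.sub {u v : L2 A a} {g h : Lp (E N) 2 (gaussMeasure A a)}
    (hu : IsWeakGradient u g) (hv : IsWeakGradient v h) :
    IsWeakGradient (u - v : L2 A a) (g - h : Lp (E N) 2 (gaussMeasure A a)) := by
  have := hu.add (hv.smul (-1))
  rwa [neg_one_smul, neg_one_smul, ← sub_eq_add_neg, ← sub_eq_add_neg] at this

theorem sub_mem_H1 {u v : L2 A a} (hu : u ∈ H1 A a) (hv : v ∈ H1 A a) : u - v ∈ H1 A a :=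
  ⟨_, (isWeakGradient_weakGrad hu).sub (isWeakGradient_weakGrad hv)⟩

theorem weakGrad_sub {u v : L2 A a} (hu : u ∈ H1 A a) (hv : v ∈ H1 A a) :
    weakGrad A a (u - v) = weakGrad A a u - weakGrad A a v :=
  weakGrad_eq ((isWeakGradient_weakGrad hu).sub (isWeakGradient_weakGrad hv))

theorem dirichletForm_val (u v : L2 A a) :
    (dirichletForm A a).val u v = inner ℝ (weakGrad A a u) (weakGrad A a v) :=
  (L2.inner_def _ _).symm

/-! ### Test functions -/

theorem isWeakGradient_gradient {f : E N → ℝ} (hf : ContDiff ℝ 1 f) :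
    IsWeakGradient f (gradient f) := by
  intro φ hφ hc v
  have hf' : Continuous fun x => fderiv ℝ f x v :=
    (hf.continuous_fderiv (by simp)).clm_apply continuous_const
  have e : ∀ x, inner ℝ (gradient f x) v = fderiv ℝ f x v := fun x => by
    rw [gradient, InnerProductSpace.toDual_symm_apply]
  simp only [e]
  rw [integral_mul_fderiv_eq_neg_fderiv_mul_of_integrable]
  · simp only [mul_comm]
  · exact (hf'.mul hφ.continuous).integrable_of_hasCompactSupport hc.mul_left
  · exact (hf.continuous.mul (continuous_fderiv_apply hφ v)).integrable_of_hasCompactSupport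
      (hasCompactSupport_fderiv_apply hc v).mul_left
  · exact (hf.continuous.mul hφ.continuous).integrable_of_hasCompactSupport hc.mul_left
  · exact fun x _ => (hf.differentiable (by simp)).differentiableAt
  · exact fun x _ => (hφ.differentiable (by simp)).differentiableAt

theorem continuous_gradient {f : E N → ℝ} (hf : ContDiff ℝ 1 f) : Continuous (gradient f) :=
  (InnerProductSpace.toDual ℝ (E N)).symm.continuous.comp (hf.continuous_fderiv (by simp))

theorem hasCompactSupport_gradient {f : E N → ℝ} (hc : HasCompactSupport f) :
    HasCompactSupport (gradient f) :=
  (hc.fderiv ℝ).comp_left (g := (InnerProductSpace.toDual ℝ (E N)).symm) (map_zero _)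

theorem memLp_of_compact {F : Type*} [NormedAddCommGroup F] {f : E N → F} (hf : Continuous f)
    (hc : HasCompactSupport f) : MemLp f 2 (gaussMeasure A a) :=
  hf.memLp_of_hasCompactSupport hc

variable (A a) in
/-- A `C¹` function with compact support as an element of `L²_μ`. -/
def testFun (f : E N → ℝ) (hf : ContDiff ℝ 1 f) (hc : HasCompactSupport f) : L2 A a :=
  (memLp_of_compact hf.continuous hc).toLp f

variable (A a) in
/-- The gradient of a `C¹` function with compact support as an element of `L²_μ`. -/
def testGrad (f : E N → ℝ) (hf : ContDiff ℝ 1 f) (hc : HasCompactSupport f) :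
    Lp (E N) 2 (gaussMeasure A a) :=
  (memLp_of_compact (continuous_gradient hf) (hasCompactSupport_gradient hc)).toLp (gradient f)

theorem coeFn_testFun {f : E N → ℝ} (hf : ContDiff ℝ 1 f) (hc : HasCompactSupport f) :
    testFun A a f hf hc =ᵐ[gaussMeasure A a] f := MemLp.coeFn_toLp _

theorem coeFn_testGrad {f : E N → ℝ} (hf : ContDiff ℝ 1 f) (hc : HasCompactSupport f) :
    testGrad A a f hf hc =ᵐ[gaussMeasure A a] gradient f := MemLp.coeFn_toLp _

theorem isWeakGradient_test {f : E N → ℝ} (hf : ContDiff ℝ 1 f) (hc : HasCompactSupport f) :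
    IsWeakGradient (testFun A a f hf hc) (testGrad A a f hf hc) :=
  (isWeakGradient_gradient hf).congr
    (EventuallyEq.symm ((ac_gaussMeasure A a).ae_le (coeFn_testFun hf hc)))
    (EventuallyEq.symm ((ac_gaussMeasure A a).ae_le (coeFn_testGrad hf hc)))

theorem testFun_mem_H1 {f : E N → ℝ} (hf : ContDiff ℝ 1 f) (hc : HasCompactSupport f) :
    testFun A a f hf hc ∈ H1 A a := ⟨_, isWeakGradient_test hf hc⟩

theorem weakGrad_testFun {f : E N → ℝ} (hf : ContDiff ℝ 1 f) (hc : HasCompactSupport f) :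
    weakGrad A a (testFun A a f hf hc) = testGrad A a f hf hc :=
  weakGrad_eq (isWeakGradient_test hf hc)

/-! ### The Ornstein-Uhlenbeck operator on test functions -/

theorem fderiv_mul_apply' {f g : E N → ℝ} {x : E N} (hf : DifferentiableAt ℝ f x)
    (hg : DifferentiableAt ℝ g x) (v : E N) :
    fderiv ℝ (fun y => f y * g y) x v = f x * fderiv ℝ g x v + g x * fderiv ℝ f x v := by
  rw [fderiv_fun_mul hf hg]
  simp

/-- The divergence form `μ Lφ = div (μ ∇φ)`: the drift is minus the logarithmic gradient of the
density. This makes `L` symmetric in `L²_μ`. -/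
theorem ouOp_eq {φ : E N → ℝ} (hφ : ContDiff ℝ ∞ φ) (x : E N) :
    density A a x * ouOp A a φ x = ∑ l, fderiv ℝ (fun y => density A a y *
      fderiv ℝ φ y (EuclideanSpace.basisFun (Fin N) ℝ l)) x
      (EuclideanSpace.basisFun (Fin N) ℝ l) := by
  set e := EuclideanSpace.basisFun (Fin N) ℝ
  have h2 : ∀ l, ContDiff ℝ ∞ fun y => fderiv ℝ φ y (e l) := fun l =>
    (hφ.fderiv_right (m := ∞) (by simp)).clm_apply contDiff_const
  have h1 : ∀ l, fderiv ℝ (fun y => density A a y * fderiv ℝ φ y (e l)) x (e l) =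
      density A a x * iteratedFDeriv ℝ 2 φ x ![e l, e l] -
      density A a x * (fderiv ℝ φ x (e l) * inner ℝ (drift A a x) (e l)) := by
    intro l
    rw [fderiv_mul_apply' (contDiff_density.differentiable (by simp)).differentiableAt
      ((h2 l).differentiable (by simp)).differentiableAt, (hasFDerivAt_density x).fderiv,
      iteratedFDeriv_two_apply]
    have h3 : fderiv ℝ (fun y => fderiv ℝ φ y (e l)) x (e l) =
        fderiv ℝ (fderiv ℝ φ) x (e l) (e l) := by
      rw [fderiv_clm_apply ((hφ.fderiv_right (m := ∞) (by simp)).differentiable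
        (by simp)).differentiableAt (differentiableAt_const _)]
      simp
    rw [h3]
    simp
    ring
  simp only [h1]
  rw [Finset.sum_sub_distrib, ← Finset.mul_sum, ← Finset.mul_sum, ouOp,
    InnerProductSpace.laplacian_eq_iteratedFDeriv_orthonormalBasis φ e, mul_sub]
  congr 2
  have h4 : ∀ l, fderiv ℝ φ x (e l) = inner ℝ (gradient φ x) (e l) := fun l => by
    rw [gradient, InnerProductSpace.toDual_symm_apply]
  simp only [h4]
  rw [← sum_inner]
  have := e.sum_inner_mul_inner (gradient φ x) (drift A a x)
  simp only [real_inner_comm (e _) (drift A a x)] at *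
  rw [this, real_inner_comm]
  rfl

/-- `∫ ⟨∇φ, ∇u⟩ dμ = - ∫ Lφ u dμ` for test functions `φ`. -/
theorem inner_testGrad_weakGrad {φ : E N → ℝ} (hφ : ContDiff ℝ ∞ φ) (hc : HasCompactSupport φ)
    {u : L2 A a} {g : Lp (E N) 2 (gaussMeasure A a)} (hu : IsWeakGradient u g) :
    inner ℝ (testGrad A a φ (hφ.of_le (by simp)) hc) g =
      -∫ x, ouOp A a φ x * u x ∂gaussMeasure A a := by
  set e := EuclideanSpace.basisFun (Fin N) ℝ
  have h2 : ∀ l, ContDiff ℝ ∞ fun y => density A a y * fderiv ℝ φ y (e l) := fun l =>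
    contDiff_density.mul ((hφ.fderiv_right (m := ∞) (by simp)).clm_apply contDiff_const)
  have h3 : ∀ l, HasCompactSupport fun y => density A a y * fderiv ℝ φ y (e l) := fun l =>
    (hasCompactSupport_fderiv_apply hc (e l)).mul_left
  have hlu := locallyIntegrable_Lp u
  have hlg := locallyIntegrable_Lp g
  rw [L2.inner_def, integral_gaussMeasure, integral_gaussMeasure]
  have e1 : ∫ x, density A a x • (ouOp A a φ x * u x) = ∑ l, ∫ x, u x *
      fderiv ℝ (fun y => density A a y * fderiv ℝ φ y (e l)) x (e l) := by
    rw [← integral_finsetSum]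
    · refine integral_congr_ae (Eventually.of_forall fun x => ?_)
      simp only [smul_eq_mul]
      rw [← mul_assoc, ouOp_eq hφ, Finset.sum_mul]
      simp only [mul_comm (u x)]
      rfl
    · intro l _
      have := hlu.integrable_smul_left_of_hasCompactSupport (continuous_fderiv_apply (h2 l) (e l))
        (hasCompactSupport_fderiv_apply (h3 l) (e l))
      simpa [mul_comm] using this
  have e2 : ∫ x, density A a x • inner ℝ (testGrad A a φ (hφ.of_le (by simp)) hc x) (g x) =
      ∑ l, ∫ x, (density A a x * fderiv ℝ φ x (e l)) * inner ℝ (g x) (e l) := by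
    rw [← integral_finsetSum]
    · refine integral_congr_ae ?_
      have := (ac_gaussMeasure A a).ae_le (coeFn_testGrad (A := A) (a := a)
        (hφ.of_le (by simp) : ContDiff ℝ 1 φ) hc)
      filter_upwards [this] with x hx
      rw [hx, smul_eq_mul]
      have h4 : ∀ l, fderiv ℝ φ x (e l) = inner ℝ (gradient φ x) (e l) := fun l => by
        rw [gradient, InnerProductSpace.toDual_symm_apply]
      simp only [h4, mul_assoc]
      rw [← Finset.mul_sum, ← e.sum_inner_mul_inner (gradient φ x) (g x)]
      simp only [real_inner_comm (e _) (g x)]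
    · intro l _
      have := hlg.integrable_smul_left_of_hasCompactSupport (h2 l).continuous (h3 l)
      have := this.inner_const (𝕜 := ℝ) (e l)
      simpa [real_inner_smul_left] using this
  rw [e1, e2, ← Finset.sum_neg_distrib]
  refine Finset.sum_congr rfl fun l _ => ?_
  -- The weak gradient identity is tested with `μ ∂ₗφ`, which is again smooth with compact support.
  rw [hu _ (h2 l) (h3 l) (e l), neg_neg]

end WeakGradient

/-! ### Mollification in L² -/

section Mollification

theorem eLpNorm_two_sq {α F : Type*} [MeasurableSpace α] {ν : Measure α} [NormedAddCommGroup F]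
    (f : α → F) : eLpNorm f 2 ν ^ 2 = ∫⁻ x, ‖f x‖ₑ ^ 2 ∂ν := by
  rw [eLpNorm_eq_lintegral_rpow_enorm_toReal two_ne_zero ENNReal.ofNat_ne_top,
    ← ENNReal.rpow_natCast, ← ENNReal.rpow_mul]
  simp

theorem tendsto_eLpNorm_two_iff {α F ι : Type*} [MeasurableSpace α] {ν : Measure α}
    [NormedAddCommGroup F] {l : Filter ι} {f : ι → α → F} :
    Tendsto (fun k => eLpNorm (f k) 2 ν) l (𝓝 0) ↔
      Tendsto (fun k => ∫⁻ x, ‖f k x‖ₑ ^ 2 ∂ν) l (𝓝 0) := by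
  simp only [← eLpNorm_two_sq]
  constructor
  · intro h
    simpa using ENNReal.Tendsto.pow (n := 2) h
  · intro h
    have := (ENNReal.continuous_rpow_const (y := 1 / 2)).tendsto 0 |>.comp h
    have e : ∀ x : ℝ≥0∞, (x ^ 2) ^ (1 / 2 : ℝ) = x := fun x => by
      rw [← ENNReal.rpow_natCast, ← ENNReal.rpow_mul]
      simp
    rw [ENNReal.zero_rpow_of_pos (by norm_num)] at this
    exact this.congr fun k => e _

/-- Jensen's inequality for a weight of mass at most one: Cauchy-Schwarz applied to `√w` and `√w h`.
-/
theorem sq_lintegral_mul_le {α : Type*} [MeasurableSpace α] {ν : Measure α} {w h : α → ℝ≥0∞}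
    (hw : AEMeasurable w ν) (hh : AEMeasurable h ν) (h1 : ∫⁻ x, w x ∂ν ≤ 1) :
    (∫⁻ x, w x * h x ∂ν) ^ 2 ≤ ∫⁻ x, w x * h x ^ 2 ∂ν := by
  have e : ∀ x : ℝ≥0∞, (x ^ (1 / 2 : ℝ)) ^ 2 = x := fun x => by
    rw [← ENNReal.rpow_natCast, ← ENNReal.rpow_mul]
    simp
  have H := ENNReal.lintegral_mul_le_Lp_mul_Lq ν Real.HolderConjugate.two_two
    (hw.pow_const (1 / 2 : ℝ)) ((hw.pow_const (1 / 2 : ℝ)).mul hh)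
  have e1 : ∀ x, ((fun x => w x ^ (1 / 2 : ℝ)) * ((fun x => w x ^ (1 / 2 : ℝ)) * h)) x =
      w x * h x := fun x => by
    simp only [Pi.mul_apply]
    rw [← mul_assoc, ← sq, e]
  have e2 : ∀ x, (((fun x => w x ^ (1 / 2 : ℝ)) * h) x) ^ (2 : ℝ) = w x * h x ^ 2 := fun x => by
    rw [Pi.mul_apply, ENNReal.rpow_two, mul_pow, e]
  simp only [e1, e2, ENNReal.rpow_two, e] at H
  calc _ ≤ ((∫⁻ x, w x ∂ν) ^ (1 / 2 : ℝ) * (∫⁻ x, w x * h x ^ 2 ∂ν) ^ (1 / 2 : ℝ)) ^ 2 := by gcongr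
    _ = (∫⁻ x, w x ∂ν) * ∫⁻ x, w x * h x ^ 2 ∂ν := by rw [mul_pow, e, e]
    _ ≤ 1 * ∫⁻ x, w x * h x ^ 2 ∂ν := by gcongr
    _ = _ := one_mul _

variable {N : ℕ} {F : Type*} [NormedAddCommGroup F] [NormedSpace ℝ F] [CompleteSpace F]

/-- The convolution `ρ ⋆ f`. -/
def mollify (ρ : E N → ℝ) (f : E N → F) : E N → F :=
  convolution ρ f (ContinuousLinearMap.lsmul ℝ ℝ) volume

theorem mollify_apply (ρ : E N → ℝ) (f : E N → F) (x : E N) :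
    mollify ρ f x = ∫ t, ρ t • f (x - t) := rfl

theorem mollify_apply' (ρ : E N → ℝ) (f : E N → F) (x : E N) :
    mollify ρ f x = ∫ t, ρ (x - t) • f t := convolution_lsmul_swap

/-- `ρ ⋆ f - f` is a `ρ`-average of the differences `f(· - t) - f`; Jensen's inequality and
Tonelli's theorem move the average outside the norm. -/
theorem eLpNorm_mollify_sub_le {ρ : E N → ℝ} (hρ : Continuous ρ) (hc : HasCompactSupport ρ)
    (h0 : ∀ x, 0 ≤ ρ x) (h1 : ∫ x, ρ x = 1) {f : E N → F} (hf : MemLp f 2) {δ : ℝ≥0∞}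
    (hδ : ∀ t, ρ t ≠ 0 → eLpNorm (fun x => f (x - t) - f x) 2 ≤ δ) :
    eLpNorm (mollify ρ f - f) 2 ≤ δ := by
  have hρi : Integrable ρ := hρ.integrable_of_hasCompactSupport hc
  have hρ1 : ∫⁻ t, ‖ρ t‖ₑ = 1 := by
    rw [lintegral_congr fun t => Real.enorm_of_nonneg (h0 t),
      ← ofReal_integral_eq_lintegral_ofReal hρi (Eventually.of_forall h0), h1, ENNReal.ofReal_one]
  have hloc : LocallyIntegrable f := hf.locallyIntegrable one_le_two
  have hfm := hf.1
  have hm : AEStronglyMeasurable (fun p : E N × E N => f (p.1 - p.2) - f p.1) := by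
    refine AEStronglyMeasurable.sub ?_ hfm.comp_fst
    exact hfm.comp_quasiMeasurePreserving (quasiMeasurePreserving_sub_of_right_invariant _ _)
  have hpt : ∀ x, ‖(mollify ρ f - f) x‖ₑ ^ 2 ≤ ∫⁻ t, ‖ρ t‖ₑ * ‖f (x - t) - f x‖ₑ ^ 2 := by
    intro x
    have e1 : (mollify ρ f - f) x = ∫ t, ρ t • (f (x - t) - f x) := by
      have hex : Integrable fun t => ρ t • f (x - t) :=
        hc.convolutionExists_left (ContinuousLinearMap.lsmul ℝ ℝ) hρ hloc x
      simp only [smul_sub]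
      rw [integral_sub hex (hρi.smul_const _), integral_smul_const, h1, one_smul, Pi.sub_apply,
        mollify_apply]
    have hmx : AEStronglyMeasurable fun t => f (x - t) - f x := by
      refine AEStronglyMeasurable.sub ?_ aestronglyMeasurable_const
      exact hfm.comp_quasiMeasurePreserving
        (quasiMeasurePreserving_sub_left_of_right_invariant _ _)
    calc _ ≤ (∫⁻ t, ‖ρ t‖ₑ * ‖f (x - t) - f x‖ₑ) ^ 2 := by
          rw [e1]
          gcongr
          refine (enorm_integral_le_lintegral_enorm _).trans_eq (lintegral_congr fun t => ?_)
          rw [enorm_smul]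
      _ ≤ _ := sq_lintegral_mul_le hρ.measurable.enorm.aemeasurable hmx.enorm hρ1.le
  have h2 : eLpNorm (mollify ρ f - f) 2 ^ 2 ≤ δ ^ 2 := by
    rw [eLpNorm_two_sq]
    calc _ ≤ ∫⁻ x, ∫⁻ t, ‖ρ t‖ₑ * ‖f (x - t) - f x‖ₑ ^ 2 := lintegral_mono hpt
      _ = ∫⁻ t, ∫⁻ x, ‖ρ t‖ₑ * ‖f (x - t) - f x‖ₑ ^ 2 := by
          refine lintegral_lintegral_swap ?_
          exact ((hρ.measurable.comp measurable_snd).enorm.aemeasurable).mul (hm.enorm.pow_const 2)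
      _ = ∫⁻ t, ‖ρ t‖ₑ * eLpNorm (fun x => f (x - t) - f x) 2 ^ 2 := by
          refine lintegral_congr fun t => ?_
          rw [lintegral_const_mul' _ _ enorm_ne_top, eLpNorm_two_sq]
      _ ≤ ∫⁻ t, ‖ρ t‖ₑ * δ ^ 2 := by
          refine lintegral_mono fun t => ?_
          rcases eq_or_ne (ρ t) 0 with h | h
          · simp [h]
          · dsimp only
            gcongr
            exact hδ t h
      _ = δ ^ 2 := by
          rw [lintegral_mul_const _ hρ.measurable.enorm, hρ1, one_mul]
  exact (ENNReal.pow_le_pow_left_iff two_ne_zero).1 h2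

theorem tendsto_eLpNorm_translate_sub {f : E N → F} (hf : MemLp f 2) :
    Tendsto (fun t => eLpNorm (fun x => f (x - t) - f x) 2) (𝓝 0) (𝓝 0) := by
  have : Fact ((2 : ℝ≥0∞) ≠ ⊤) := ⟨by simp⟩
  have hc : Continuous fun t : E N => (DomAddAct.mk (-t) +ᵥ hf.toLp f : Lp F 2 (volume : Measure (E N))) :=
    (DomAddAct.continuous_mk.comp continuous_neg).vadd continuous_const
  have h := (tendsto_iff_edist_tendsto_0.1 (hc.tendsto 0))
  refine h.congr fun t => ?_
  rw [DomAddAct.mk_vadd_toLp, DomAddAct.mk_vadd_toLp, Lp.edist_toLp_toLp]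
  congr 1
  ext x
  simp [sub_eq_neg_add]

variable (N) in
/-- A standard mollifier at scale `1 / (k + 1)`. -/
def mollifier (k : ℕ) : E N → ℝ :=
  ContDiffBump.normed (⟨1 / (2 * ((k : ℝ) + 1)), 1 / ((k : ℝ) + 1), by positivity, by
    gcongr; linarith [show (0 : ℝ) ≤ k from k.cast_nonneg]⟩ : ContDiffBump (0 : E N)) volume

theorem contDiff_mollifier (k : ℕ) : ContDiff ℝ ∞ (mollifier N k) := ContDiffBump.contDiff_normed _

theorem hasCompactSupport_mollifier (k : ℕ) : HasCompactSupport (mollifier N k) :=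
  ContDiffBump.hasCompactSupport_normed _

theorem tendsto_mollify {f : E N → F} (hf : MemLp f 2) :
    Tendsto (fun k => eLpNorm (mollify (mollifier N k) f - f) 2) atTop (𝓝 0) := by
  rw [ENNReal.tendsto_nhds_zero]
  intro δ hδ
  have h := (ENNReal.tendsto_nhds_zero.1 (tendsto_eLpNorm_translate_sub hf)) δ hδ
  obtain ⟨r, hr, h⟩ := Metric.eventually_nhds_iff_ball.1 h
  filter_upwards [(tendsto_one_div_add_atTop_nhds_zero_nat (𝕜 := ℝ)).eventually_lt_const hr]
    with k hk
  refine eLpNorm_mollify_sub_le (contDiff_mollifier k).continuous (hasCompactSupport_mollifier k)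
    (ContDiffBump.nonneg_normed _) (ContDiffBump.integral_normed _) hf fun t ht => h t ?_
  have : t ∈ Function.support (mollifier N k) := ht
  rw [mollifier, ContDiffBump.support_normed_eq] at this
  exact Metric.ball_subset_ball hk.le this

theorem contDiff_mollify {ρ : E N → ℝ} (hρ : ContDiff ℝ ∞ ρ) (hc : HasCompactSupport ρ)
    {f : E N → F} (hf : LocallyIntegrable f) : ContDiff ℝ ∞ (mollify ρ f) :=
  hc.contDiff_convolution_left (n := ⊤) _ hρ hf

theorem hasCompactSupport_mollify {ρ : E N → ℝ} (hc : HasCompactSupport ρ) {f : E N → F}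
    (hf : HasCompactSupport f) : HasCompactSupport (mollify ρ f) :=
  HasCompactSupport.convolution _ hc hf

/-- The derivative falls on the kernel, and `t ↦ ρ (x - t)` is an admissible test function; the
reflection in `t` produces the sign that cancels the one in the weak gradient identity. -/
theorem gradient_mollify {ρ : E N → ℝ} (hρ : ContDiff ℝ ∞ ρ) (hc : HasCompactSupport ρ)
    {u : E N → ℝ} {g : E N → E N} (hu : LocallyIntegrable u) (hg : LocallyIntegrable g)
    (h : IsWeakGradient u g) : gradient (mollify ρ u) = mollify ρ g := by
  ext1 x
  refine ext_inner_right ℝ fun v => ?_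
  have h1 : ContDiff ℝ 1 ρ := hρ.of_le (by simp)
  have hψ : ContDiff ℝ ∞ fun t => ρ (x - t) := hρ.comp (contDiff_const.sub contDiff_id)
  have hψc : HasCompactSupport fun t => ρ (x - t) := hc.comp_homeomorph (Homeomorph.subLeft x)
  have hfd : ∀ t, fderiv ℝ (fun t => ρ (x - t)) t v = -fderiv ℝ ρ (x - t) v := fun t => by
    have : HasFDerivAt (fun t => ρ (x - t)) _ t := ((h1.differentiable (by simp)).differentiableAt (x := x - t)).hasFDerivAt.comp t
      ((hasFDerivAt_id t).const_sub x)
    rw [this.fderiv]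
    simp
  have hi : Integrable fun t => ρ (x - t) • g t :=
    hg.integrable_smul_left_of_hasCompactSupport hψ.continuous hψc
  have hL : inner ℝ (mollify ρ g x) v = ∫ t, ρ (x - t) * inner ℝ (g t) v := by
    rw [mollify_apply', real_inner_comm, ← integral_inner hi]
    simp only [real_inner_smul_right, real_inner_comm]
  rw [hL, gradient, InnerProductSpace.toDual_symm_apply]
  have hD := (hc.hasFDerivAt_convolution_left (ContinuousLinearMap.lsmul ℝ ℝ) h1 hu x).fderiv
  have hex := (hc.fderiv ℝ).convolutionExists_left
    ((ContinuousLinearMap.lsmul ℝ ℝ : ℝ →L[ℝ] ℝ →L[ℝ] ℝ).precompL (E N))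
    (h1.continuous_fderiv (by simp)) hu x
  rw [show fderiv ℝ (mollify ρ u) x = _ from hD, convolution_eq_swap,
    ContinuousLinearMap.integral_apply hex.integrable_swap]
  have h2 := h _ hψ hψc v
  rw [eq_neg_iff_add_eq_zero, add_comm, ← eq_neg_iff_add_eq_zero] at h2
  rw [h2, ← integral_neg]
  refine integral_congr_ae (Eventually.of_forall fun t => ?_)
  simp only [hfd, mul_neg, neg_neg]
  simp [ContinuousLinearMap.precompL_apply, mul_comm]

end Mollification

/-! ### Smooth cutoffs -/

section Cutoff

variable {N : ℕ}

/-- A smooth function equal to `1` for `r ‖x - p‖ ≤ 1` and to `0` for `2 ≤ r ‖x - p‖`. -/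
def cutoff (r : ℝ) (p x : E N) : ℝ :=
  (⟨1, 2, one_pos, one_lt_two⟩ : ContDiffBump (0 : E N)) (r • (x - p))

theorem contDiff_cutoff (r : ℝ) (p : E N) : ContDiff ℝ ∞ (cutoff r p) :=
  (ContDiffBump.contDiff _).comp ((contDiff_id.sub contDiff_const).const_smul r)

theorem cutoff_nonneg (r : ℝ) (p x : E N) : 0 ≤ cutoff r p x := ContDiffBump.nonneg _

theorem cutoff_le_one (r : ℝ) (p x : E N) : cutoff r p x ≤ 1 := ContDiffBump.le_one _

theorem cutoff_eq_one {r : ℝ} (hr : 0 < r) {p x : E N} (h : r * ‖x - p‖ ≤ 1) :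
    cutoff r p x = 1 := by
  refine ContDiffBump.one_of_mem_closedBall _ ?_
  rwa [mem_closedBall_zero_iff, norm_smul, Real.norm_of_nonneg hr.le]

theorem cutoff_eq_zero {r : ℝ} (hr : 0 < r) {p x : E N} (h : 2 ≤ r * ‖x - p‖) :
    cutoff r p x = 0 := by
  refine ContDiffBump.zero_of_le_dist _ ?_
  rwa [dist_zero_right, norm_smul, Real.norm_of_nonneg hr.le]

theorem tsupport_cutoff_subset {r : ℝ} (hr : 0 < r) (p : E N) :
    tsupport (cutoff r p) ⊆ Metric.closedBall p (2 / r) := by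
  refine closure_minimal (fun x hx => ?_) Metric.isClosed_closedBall
  rw [Metric.mem_closedBall, dist_eq_norm, le_div_iff₀' hr]
  by_contra! h
  exact hx (cutoff_eq_zero hr h.le)

theorem hasCompactSupport_cutoff {r : ℝ} (hr : 0 < r) (p : E N) : HasCompactSupport (cutoff r p) :=
  (isCompact_closedBall p (2 / r)).of_isClosed_subset (isClosed_tsupport _)
    (tsupport_cutoff_subset hr p)

theorem norm_gradient (f : E N → ℝ) (x : E N) : ‖gradient f x‖ = ‖fderiv ℝ f x‖ := by
  rw [gradient, LinearIsometryEquiv.norm_map]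

variable (N) in
theorem exists_norm_gradient_cutoff_le :
    ∃ C : ℝ, 0 ≤ C ∧ ∀ (r : ℝ) (p x : E N), 0 < r → ‖gradient (cutoff r p) x‖ ≤ C * r := by
  set β : ContDiffBump (0 : E N) := ⟨1, 2, one_pos, one_lt_two⟩
  have hβ : ContDiff ℝ 1 β := β.contDiff
  obtain ⟨C, hC⟩ := (β.hasCompactSupport.fderiv ℝ).exists_bound_of_continuous
    (hβ.continuous_fderiv (by simp))
  refine ⟨C, (norm_nonneg _).trans (hC 0), fun r p x hr => ?_⟩
  have h : HasFDerivAt (cutoff r p) _ x :=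
    ((hβ.differentiable (by simp)).differentiableAt (x := r • (x - p))).hasFDerivAt.comp x
      (((hasFDerivAt_id x).sub_const p).const_smul r)
  rw [norm_gradient, h.fderiv]
  refine (ContinuousLinearMap.opNorm_comp_le _ _).trans ?_
  have h2 : ‖r • ContinuousLinearMap.id ℝ (E N)‖ ≤ r := by
    rw [norm_smul, Real.norm_of_nonneg hr.le]
    exact mul_le_of_le_one_right hr.le ContinuousLinearMap.norm_id_le
  exact mul_le_mul (hC _) h2 (norm_nonneg _) ((norm_nonneg _).trans (hC 0))

theorem gradient_mul {f g : E N → ℝ} {x : E N} (hf : DifferentiableAt ℝ f x)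
    (hg : DifferentiableAt ℝ g x) :
    gradient (fun y => f y * g y) x = f x • gradient g x + g x • gradient f x := by
  simp only [gradient, fderiv_fun_mul hf hg, map_add, map_smulₛₗ, conj_trivial]

theorem tendsto_eLpNorm_of_dominated {α F F' : Type*} [MeasurableSpace α] {ν : Measure α}
    [NormedAddCommGroup F] [NormedAddCommGroup F'] {h : ℕ → α → F} {f : α → F'}
    (hm : ∀ k, AEStronglyMeasurable (h k) ν) (hf : MemLp f 2 ν) (hle : ∀ k x, ‖h k x‖ ≤ ‖f x‖)
    (hlim : ∀ᵐ x ∂ν, Tendsto (fun k => h k x) atTop (𝓝 0)) :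
    Tendsto (fun k => eLpNorm (h k) 2 ν) atTop (𝓝 0) := by
  rw [tendsto_eLpNorm_two_iff]
  have := tendsto_lintegral_of_dominated_convergence' (μ := ν) (F := fun k x => ‖h k x‖ₑ ^ 2)
    (f := fun _ => 0) (fun x => ‖f x‖ₑ ^ 2) (fun k => (hm k).enorm.pow_const 2)
    (fun k => Eventually.of_forall fun x => by
      dsimp only
      gcongr 1
      exact enorm_le_iff_norm_le.2 (hle k x)) ?_ ?_
  · simpa using this
  · rw [← eLpNorm_two_sq]
    exact ENNReal.pow_ne_top hf.2.ne
  · filter_upwards [hlim] with x hx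
    simpa using ENNReal.Tendsto.pow (n := 2) hx.enorm

end Cutoff

/-! ### Density of test functions -/

section Density

variable {N n : ℕ} {A : Matrix (Fin N) (Fin N) ℝ} {a : Fin n → E N} [hA : Fact A.PosDef] [NeZero n]
variable {F : Type*} [NormedAddCommGroup F] [NormedSpace ℝ F]

variable (A a) in
theorem exists_gaussMeasure_le : ∃ C : ℝ≥0∞, C ≠ ⊤ ∧ gaussMeasure A a ≤ C • volume := by
  refine ⟨ENNReal.ofReal (∫ x, gaussExp A a x)⁻¹, ENNReal.ofReal_ne_top, ?_⟩
  rw [← withDensity_const]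
  exact withDensity_mono (Eventually.of_forall fun x => ENNReal.ofReal_le_ofReal (density_le x))

theorem memLp_gaussMeasure {f : E N → F} (hf : MemLp f 2) : MemLp f 2 (gaussMeasure A a) := by
  obtain ⟨C, hC, h⟩ := exists_gaussMeasure_le A a
  exact hf.of_measure_le_smul hC h

variable (A a) in
theorem tendsto_eLpNorm_gaussMeasure {f : ℕ → E N → F}
    (hf : Tendsto (fun k => eLpNorm (f k) 2) atTop (𝓝 0)) :
    Tendsto (fun k => eLpNorm (f k) 2 (gaussMeasure A a)) atTop (𝓝 0) := by
  obtain ⟨C, hC, h⟩ := exists_gaussMeasure_le A a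
  rw [tendsto_eLpNorm_two_iff] at hf ⊢
  have h1 := ENNReal.Tendsto.const_mul hf (Or.inr hC)
  rw [mul_zero] at h1
  refine tendsto_of_tendsto_of_tendsto_of_le_of_le tendsto_const_nhds h1 (fun _ => zero_le)
    fun k => ?_
  calc _ ≤ ∫⁻ x, ‖f k x‖ₑ ^ 2 ∂(C • volume) := lintegral_mono' h le_rfl
    _ = _ := by rw [lintegral_smul_measure, smul_eq_mul]

/-- On compact sets `L²_μ` is contained in the `L²` space of Lebesgue measure. -/
theorem memLp_of_norm_eq_mul {F' : Type*} [NormedAddCommGroup F'] [NormedSpace ℝ F']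
    (f : Lp F 2 (gaussMeasure A a)) {h : E N → ℝ}
    (hh : Continuous h) (hc : HasCompactSupport h) {w : E N → F'} (hw : AEStronglyMeasurable w)
    (hn : ∀ x, ‖w x‖ = |h x| * ‖f x‖) : MemLp w 2 := by
  rw [memLp_two_iff_integrable_sq_norm hw]
  have h1 : LocallyIntegrable (fun x => ‖f x‖ ^ 2) volume :=
    locallyIntegrable_of_integrable ((memLp_two_iff_integrable_sq_norm (Lp.memLp f).1).1 (Lp.memLp f))
  have hc2 : HasCompactSupport fun x => h x ^ 2 := hc.comp_left (g := fun t : ℝ => t ^ 2) (by simp)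
  have hh2 : Continuous fun x => h x ^ 2 := hh.pow 2
  have := h1.integrable_smul_left_of_hasCompactSupport hh2 hc2
  refine this.congr (Eventually.of_forall fun x => ?_)
  simp only [hn, mul_pow, sq_abs, smul_eq_mul]

theorem aestronglyMeasurable_volume (f : Lp F 2 (gaussMeasure A a)) :
    AEStronglyMeasurable f volume := (Lp.memLp f).1.mono_ac (ac_gaussMeasure A a)

theorem IsWeakGradient.mul {u : E N → ℝ} {g : E N → E N} (hu : LocallyIntegrable u)
    (hg : LocallyIntegrable g) (h : IsWeakGradient u g) {χ : E N → ℝ} (hχ : ContDiff ℝ ∞ χ) :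
    IsWeakGradient (fun x => χ x * u x) (fun x => χ x • g x + u x • gradient χ x) := by
  intro φ hφ hc v
  have h1 := h _ (hχ.mul hφ) hc.mul_left v
  have hd : ∀ x, fderiv ℝ (fun y => χ y * φ y) x v = χ x * fderiv ℝ φ x v + φ x * fderiv ℝ χ x v :=
    fun x => fderiv_mul_apply' (hχ.differentiable (by simp)).differentiableAt
      (hφ.differentiable (by simp)).differentiableAt v
  have e : ∀ x, inner ℝ (gradient χ x) v = fderiv ℝ χ x v := fun x => by
    rw [gradient, InnerProductSpace.toDual_symm_apply]
  have i1 : Integrable fun x => (χ x * fderiv ℝ φ x v) • u x :=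
    hu.integrable_smul_left_of_hasCompactSupport (hχ.continuous.mul (continuous_fderiv_apply hφ v))
      (hasCompactSupport_fderiv_apply hc v).mul_left
  have i2 : Integrable fun x => (φ x * fderiv ℝ χ x v) • u x :=
    hu.integrable_smul_left_of_hasCompactSupport (hφ.continuous.mul (continuous_fderiv_apply hχ v))
      hc.mul_right
  have i3 : Integrable fun x => (χ x * φ x) * inner ℝ (g x) v := by
    have := (hg.integrable_smul_left_of_hasCompactSupport (hχ.continuous.mul hφ.continuous)
      hc.mul_left).inner_const (𝕜 := ℝ) v
    simpa [real_inner_smul_left] using this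
  simp only [hd, mul_add] at h1
  rw [integral_add] at h1
  rotate_left
  · exact i1.congr (Eventually.of_forall fun x => by simp only [smul_eq_mul]; ring)
  · exact i2.congr (Eventually.of_forall fun x => by simp only [smul_eq_mul]; ring)
  have h2 : ∫ x, φ x * inner ℝ (χ x • g x + u x • gradient χ x) v =
      (∫ x, (χ x * φ x) * inner ℝ (g x) v) + ∫ x, u x * (φ x * fderiv ℝ χ x v) := by
    rw [← integral_add i3]
    · refine integral_congr_ae (Eventually.of_forall fun x => ?_)
      simp only [inner_add_left, real_inner_smul_left, e]
      ring
    · exact i2.congr (Eventually.of_forall fun x => by simp only [smul_eq_mul]; ring)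
  have h3 : ∫ x, χ x * u x * fderiv ℝ φ x v = ∫ x, u x * (χ x * fderiv ℝ φ x v) :=
    integral_congr_ae (Eventually.of_forall fun x => by dsimp only; ring)
  rw [h2, h3]
  linarith

variable (A a) in
/-- The test functions whose support avoids `s`, with their gradients. -/
def testGraph (s : Set (E N)) : Set (L2 A a × Lp (E N) 2 (gaussMeasure A a)) :=
  {p | ∃ (φ : E N → ℝ) (hφ : ContDiff ℝ ∞ φ) (hc : HasCompactSupport φ),
    (∀ x ∈ s, x ∉ tsupport φ) ∧
    p = (testFun A a φ (hφ.of_le (by simp)) hc, testGrad A a φ (hφ.of_le (by simp)) hc)}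

/-- Functions with compact support are approximated by mollification. -/
theorem mem_closure_testGraph_of_compact {u : E N → ℝ} {g : E N → E N} (hu : MemLp u 2)
    (hg : MemLp g 2) (huc : HasCompactSupport u) (h : IsWeakGradient u g) :
    ((memLp_gaussMeasure (A := A) (a := a) hu).toLp u,
      (memLp_gaussMeasure (A := A) (a := a) hg).toLp g) ∈ closure (testGraph A a ∅) := by
  have hul := hu.locallyIntegrable one_le_two
  have hgl := hg.locallyIntegrable one_le_two
  have hs := fun k => contDiff_mollify (contDiff_mollifier (N := N) k) (hasCompactSupport_mollifier k) hul
  have hc := fun k => hasCompactSupport_mollify (hasCompactSupport_mollifier (N := N) k) huc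
  refine mem_closure_of_tendsto (b := atTop) (f := fun k : ℕ =>
    (testFun A a (mollify (mollifier N k) u) ((hs k).of_le (by simp)) (hc k),
      testGrad A a (mollify (mollifier N k) u) ((hs k).of_le (by simp)) (hc k))) ?_
    (Eventually.of_forall fun k => ⟨_, hs k, hc k, by simp, rfl⟩)
  refine Tendsto.prodMk_nhds ?_ ?_
  · exact (Lp.tendsto_Lp_iff_tendsto_eLpNorm'' _ _ _ _).2
      (tendsto_eLpNorm_gaussMeasure A a (tendsto_mollify hu))
  · refine (Lp.tendsto_Lp_iff_tendsto_eLpNorm'' _ _ _ _).2 ?_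
    refine tendsto_eLpNorm_gaussMeasure A a ((tendsto_mollify hg).congr fun k => ?_)
    rw [gradient_mollify (contDiff_mollifier k) (hasCompactSupport_mollifier k) hul hgl h]

/-- Cutoffs at radius of order `k + 1` reduce to compact support, where mollification applies. The
extra term `u ∇χₖ` is at most `C |u| / (k + 1)` and disappears in the limit. -/
theorem gradGraph_subset_closure :
    (gradGraph A a : Set (L2 A a × Lp (E N) 2 (gaussMeasure A a))) ⊆ closure (testGraph A a ∅) := by
  rintro ⟨u, g⟩ (h : IsWeakGradient u g)
  obtain ⟨C, hC0, hC⟩ := exists_norm_gradient_cutoff_le N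
  have hr : ∀ k : ℕ, 0 < 1 / ((k : ℝ) + 1) := fun k => by positivity
  set χ : ℕ → E N → ℝ := fun k => cutoff (1 / ((k : ℝ) + 1)) 0 with hχ
  have hχs : ∀ k, ContDiff ℝ ∞ (χ k) := fun k => contDiff_cutoff _ _
  have hχ1 : ∀ k, ContDiff ℝ 1 (χ k) := fun k => contDiff_cutoff _ _ |>.of_le (by simp)
  have hχc : ∀ k, HasCompactSupport (χ k) := fun k => hasCompactSupport_cutoff (hr k) _
  have hum := aestronglyMeasurable_volume u
  have hgm := aestronglyMeasurable_volume g
  have m1 : ∀ k, MemLp (fun x => χ k x * u x) 2 := fun k =>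
    memLp_of_norm_eq_mul u (hχs k).continuous (hχc k)
      ((hχs k).continuous.aestronglyMeasurable.mul hum) fun x => by
        rw [norm_mul, Real.norm_eq_abs]
  have m2 : ∀ k, MemLp (fun x => χ k x • g x) 2 := fun k =>
    memLp_of_norm_eq_mul g (hχs k).continuous (hχc k)
      ((hχs k).continuous.aestronglyMeasurable.smul hgm) fun x => by
        rw [norm_smul, Real.norm_eq_abs]
  have m3 : ∀ k, MemLp (fun x => u x • gradient (χ k) x) 2 := fun k =>
    memLp_of_norm_eq_mul u (h := fun x => ‖gradient (χ k) x‖) (continuous_gradient (hχ1 k)).norm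
      (hasCompactSupport_gradient (hχc k)).norm
      (hum.smul (continuous_gradient (hχ1 k)).aestronglyMeasurable) fun x => by
        rw [norm_smul, abs_norm, mul_comm]
  have hlim : ∀ x : E N, ∀ᶠ k in atTop, χ k x = 1 := by
    intro x
    filter_upwards [eventually_ge_atTop ⌈‖x‖⌉₊] with k hk
    refine cutoff_eq_one (hr k) ?_
    rw [sub_zero, one_div, inv_mul_le_iff₀ (by positivity), mul_one]
    have := (Nat.le_ceil ‖x‖).trans (Nat.cast_le.2 hk)
    linarith
  have d1 : ∀ {F : Type} [NormedAddCommGroup F] [NormedSpace ℝ F] (f : Lp F 2 (gaussMeasure A a)),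
      Tendsto (fun k => eLpNorm (fun x => χ k x • f x - f x) 2 (gaussMeasure A a)) atTop (𝓝 0) := by
    intro F _ _ f
    refine tendsto_eLpNorm_of_dominated (f := f) (fun k => ?_) (Lp.memLp f) (fun k x => ?_) ?_
    · exact ((hχs k).continuous.aestronglyMeasurable.smul (Lp.memLp f).1).sub (Lp.memLp f).1
    · rw [show χ k x • f x - f x = (χ k x - 1) • f x by rw [sub_smul, one_smul], norm_smul]
      refine mul_le_of_le_one_left (norm_nonneg _) ?_
      rw [Real.norm_eq_abs, abs_le]
      constructor <;> linarith [cutoff_nonneg (1 / ((k : ℝ) + 1)) 0 x,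
        cutoff_le_one (1 / ((k : ℝ) + 1)) 0 x]
    · refine Eventually.of_forall fun x => tendsto_const_nhds.congr' ?_
      filter_upwards [hlim x] with k hk
      rw [hk, one_smul, sub_self]
  have d2 : Tendsto (fun k => eLpNorm (fun x => u x • gradient (χ k) x) 2 (gaussMeasure A a))
      atTop (𝓝 0) := by
    have hb : ∀ k x, ‖u x • gradient (χ k) x‖ ≤ (1 / ((k : ℝ) + 1)) * ‖C * u x‖ := fun k x => by
      rw [norm_smul, norm_mul, Real.norm_of_nonneg hC0]
      have := mul_le_mul_of_nonneg_left (hC _ 0 x (hr k)) (norm_nonneg (u x))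
      linarith
    refine tendsto_eLpNorm_of_dominated (f := fun x => C * u x) (fun k => ?_)
      ((Lp.memLp u).const_mul C) (fun k x => (hb k x).trans ?_) (Eventually.of_forall fun x => ?_)
    · exact (Lp.memLp u).1.smul (continuous_gradient (hχ1 k)).aestronglyMeasurable
    · refine mul_le_of_le_one_left (norm_nonneg _) ?_
      rw [div_le_one (by positivity)]
      linarith [show (0 : ℝ) ≤ k from k.cast_nonneg]
    · refine squeeze_zero_norm (hb · x) ?_
      have := (tendsto_one_div_add_atTop_nhds_zero_nat (𝕜 := ℝ)).mul_const ‖C * u x‖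
      rwa [zero_mul] at this
  have key : ∀ k, ((memLp_gaussMeasure (A := A) (a := a) (m1 k)).toLp _,
      (memLp_gaussMeasure (A := A) (a := a) ((m2 k).add (m3 k))).toLp _) ∈
      closure (testGraph A a ∅) := fun k =>
    mem_closure_testGraph_of_compact (m1 k) ((m2 k).add (m3 k)) (hχc k).mul_right
      (h.mul (locallyIntegrable_Lp u) (locallyIntegrable_Lp g) (hχs k))
  refine isClosed_closure.mem_of_tendsto (b := atTop) ?_ (Eventually.of_forall key)
  refine Tendsto.prodMk_nhds ?_ ?_
  · refine (Eq.subst (motive := fun v => Tendsto _ _ (𝓝 v)) (Lp.toLp_coeFn u (Lp.memLp u)) ?_)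
    exact (Lp.tendsto_Lp_iff_tendsto_eLpNorm'' _ _ _ _).2 (d1 u)
  · refine (Eq.subst (motive := fun v => Tendsto _ _ (𝓝 v)) (Lp.toLp_coeFn g (Lp.memLp g)) ?_)
    refine (Lp.tendsto_Lp_iff_tendsto_eLpNorm'' _ _ _ _).2 ?_
    have h3 := (d1 g).add d2
    rw [add_zero] at h3
    refine tendsto_of_tendsto_of_tendsto_of_le_of_le tendsto_const_nhds h3 (fun _ => zero_le)
      fun k => ?_
    refine le_trans (le_of_eq ?_) (eLpNorm_add_le (μ := gaussMeasure A a) (p := 2)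
      (f := fun x => χ k x • g x - g x) (g := fun x => u x • gradient (χ k) x) ?_ ?_ one_le_two)
    · congr 1
      ext1 x
      simp only [Pi.sub_apply, Pi.add_apply]
      abel
    · exact ((hχs k).continuous.aestronglyMeasurable.smul (Lp.memLp g).1).sub (Lp.memLp g).1
    · exact (Lp.memLp u).1.smul (continuous_gradient (hχ1 k)).aestronglyMeasurable

end Density

/-! ### Removing neighbourhoods of the poles -/

section PoleRemoval

variable {N n : ℕ} {A : Matrix (Fin N) (Fin N) ℝ} {a : Fin n → E N} [hA : Fact A.PosDef] [NeZero n]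

theorem gradient_of_notMem_tsupport {f : E N → ℝ} {x : E N} (h : x ∉ tsupport f) :
    gradient f x = 0 := by
  rw [gradient, fderiv_of_notMem_tsupport ℝ h, map_zero]

/-- The squared norm is at most of order `(k + 1)²` times the volume `(k + 1)^{-N}` of the ball, and
`N ≥ 3` makes the product tend to zero. -/
theorem tendsto_eLpNorm_of_concentrating {F : Type*} [NormedAddCommGroup F] (hN : 3 ≤ N) {C : ℝ}
    (hC : 0 ≤ C) {p : E N} {h : ℕ → E N → F} (hb : ∀ k x, ‖h k x‖ ≤ C * ((k : ℝ) + 1))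
    (h0 : ∀ (k : ℕ) x, x ∉ Metric.closedBall p (2 / ((k : ℝ) + 1)) → h k x = 0) :
    Tendsto (fun k => eLpNorm (h k) 2) atTop (𝓝 0) := by
  rw [tendsto_eLpNorm_two_iff]
  set vb := volume (Metric.ball (0 : E N) 1)
  have hvb : vb ≠ ⊤ := measure_ball_lt_top.ne
  have hle : ∀ k : ℕ, ∫⁻ x, ‖h k x‖ₑ ^ 2 ≤
      ENNReal.ofReal (C ^ 2 * 2 ^ N * (1 / ((k : ℝ) + 1))) * vb := by
    intro k
    have hk : (0 : ℝ) < (k : ℝ) + 1 := by positivity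
    calc ∫⁻ x, ‖h k x‖ₑ ^ 2 ≤ ∫⁻ x, (Metric.closedBall p (2 / ((k : ℝ) + 1))).indicator
          (fun _ => ENNReal.ofReal ((C * ((k : ℝ) + 1)) ^ 2)) x := by
          refine lintegral_mono fun x => ?_
          by_cases hx : x ∈ Metric.closedBall p (2 / ((k : ℝ) + 1))
          · rw [Set.indicator_of_mem hx, ENNReal.ofReal_pow (by positivity)]
            dsimp only
            gcongr
            rw [← ofReal_norm]
            exact ENNReal.ofReal_le_ofReal (hb k x)
          · simp [h0 k x hx]
      _ = ENNReal.ofReal ((C * ((k : ℝ) + 1)) ^ 2 * (2 / ((k : ℝ) + 1)) ^ N) * vb := by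
          rw [lintegral_indicator_const measurableSet_closedBall,
            Measure.addHaar_closedBall _ _ (by positivity), finrank_euclideanSpace_fin, ← mul_assoc,
            ← ENNReal.ofReal_mul (by positivity)]
      _ ≤ _ := by
          refine mul_le_mul_left (ENNReal.ofReal_le_ofReal ?_) _
          obtain ⟨m, rfl⟩ : ∃ m, N = m + 3 := ⟨N - 3, by omega⟩
          have h1 : (1 / ((k : ℝ) + 1)) ^ m ≤ 1 := by
            refine pow_le_one₀ (by positivity) ?_
            rw [div_le_one hk]
            linarith [show (0 : ℝ) ≤ k from k.cast_nonneg]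
          calc (C * ((k : ℝ) + 1)) ^ 2 * (2 / ((k : ℝ) + 1)) ^ (m + 3)
              = C ^ 2 * 2 ^ (m + 3) * (1 / ((k : ℝ) + 1)) * (1 / ((k : ℝ) + 1)) ^ m := by
                rw [div_pow, div_pow, pow_add]
                field_simp
                ring
            _ ≤ _ := mul_le_of_le_one_right (by positivity) h1
  have hlim : Tendsto (fun k : ℕ => ENNReal.ofReal (C ^ 2 * 2 ^ N * (1 / ((k : ℝ) + 1))) * vb)
      atTop (𝓝 0) := by
    have h1 := (tendsto_one_div_add_atTop_nhds_zero_nat (𝕜 := ℝ)).const_mul (C ^ 2 * 2 ^ N)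
    have h2 := ENNReal.Tendsto.mul_const (ENNReal.tendsto_ofReal h1) (Or.inr hvb)
    simpa using h2
  exact tendsto_of_tendsto_of_tendsto_of_le_of_le tendsto_const_nhds hlim (fun _ => zero_le) hle

/-- A point has zero capacity in dimension at least three: multiplying by `1 - β k`, with `β k` a
bump of radius of order `1 / (k + 1)` at `p`, changes function and gradient only by concentrating
terms. -/
theorem testGraph_subset_closure_insert (hN : 3 ≤ N) (s : Set (E N)) (p : E N) :
    testGraph A a s ⊆ closure (testGraph A a (insert p s)) := by
  rintro _ ⟨φ, hφ, hc, hs, rfl⟩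
  obtain ⟨C, hC0, hC⟩ := exists_norm_gradient_cutoff_le N
  have hr : ∀ k : ℕ, 0 < (k : ℝ) + 1 := fun k => by positivity
  have hr1 : ∀ k : ℕ, 1 ≤ (k : ℝ) + 1 := fun k => by
    linarith [show (0 : ℝ) ≤ k from k.cast_nonneg]
  set β : ℕ → E N → ℝ := fun k => cutoff ((k : ℝ) + 1) p with hβ
  have hβs : ∀ k, ContDiff ℝ ∞ (β k) := fun k => contDiff_cutoff _ _
  have hφ1 : ContDiff ℝ 1 φ := hφ.of_le (by simp)
  have hβd : ∀ k, Differentiable ℝ (β k) := fun k => (hβs k).differentiable (by simp)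
  have hφd : Differentiable ℝ φ := hφ.differentiable (by simp)
  set φk : ℕ → E N → ℝ := fun k x => φ x * (1 - β k x) with hφk
  have hks : ∀ k, ContDiff ℝ ∞ (φk k) := fun k => hφ.mul (contDiff_const.sub (hβs k))
  have hkc : ∀ k, HasCompactSupport (φk k) := fun k => hc.mul_right
  have hgrad : ∀ k x, gradient (φk k) x - gradient φ x =
      -(φ x • gradient (β k) x + β k x • gradient φ x) := fun k x => by
    have e : gradient (fun y => 1 - β k y) x = -gradient (β k) x := by
      simp only [gradient, fderiv_const_sub, map_neg]
    rw [hφk, gradient_mul hφd.differentiableAt ((hβd k).differentiableAt.const_sub 1), e]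
    module
  obtain ⟨M₁, hM₁⟩ := hc.exists_bound_of_continuous hφ.continuous
  obtain ⟨M₂, hM₂⟩ := (hasCompactSupport_gradient hc).exists_bound_of_continuous
    (continuous_gradient hφ1)
  have hM₁0 : 0 ≤ M₁ := (norm_nonneg _).trans (hM₁ 0)
  have hM₂0 : 0 ≤ M₂ := (norm_nonneg _).trans (hM₂ 0)
  have hβn : ∀ k x, ‖β k x‖ ≤ 1 := fun k x => by
    rw [Real.norm_of_nonneg (cutoff_nonneg _ _ _)]
    exact cutoff_le_one _ _ _
  have hoff : ∀ (k : ℕ) x, x ∉ Metric.closedBall p (2 / ((k : ℝ) + 1)) → x ∉ tsupport (β k) :=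
    fun k x hx hx' => hx (tsupport_cutoff_subset (hr k) p hx')
  refine mem_closure_of_tendsto (b := atTop) (f := fun k : ℕ =>
    (testFun A a (φk k) ((hks k).of_le (by simp)) (hkc k),
      testGrad A a (φk k) ((hks k).of_le (by simp)) (hkc k))) ?_
    (Eventually.of_forall fun k => ⟨_, hks k, hkc k, ?_, rfl⟩)
  · refine Tendsto.prodMk_nhds ?_ ?_
    · refine (Lp.tendsto_Lp_iff_tendsto_eLpNorm'' _ _ _ _).2 (tendsto_eLpNorm_gaussMeasure A a
        (tendsto_eLpNorm_of_concentrating hN hM₁0 (p := p) (fun k x => ?_) fun k x hx => ?_))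
      · rw [Pi.sub_apply, show φk k x - φ x = -(φ x * β k x) by simp only [hφk]; ring, norm_neg,
          norm_mul]
        calc ‖φ x‖ * ‖β k x‖ ≤ M₁ * 1 := by gcongr; exacts [hM₁ x, hβn k x]
          _ ≤ _ := by gcongr; exact hr1 k
      · have : β k x = 0 := image_eq_zero_of_notMem_tsupport (hoff k x hx)
        simp [hφk, this]
    · refine (Lp.tendsto_Lp_iff_tendsto_eLpNorm'' _ _ _ _).2 (tendsto_eLpNorm_gaussMeasure A a
        (tendsto_eLpNorm_of_concentrating hN (C := M₁ * C + M₂) (by positivity) (p := p)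
          (fun k x => ?_) fun k x hx => ?_))
      · rw [Pi.sub_apply, hgrad, norm_neg]
        refine (norm_add_le _ _).trans ?_
        rw [norm_smul, norm_smul, add_mul, mul_assoc]
        refine add_le_add ?_ ?_
        · exact mul_le_mul (hM₁ x) (hC _ _ _ (hr k)) (norm_nonneg _) hM₁0
        · calc ‖β k x‖ * ‖gradient φ x‖ ≤ 1 * M₂ := by gcongr; exacts [hβn k x, hM₂ x]
            _ ≤ _ := by rw [one_mul]; exact le_mul_of_one_le_right hM₂0 (hr1 k)
      · rw [Pi.sub_apply, hgrad, gradient_of_notMem_tsupport (hoff k x hx),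
          image_eq_zero_of_notMem_tsupport (hoff k x hx)]
        simp
  · rintro x (rfl | hx)
    · rw [notMem_tsupport_iff_eventuallyEq]
      filter_upwards [Metric.closedBall_mem_nhds x (ε := 1 / ((k : ℝ) + 1)) (by positivity)]
        with y hy
      rw [Metric.mem_closedBall, dist_eq_norm, le_div_iff₀' (hr k)] at hy
      simp [hφk, hβ, cutoff_eq_one (hr k) hy]
    · exact fun hx' => hs x hx (closure_mono (fun y hy => left_ne_zero_of_mul hy) hx')

variable (A a) in
/-- Test functions vanishing near the poles are dense in `H¹_μ`. -/
theorem gradGraph_subset_closure_poles (hN : 3 ≤ N) :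
    (gradGraph A a : Set (L2 A a × Lp (E N) 2 (gaussMeasure A a))) ⊆
      closure (testGraph A a (Set.range a)) := by
  have h : ∀ s : Finset (E N), testGraph A a ∅ ⊆ closure (testGraph A a (s : Set (E N))) := by
    classical
    intro s
    induction s using Finset.induction with
    | empty => rw [Finset.coe_empty]; exact subset_closure
    | insert p s _ ih =>
      rw [Finset.coe_insert]
      exact ih.trans (closure_minimal (testGraph_subset_closure_insert hN _ p) isClosed_closure)
  have h1 := h (Set.finite_range a).toFinset
  rw [Set.Finite.coe_toFinset] at h1
  exact gradGraph_subset_closure.trans (closure_minimal h1 isClosed_closure)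

/-- Every element of `H¹_μ` is the limit of test functions vanishing near the poles. -/
theorem exists_seq_testFun (hN : 3 ≤ N) {u : L2 A a} (hu : u ∈ H1 A a) :
    ∃ (φ : ℕ → E N → ℝ) (hφ : ∀ k, ContDiff ℝ ∞ (φ k)) (hc : ∀ k, HasCompactSupport (φ k)),
      (∀ k i, a i ∉ tsupport (φ k)) ∧
      Tendsto (fun k => testFun A a (φ k) ((hφ k).of_le (by simp)) (hc k)) atTop (𝓝 u) ∧
      Tendsto (fun k => testGrad A a (φ k) ((hφ k).of_le (by simp)) (hc k)) atTop
        (𝓝 (weakGrad A a u)) := by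
  have h : (u, weakGrad A a u) ∈ closure (testGraph A a (Set.range a)) :=
    gradGraph_subset_closure_poles A a hN (isWeakGradient_weakGrad hu)
  obtain ⟨p, hp, hlim⟩ := mem_closure_iff_seq_limit.1 h
  choose φ hφ hc hs he using hp
  refine ⟨φ, hφ, hc, fun k i => hs k _ ⟨i, rfl⟩, ?_, ?_⟩
  · have := (continuous_fst.tendsto _).comp hlim
    refine this.congr fun k => ?_
    rw [Function.comp_apply, he]
  · have := (continuous_snd.tendsto _).comp hlim
    refine this.congr fun k => ?_
    rw [Function.comp_apply, he]

theorem dense_H1 : Dense (H1 A a) := by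
  have h := Lp.dense_hasCompactSupport_contDiff (F := ℝ) (μ := gaussMeasure A a) (p := 2) (by simp)
  refine h.mono ?_
  rintro f ⟨g, hg, hgc, hgs⟩
  have : f = testFun A a g (hgs.of_le (by simp)) hgc :=
    Lp.ext (hg.trans (coeFn_testFun _ _).symm)
  rw [this]
  exact testFun_mem_H1 _ _

end PoleRemoval

/-! ### The cut off radial field -/

section VectorField

variable {N : ℕ}

/-- The square of the positive part. -/
def posSq (t : ℝ) : ℝ := max t 0 ^ 2

theorem hasDerivAt_posSq (t : ℝ) : HasDerivAt posSq (2 * max t 0) t := by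
  rcases lt_trichotomy t 0 with h | rfl | h
  · rw [max_eq_right h.le, mul_zero]
    refine (hasDerivAt_const t (0 : ℝ)).congr_of_eventuallyEq ?_
    filter_upwards [eventually_lt_nhds h] with s hs
    simp [posSq, max_eq_right hs.le]
  · rw [max_self, mul_zero, hasDerivAt_iff_isLittleO]
    have h1 : (fun x : ℝ => x ^ 2) =o[𝓝 0] fun x => x := by
      simpa using Asymptotics.isLittleO_pow_pow (𝕜 := ℝ) (m := 1) (n := 2) one_lt_two
    have h2 : (fun x : ℝ => posSq x) =O[𝓝 0] fun x => x ^ 2 := by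
      refine Asymptotics.IsBigO.of_bound 1 (Eventually.of_forall fun x => ?_)
      rw [one_mul, posSq, norm_pow, norm_pow]
      gcongr
      rw [Real.norm_of_nonneg (le_max_right _ _)]
      exact max_le (Real.le_norm_self x) (norm_nonneg x)
    simpa [posSq] using h2.trans_isLittleO h1
  · rw [max_eq_left h.le]
    have h1 : HasDerivAt (fun s : ℝ => s ^ 2) (2 * t) t := by simpa using hasDerivAt_pow 2 t
    refine h1.congr_of_eventuallyEq ?_
    filter_upwards [eventually_gt_nhds h] with s hs
    simp [posSq, max_eq_left hs.le]

theorem contDiff_posSq : ContDiff ℝ 1 posSq := by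
  rw [contDiff_one_iff_deriv]
  refine ⟨fun t => (hasDerivAt_posSq t).differentiableAt, ?_⟩
  rw [show deriv posSq = fun t => 2 * max t 0 from funext fun t => (hasDerivAt_posSq t).deriv]
  fun_prop

/-- The divergence of a vector field. -/
def divergence (F : E N → E N) (x : E N) : ℝ :=
  ∑ l, inner ℝ (fderiv ℝ F x (EuclideanSpace.basisFun (Fin N) ℝ l))
    (EuclideanSpace.basisFun (Fin N) ℝ l)

theorem divergence_sub {F G : E N → E N} {x : E N} (hF : DifferentiableAt ℝ F x)
    (hG : DifferentiableAt ℝ G x) :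
    divergence (fun y => F y - G y) x = divergence F x - divergence G x := by
  simp only [divergence, fderiv_fun_sub hF hG, sub_apply, inner_sub_left, Finset.sum_sub_distrib]

theorem divergence_const_smul {F : E N → E N} {x : E N} (hF : DifferentiableAt ℝ F x) (r : ℝ) :
    divergence (fun y => r • F y) x = r * divergence F x := by
  simp only [divergence, fderiv_fun_const_smul hF, smul_apply, real_inner_smul_left, Finset.mul_sum]

theorem divergence_sum {ι : Type*} [Fintype ι] {F : ι → E N → E N} {x : E N}
    (hF : ∀ i, DifferentiableAt ℝ (F i) x) :
    divergence (fun y => ∑ i, F i y) x = ∑ i, divergence (F i) x := by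
  simp only [divergence, fderiv_fun_sum fun i _ => hF i, sum_apply, sum_inner]
  exact Finset.sum_comm

theorem continuous_divergence {F : E N → E N} (hF : ContDiff ℝ 1 F) : Continuous (divergence F) :=
  continuous_finsetSum _ fun _ _ =>
    ((hF.continuous_fderiv (by simp)).clm_apply continuous_const).inner continuous_const

/-- The field `m (x - p) ((1 - σ ‖x - p‖²)₊)² / (‖x - p‖² + ε)`. -/
def radialField (m σ ε : ℝ) (p x : E N) : E N :=
  (m * posSq (1 - σ * ‖x - p‖ ^ 2) / (‖x - p‖ ^ 2 + ε)) • (x - p)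

theorem contDiff_radialField {m σ ε : ℝ} (hε : 0 < ε) (p : E N) :
    ContDiff ℝ 1 (radialField m σ ε p) := by
  have h1 : ContDiff ℝ 1 fun x : E N => x - p := contDiff_id.sub contDiff_const
  have h2 : ContDiff ℝ 1 fun x : E N => ‖x - p‖ ^ 2 := h1.norm_sq ℝ
  refine ContDiff.smul (ContDiff.div ?_ (h2.add contDiff_const) fun x => by positivity) h1
  exact contDiff_const.mul (contDiff_posSq.comp (contDiff_const.sub (contDiff_const.mul h2)))

theorem divergence_radialField {m σ ε : ℝ} (hε : 0 < ε) (p x : E N) :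
    divergence (radialField m σ ε p) x =
      N * (m * posSq (1 - σ * ‖x - p‖ ^ 2) / (‖x - p‖ ^ 2 + ε)) + 2 * ‖x - p‖ ^ 2 *
        (m * (-(2 * σ * max (1 - σ * ‖x - p‖ ^ 2) 0 / (‖x - p‖ ^ 2 + ε)) -
          posSq (1 - σ * ‖x - p‖ ^ 2) / (‖x - p‖ ^ 2 + ε) ^ 2)) := by
  set s := ‖x - p‖ ^ 2 with hs
  have hs0 : s + ε ≠ 0 := by positivity
  have h1 : HasFDerivAt (fun y : E N => y - p) (ContinuousLinearMap.id ℝ (E N)) x :=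
    (hasFDerivAt_id x).sub_const p
  have h2 : HasFDerivAt (fun y : E N => ‖y - p‖ ^ 2) (2 • innerSL ℝ (x - p)) x := by
    simpa using h1.norm_sq
  have hq : HasDerivAt (fun t => m * posSq (1 - σ * t) / (t + ε))
      (m * (-(2 * σ * max (1 - σ * s) 0 / (s + ε)) - posSq (1 - σ * s) / (s + ε) ^ 2)) s := by
    have h3 : HasDerivAt (fun t => 1 - σ * t) (-σ) s := by
      simpa using ((hasDerivAt_id s).const_mul σ).const_sub 1
    have h4 := (hasDerivAt_posSq (1 - σ * s)).comp s h3
    have h5 := (h4.const_mul m).div ((hasDerivAt_id s).add_const ε) hs0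
    refine h5.congr_deriv ?_
    simp only [id_eq, Function.comp_apply]
    field_simp
  have h6 := (HasDerivAt.comp_hasFDerivAt x hq h2).smul h1
  have h7 : fderiv ℝ (radialField m σ ε p) x = _ := h6.fderiv
  rw [divergence, h7]
  set e := EuclideanSpace.basisFun (Fin N) ℝ
  have h8 : ∑ l, inner ℝ (x - p) (e l) * inner ℝ (x - p) (e l) = s := by
    have := e.sum_inner_mul_inner (x - p) (x - p)
    simp only [real_inner_comm (x - p) (e _)] at this
    rw [this, real_inner_self_eq_norm_sq]
  simp only [Function.comp_apply, add_apply, smul_apply, ContinuousLinearMap.smulRight_apply,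
    ContinuousLinearMap.id_apply, innerSL_apply_apply, inner_add_left, real_inner_smul_left,
    real_inner_self_eq_norm_sq, e.norm_eq_one, Finset.sum_add_distrib, nsmul_eq_mul, smul_eq_mul]
  rw [Finset.sum_const, Finset.card_univ, Fintype.card_fin, nsmul_eq_mul, one_pow, mul_one]
  congr 1
  rw [Finset.sum_congr rfl fun l _ => mul_assoc _ _ _]
  generalize m * (-(2 * σ * max (1 - σ * s) 0 / (s + ε)) - posSq (1 - σ * s) / (s + ε) ^ 2) = q'
  rw [← Finset.mul_sum, ← h8, Finset.mul_sum, Finset.mul_sum, Finset.sum_mul]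
  refine Finset.sum_congr rfl fun l _ => ?_
  push_cast
  ring

/-- Here `s` stands for the squared distance to the pole and `z = 1 - σ s`. Since `2z² - z⁴ = 1 - (1
- z²)²`, the full singular term `m² / (s + ε)` survives. The loss `(1 - z²)²` contains a factor `σ
s`, which cancels the singularity, so the total loss is `σ` times a bounded quantity. -/
theorem radialField_bound_aux {m σ ε s : ℝ} (hm : 0 ≤ m) (hσ : 0 ≤ σ) (hε : 0 < ε) (hs : 0 ≤ s)
    (hy : σ * s ≤ 1) :
    m ^ 2 / (s + ε) - σ * (8 + 2 * m ^ 2) ≤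
      (2 * m + 2) * (m * (1 - σ * s) ^ 2 / (s + ε)) + 2 * s *
        (m * (-(2 * σ * (1 - σ * s) / (s + ε)) - (1 - σ * s) ^ 2 / (s + ε) ^ 2)) -
      (m * (1 - σ * s) ^ 2 / (s + ε)) ^ 2 * s := by
  have hp : 0 < s + ε := by positivity
  set z := 1 - σ * s with hz
  have hz0 : 0 ≤ z := by linarith
  have hz1 : z ≤ 1 := by have := mul_nonneg hσ hs; linarith
  set r := 1 / (s + ε) with hr
  set τ := s * r with hτ
  have hr0 : 0 < r := by positivity
  have hτ1 : τ ≤ 1 := by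
    rw [hτ, hr, mul_one_div, div_le_one hp]
    linarith
  have hτ0 : 0 ≤ τ := by positivity
  have e1 : (2 * m + 2) * (m * z ^ 2 / (s + ε)) + 2 * s *
        (m * (-(2 * σ * z / (s + ε)) - z ^ 2 / (s + ε) ^ 2)) - (m * z ^ 2 / (s + ε)) ^ 2 * s =
      2 * m ^ 2 * z ^ 2 * r + 2 * m * z ^ 2 * r * (1 - τ) - 4 * m * σ * z * τ -
        m ^ 2 * z ^ 4 * r * τ := by
    rw [hτ, hr]
    field_simp
    ring
  have e2 : m ^ 2 / (s + ε) = m ^ 2 * r := by rw [hr, mul_one_div]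
  rw [e1, e2]
  have i1 : 0 ≤ 2 * m * z ^ 2 * r * (1 - τ) := mul_nonneg (by positivity) (by linarith)
  have i2 : 4 * m * σ * z * τ ≤ 4 * m * σ * z := mul_le_of_le_one_right (by positivity) hτ1
  have i3 : m ^ 2 * z ^ 4 * r * τ ≤ m ^ 2 * z ^ 4 * r := mul_le_of_le_one_right (by positivity) hτ1
  have e3 : m ^ 2 * r * (1 - z ^ 2) ^ 2 = m ^ 2 * σ * (1 - z) * (1 + z) ^ 2 * τ := by
    rw [hτ, show (1 - z ^ 2) ^ 2 = (1 - z) * (1 - z) * (1 + z) ^ 2 by ring,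
      show 1 - z = σ * s by rw [hz]; ring]
    ring
  have i4 : m ^ 2 * σ * (1 - z) * (1 + z) ^ 2 * τ ≤ m ^ 2 * σ * (1 - z) * (1 + z) ^ 2 := by
    refine mul_le_of_le_one_right (mul_nonneg (mul_nonneg (by positivity) ?_) (by positivity)) hτ1
    linarith
  -- The source of the constant 8: the linear term `4 m z` from differentiating the cutoff is
  -- absorbed by `8 + (m z)² / 2`, and what remains of `2 m²` still dominates the other loss.
  have i5 : 0 ≤ 8 + 2 * m ^ 2 - 4 * m * z - m ^ 2 * ((1 - z) * (1 + z) ^ 2) := by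
    have : 8 + 2 * m ^ 2 - 4 * m * z - m ^ 2 * ((1 - z) * (1 + z) ^ 2) =
        (m * z - 4) ^ 2 / 2 + m ^ 2 * ((1 - z) ^ 2 / 2 + 1 / 2 + z ^ 3) := by ring
    rw [this]
    positivity
  have i6 := mul_nonneg hσ i5
  nlinarith

theorem radialField_eq_zero {m σ ε : ℝ} {p x : E N} (hy : 1 ≤ σ * ‖x - p‖ ^ 2) :
    radialField m σ ε p x = 0 := by
  rw [radialField, posSq, max_eq_right (by linarith)]
  simp

/-- With `m = (N - 2) / 2`, the uncut field `m (x - p) / |x - p|²` has divergence `2 m² / |x - p|²`;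
subtracting its square leaves the optimal coefficient `m²`. -/
theorem le_divergence_radialField {m σ ε : ℝ} (hm : 0 ≤ m) (hσ : 0 ≤ σ) (hε : 0 < ε)
    (hN : (N : ℝ) = 2 * m + 2) {p x : E N} (hy : σ * ‖x - p‖ ^ 2 ≤ 1) :
    m ^ 2 / (‖x - p‖ ^ 2 + ε) - σ * (8 + 2 * m ^ 2) ≤
      divergence (radialField m σ ε p) x - ‖radialField m σ ε p x‖ ^ 2 := by
  have h := radialField_bound_aux hm hσ hε (sq_nonneg ‖x - p‖) hy
  rw [divergence_radialField hε, radialField, norm_smul, mul_pow, Real.norm_eq_abs, sq_abs, posSq,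
    max_eq_left (by linarith), hN]
  exact h

theorem divergence_radialField_eq_zero {m σ ε : ℝ} (hε : 0 < ε) {p x : E N}
    (hy : 1 ≤ σ * ‖x - p‖ ^ 2) : divergence (radialField m σ ε p) x = 0 := by
  rw [divergence_radialField hε, posSq, max_eq_right (by linarith)]
  simp

end VectorField

/-! ### Multiplication by bounded functions -/

section MulOp

variable {α : Type*} [MeasurableSpace α] {ν : Measure α}

theorem memLp_bdd_mul {w : α → ℝ} (hw : Measurable w) {C : ℝ} (hC : ∀ x, |w x| ≤ C)
    (f : Lp ℝ 2 ν) : MemLp (fun x => w x * f x) 2 ν :=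
  (Lp.memLp f).of_le_mul (hw.aestronglyMeasurable.mul (Lp.memLp f).1)
    (Eventually.of_forall fun x => by
      rw [norm_mul]
      exact mul_le_mul_of_nonneg_right (hC x) (norm_nonneg _))

variable (ν) in
/-- Multiplication by a bounded function. -/
def mulOp (w : α → ℝ) (hw : Measurable w) (C : ℝ) (hC : ∀ x, |w x| ≤ C) :
    Lp ℝ 2 ν →L[ℝ] Lp ℝ 2 ν :=
  LinearMap.mkContinuous
    { toFun := fun f => (memLp_bdd_mul hw hC f).toLp _
      map_add' := fun f g => by
        rw [← MemLp.toLp_add]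
        refine MemLp.toLp_congr _ _ ?_
        filter_upwards [Lp.coeFn_add f g] with x hx
        rw [hx, Pi.add_apply, Pi.add_apply, mul_add]
      map_smul' := fun r f => by
        rw [RingHom.id_apply, ← MemLp.toLp_const_smul]
        refine MemLp.toLp_congr _ _ ?_
        filter_upwards [Lp.coeFn_smul r f] with x hx
        rw [hx, Pi.smul_apply, Pi.smul_apply, smul_eq_mul, smul_eq_mul, mul_left_comm] }
    C fun f => by
      refine Lp.norm_le_mul_norm_of_ae_le_mul ?_
      filter_upwards [(memLp_bdd_mul hw hC f).coeFn_toLp] with x hx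
      change ‖(memLp_bdd_mul hw hC f).toLp _ x‖ ≤ _
      rw [hx, norm_mul]
      exact mul_le_mul_of_nonneg_right (hC x) (norm_nonneg _)

theorem coeFn_mulOp {w : α → ℝ} (hw : Measurable w) {C : ℝ} (hC : ∀ x, |w x| ≤ C) (f : Lp ℝ 2 ν) :
    mulOp ν w hw C hC f =ᵐ[ν] fun x => w x * f x := (memLp_bdd_mul hw hC f).coeFn_toLp

theorem inner_mulOp {w : α → ℝ} (hw : Measurable w) {C : ℝ} (hC : ∀ x, |w x| ≤ C)
    (f g : Lp ℝ 2 ν) : inner ℝ (mulOp ν w hw C hC f) g = ∫ x, w x * (f x * g x) ∂ν := by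
  rw [L2.inner_def]
  refine integral_congr_ae ?_
  filter_upwards [coeFn_mulOp hw hC f] with x hx
  rw [hx]
  simp
  ring

theorem integrable_mulOp {w : α → ℝ} (hw : Measurable w) {C : ℝ} (hC : ∀ x, |w x| ≤ C)
    (f g : Lp ℝ 2 ν) : Integrable (fun x => w x * (f x * g x)) ν := by
  have := (memLp_bdd_mul hw hC f).integrable_mul (Lp.memLp g)
  refine this.congr (Eventually.of_forall fun x => ?_)
  simp [mul_assoc]

end MulOp

/-! ### Field inequality and geometry of the poles -/

section Hardy

variable {N n : ℕ} {A : Matrix (Fin N) (Fin N) ℝ} {a : Fin n → E N}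

theorem fderiv_drift (x : E N) : fderiv ℝ (drift A a) x = (n : ℝ) • matCLM A := by
  have h : HasFDerivAt (drift A a) (∑ _i : Fin n, matCLM A) x :=
    HasFDerivAt.fun_sum fun i _ => by
      have h1 : HasFDerivAt (fun y : E N => y - a i) (ContinuousLinearMap.id ℝ (E N)) x :=
        (hasFDerivAt_id x).sub_const (a i)
      exact ((matCLM A).hasFDerivAt (x := x - a i)).comp x h1
  rw [h.fderiv, Finset.sum_const, Finset.card_univ, Fintype.card_fin]
  exact (Nat.cast_smul_eq_nsmul ℝ n _).symm

theorem contDiff_drift : ContDiff ℝ 1 (drift A a) :=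
  ContDiff.sum fun _ _ => (matCLM A).contDiff.comp (contDiff_id.sub contDiff_const)

theorem divergence_drift (x : E N) : divergence (drift A a) x = n * A.trace := by
  simp only [divergence, fderiv_drift, smul_apply, Matrix.trace, Matrix.diag_apply]
  rw [Finset.mul_sum]
  refine Finset.sum_congr rfl fun l _ => ?_
  rw [real_inner_smul_left]
  congr 1
  rw [← toEuclideanLin_eq_matCLM]
  simp [Matrix.toLpLin_apply, EuclideanSpace.inner_single_right]

section FieldInequality

variable [hA : Fact A.PosDef] [NeZero n]

theorem integrable_of_tsupport {φ f : E N → ℝ} (hc : HasCompactSupport φ) (hf : Continuous f)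
    (h : ∀ x, x ∉ tsupport φ → f x = 0) : Integrable f :=
  hf.integrable_of_hasCompactSupport (HasCompactSupport.intro hc h)

/-- The method of supersolutions: every vector field gives a lower bound for the gradient. -/
theorem integral_sq_mul_field_le {F : E N → E N} (hF : ContDiff ℝ 1 F) {φ : E N → ℝ}
    (hφ : ContDiff ℝ 1 φ) (hc : HasCompactSupport φ) :
    ∫ x, φ x ^ 2 * (divergence F x - inner ℝ (F x) (drift A a x) - ‖F x‖ ^ 2) ∂gaussMeasure A a ≤
      ∫ x, ‖gradient φ x‖ ^ 2 ∂gaussMeasure A a := by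
  set e := EuclideanSpace.basisFun (Fin N) ℝ with he
  have hdens1 : ContDiff ℝ 1 (density A a) := contDiff_density.of_le (by simp)
  have hη : ∀ l, ContDiff ℝ 1 fun y => density A a y * inner ℝ (F y) (e l) := fun l =>
    hdens1.mul (hF.inner ℝ contDiff_const)
  have hφ2 : ContDiff ℝ 1 fun x => φ x ^ 2 := hφ.pow 2
  have hφ0 : ∀ x, x ∉ tsupport φ → φ x = 0 := fun x hx => image_eq_zero_of_notMem_tsupport hx
  have hg0 : ∀ x, x ∉ tsupport φ → gradient φ x = 0 := fun x hx => gradient_of_notMem_tsupport hx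
  have hgc := continuous_gradient hφ
  have hdc : Continuous (density A a) := continuous_density
  have hFc := hF.continuous
  have hDc := continuous_divergence hF
  have hdr := (contDiff_drift (A := A) (a := a)).continuous
  have hdηc : ∀ l, Continuous fun x => fderiv ℝ (fun y => density A a y * inner ℝ (F y) (e l)) x (e l) :=
    fun l => ((hη l).continuous_fderiv (by simp)).clm_apply continuous_const
  have hφ2d : ∀ x v, fderiv ℝ (fun x => φ x ^ 2) x v = 2 * φ x * inner ℝ (gradient φ x) v := by
    intro x v
    have h1 := ((hφ.differentiable (by simp)).differentiableAt (x := x)).hasFDerivAt.pow 2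
    rw [gradient, InnerProductSpace.toDual_symm_apply, h1.fderiv]
    simp
  have hηd : ∀ x l, fderiv ℝ (fun y => density A a y * inner ℝ (F y) (e l)) x (e l) =
      density A a x * (inner ℝ (fderiv ℝ F x (e l)) (e l) -
        inner ℝ (F x) (e l) * inner ℝ (drift A a x) (e l)) := by
    intro x l
    have h1 : HasFDerivAt (fun y => inner ℝ (F y) (e l)) _ x :=
      (((hF.differentiable (by simp)).differentiableAt (x := x)).hasFDerivAt).inner ℝ
        (hasFDerivAt_const (e l) x)
    rw [fderiv_mul_apply' (hdens1.differentiable (by simp)).differentiableAt h1.differentiableAt,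
      (hasFDerivAt_density x).fderiv, h1.fderiv]
    simp
    ring
  set P : E N → ℝ := fun x => density A a x * (φ x ^ 2 * (divergence F x - inner ℝ (F x) (drift A a x)))
  set Q : E N → ℝ := fun x => density A a x * (2 * φ x * inner ℝ (gradient φ x) (F x))
  set R : E N → ℝ := fun x => density A a x * (φ x ^ 2 * ‖F x‖ ^ 2)
  set T : E N → ℝ := fun x => density A a x * ‖gradient φ x‖ ^ 2
  have iP : Integrable P := integrable_of_tsupport hc (by fun_prop) fun x hx => by
    simp [P, hφ0 x hx]
  have iQ : Integrable Q := integrable_of_tsupport hc (by fun_prop) fun x hx => by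
    simp [Q, hφ0 x hx]
  have iR : Integrable R := integrable_of_tsupport hc (by fun_prop) fun x hx => by
    simp [R, hφ0 x hx]
  have iT : Integrable T := integrable_of_tsupport hc (by fun_prop) fun x hx => by
    simp [T, hg0 x hx]
  have hsum : ∀ x y : E N, ∑ l, inner ℝ x (e l) * inner ℝ y (e l) = inner ℝ x y := fun x y => by
    rw [← e.sum_inner_mul_inner x y]
    simp only [real_inner_comm y (e _)]
  -- Integration by parts of `φ² div (μ F)`, one coordinate at a time; the drift term in `P` comes
  -- from differentiating the density.
  have hPQ : ∫ x, P x = -∫ x, Q x := by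
    have e1 : ∀ x, P x = ∑ l, φ x ^ 2 *
        fderiv ℝ (fun y => density A a y * inner ℝ (F y) (e l)) x (e l) := fun x => by
      simp only [hηd, P, ← Finset.mul_sum, Finset.sum_sub_distrib, hsum, divergence]
      ring
    have e2 : ∀ x, Q x = ∑ l, fderiv ℝ (fun x => φ x ^ 2) x (e l) *
        (density A a x * inner ℝ (F x) (e l)) := fun x => by
      simp only [hφ2d, Q, ← hsum (gradient φ x) (F x), Finset.mul_sum]
      exact Finset.sum_congr rfl fun l _ => by ring
    have j1 : ∀ l, Integrable fun x => φ x ^ 2 *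
        fderiv ℝ (fun y => density A a y * inner ℝ (F y) (e l)) x (e l) := fun l =>
      integrable_of_tsupport hc ((hφ.continuous.pow 2).mul (hdηc l)) fun x hx => by
        simp [hφ0 x hx]
    have j2 : ∀ l, Integrable fun x => fderiv ℝ (fun x => φ x ^ 2) x (e l) *
        (density A a x * inner ℝ (F x) (e l)) := fun l =>
      integrable_of_tsupport hc (((hφ2.continuous_fderiv (by simp)).clm_apply
        continuous_const).mul (hη l).continuous) fun x hx => by
        simp [hφ2d, hφ0 x hx]
    simp only [e1, e2]
    rw [integral_finsetSum _ fun l _ => j1 l, integral_finsetSum _ fun l _ => j2 l,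
      ← Finset.sum_neg_distrib]
    refine Finset.sum_congr rfl fun l _ => ?_
    refine integral_mul_fderiv_eq_neg_fderiv_mul_of_integrable (j2 l) (j1 l) ?_ ?_ ?_
    · exact integrable_of_tsupport hc ((hφ.continuous.pow 2).mul (hη l).continuous) fun x hx => by
        simp [hφ0 x hx]
    · exact fun x _ => (hφ2.differentiable (by simp)).differentiableAt
    · exact fun x _ => ((hη l).differentiable (by simp)).differentiableAt
  rw [integral_gaussMeasure, integral_gaussMeasure]
  have e3 : ∫ x, density A a x • (φ x ^ 2 *
      (divergence F x - inner ℝ (F x) (drift A a x) - ‖F x‖ ^ 2)) = (∫ x, P x) - ∫ x, R x := by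
    rw [← integral_sub iP iR]
    refine integral_congr_ae (Eventually.of_forall fun x => ?_)
    simp only [P, R, smul_eq_mul]
    ring
  -- The sum is the integral of `|∇φ + φ F|²` against the density.
  have e4 : 0 ≤ (∫ x, T x) + (∫ x, Q x) + ∫ x, R x := by
    rw [← integral_add iT iQ, ← integral_add (f := fun x => T x + Q x) (iT.add iQ) iR]
    refine integral_nonneg fun x => ?_
    have h1 : ‖gradient φ x + φ x • F x‖ ^ 2 =
        ‖gradient φ x‖ ^ 2 + 2 * φ x * inner ℝ (gradient φ x) (F x) + φ x ^ 2 * ‖F x‖ ^ 2 := by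
      rw [norm_add_sq_real, real_inner_smul_right, norm_smul, mul_pow, Real.norm_eq_abs, sq_abs]
      ring
    have h2 : T x + Q x + R x = density A a x * ‖gradient φ x + φ x • F x‖ ^ 2 := by
      rw [h1]
      simp only [T, Q, R]
      ring
    rw [Pi.zero_apply, h2]
    exact mul_nonneg (density_pos x).le (sq_nonneg _)
  rw [e3, hPQ]
  change _ ≤ ∫ x, T x
  linarith

end FieldInequality

/-! ### Geometry of the poles -/

theorem poleRadius_pos (ha : Function.Injective a) (hn : 2 ≤ n) : 0 < poleRadius a := by
  have hfin : {r : ℝ | ∃ i j, i ≠ j ∧ r = ‖a i - a j‖}.Finite :=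
    (Set.finite_range fun p : Fin n × Fin n => ‖a p.1 - a p.2‖).subset (by
      rintro r ⟨i, j, _, rfl⟩
      exact ⟨(i, j), rfl⟩)
  have hne : {r : ℝ | ∃ i j, i ≠ j ∧ r = ‖a i - a j‖}.Nonempty :=
    ⟨_, ⟨0, by omega⟩, ⟨1, by omega⟩, by simp, rfl⟩
  obtain ⟨i, j, hij, h⟩ := hne.csInf_mem hfin
  rw [poleRadius, h]
  have : 0 < ‖a i - a j‖ := norm_pos_iff.2 (sub_ne_zero.2 (ha.ne hij))
  positivity

theorem two_poleRadius_le {i j : Fin n} (hij : i ≠ j) : 2 * poleRadius a ≤ ‖a i - a j‖ := by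
  have h : sInf {r : ℝ | ∃ i j, i ≠ j ∧ r = ‖a i - a j‖} ≤ ‖a i - a j‖ :=
    csInf_le ⟨0, by rintro r ⟨i, j, _, rfl⟩; exact norm_nonneg _⟩ ⟨i, j, hij, rfl⟩
  rw [poleRadius]
  linarith

variable (a) in
/-- The inverse square of the distance between the poles, and `0` for a single pole. -/
def invSqRadius : ℝ := if 2 ≤ n then 1 / poleRadius a ^ 2 else 0

theorem invSqRadius_nonneg : 0 ≤ invSqRadius a := by
  unfold invSqRadius
  split_ifs <;> positivity

theorem hardyConst_eq (c k : ℝ) :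
    hardyConst A a c k = invSqRadius a * (k + (n + 1) * c) + n / 2 * A.trace := by
  unfold hardyConst invSqRadius
  split_ifs <;> ring

/-- The open balls of radius `r₀` about the poles are disjoint, as distinct poles are at distance at
least `2 r₀`. -/
theorem one_le_invSqRadius_mul (ha : Function.Injective a) {i j : Fin n} (hij : i ≠ j) {x : E N}
    (hi : invSqRadius a * ‖x - a i‖ ^ 2 < 1) : 1 ≤ invSqRadius a * ‖x - a j‖ ^ 2 := by
  have hn : 2 ≤ n := by
    have h1 := i.2
    have h2 := j.2
    have h3 : (i : ℕ) ≠ j := fun h => hij (Fin.ext h)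
    omega
  have hr := poleRadius_pos ha hn
  rw [invSqRadius, if_pos hn, one_div_mul_eq_div] at *
  rw [div_lt_one (by positivity), sq_lt_sq₀ (norm_nonneg _) hr.le] at hi
  rw [le_div_iff₀ (by positivity), one_mul, sq_le_sq₀ hr.le (norm_nonneg _)]
  have h1 := two_poleRadius_le (a := a) hij
  have h2 : ‖a i - a j‖ ≤ ‖x - a i‖ + ‖x - a j‖ := by
    have := norm_sub_le (x - a j) (x - a i)
    rw [sub_sub_sub_cancel_left] at this
    linarith
  linarith

/-- Inside the ball of a pole, its own field costs `σ (8 + 2 m²)` and the other `n - 1` poles have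
potential at most `σ` each, which makes `8 + (n + 1) m²`. Outside all balls the field vanishes and
the potential is at most `n σ`. For one pole `σ = 0`, and nothing is lost. -/
theorem le_sum_radialField (ha : Function.Injective a) {m ε : ℝ} (hm : 0 ≤ m) (hε : 0 < ε)
    (hN : (N : ℝ) = 2 * m + 2) (x : E N) :
    m ^ 2 * ∑ i, 1 / (‖x - a i‖ ^ 2 + ε) - invSqRadius a * (8 + (n + 1) * m ^ 2) ≤
      ∑ i, divergence (radialField m (invSqRadius a) ε (a i)) x -
        ‖∑ i, radialField m (invSqRadius a) ε (a i) x‖ ^ 2 := by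
  set σ := invSqRadius a with hσ
  have hσ0 : 0 ≤ σ := invSqRadius_nonneg
  have hfar : ∀ j, 1 ≤ σ * ‖x - a j‖ ^ 2 → 1 / (‖x - a j‖ ^ 2 + ε) ≤ σ := fun j hj => by
    rw [div_le_iff₀ (by positivity)]
    nlinarith [mul_nonneg hσ0 hε.le]
  by_cases h : ∃ i, σ * ‖x - a i‖ ^ 2 < 1
  · obtain ⟨i, hi⟩ := h
    have hj : ∀ j, j ≠ i → 1 ≤ σ * ‖x - a j‖ ^ 2 := fun j hji =>
      one_le_invSqRadius_mul ha hji.symm hi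
    rw [Finset.sum_eq_single i (fun j _ hji => divergence_radialField_eq_zero hε (hj j hji)) (by simp),
      Finset.sum_eq_single i (fun j _ hji => radialField_eq_zero (hj j hji)) (by simp),
      ← Finset.add_sum_erase _ _ (Finset.mem_univ i)]
    have h1 := le_divergence_radialField hm hσ0 hε hN hi.le
    have h2 : ∑ j ∈ Finset.univ.erase i, 1 / (‖x - a j‖ ^ 2 + ε) ≤ (n - 1) * σ := by
      have := Finset.sum_le_card_nsmul (Finset.univ.erase i) (fun j => 1 / (‖x - a j‖ ^ 2 + ε)) σ
        fun j hji => hfar j (hj j (Finset.ne_of_mem_erase hji))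
      rw [Finset.card_erase_of_mem (Finset.mem_univ i), Finset.card_univ, Fintype.card_fin,
        nsmul_eq_mul, Nat.cast_sub (Nat.one_le_iff_ne_zero.2 (Nat.ne_of_gt (Fin.pos i)))] at this
      simpa using this
    have h3 := mul_le_mul_of_nonneg_left h2 (sq_nonneg m)
    rw [mul_add, mul_one_div]
    linarith
  · push Not at h
    rw [Finset.sum_eq_zero fun i _ => divergence_radialField_eq_zero hε (h i),
      Finset.sum_eq_zero fun i _ => radialField_eq_zero (h i)]
    have h2 : ∑ j, 1 / (‖x - a j‖ ^ 2 + ε) ≤ n * σ := by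
      have := Finset.sum_le_card_nsmul Finset.univ (fun j => 1 / (‖x - a j‖ ^ 2 + ε)) σ
        fun j _ => hfar j (h j)
      simpa using this
    have h3 := mul_le_mul_of_nonneg_left h2 (sq_nonneg m)
    have h4 : 0 ≤ σ * (8 + m ^ 2) := by positivity
    simp only [norm_zero]
    linarith

end Hardy

/-! ### The weighted Hardy inequality -/

section HardyInequality

variable {N n : ℕ} {A : Matrix (Fin N) (Fin N) ℝ} {a : Fin n → E N}

theorem norm_sq_eq_integral {α F : Type*} [MeasurableSpace α] {ν : Measure α}
    [NormedAddCommGroup F] [InnerProductSpace ℝ F] (f : Lp F 2 ν) :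
    ‖f‖ ^ 2 = ∫ x, ‖f x‖ ^ 2 ∂ν := by
  rw [← real_inner_self_eq_norm_sq, L2.inner_def]
  simp only [real_inner_self_eq_norm_sq]

variable (a) in
/-- The regularized potential `∑ᵢ 1 / (|x - aᵢ|² + ε)`. -/
def regPotential (ε : ℝ) (x : E N) : ℝ := ∑ i, 1 / (‖x - a i‖ ^ 2 + ε)

theorem continuous_regPotential {ε : ℝ} (hε : 0 < ε) : Continuous (regPotential a ε) :=
  continuous_finsetSum _ fun i _ => continuous_const.div (by fun_prop) fun x => by positivity

theorem regPotential_nonneg {ε : ℝ} (hε : 0 < ε) (x : E N) : 0 ≤ regPotential a ε x :=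
  Finset.sum_nonneg fun i _ => by positivity

theorem abs_regPotential_le {ε : ℝ} (hε : 0 < ε) (x : E N) : |regPotential a ε x| ≤ n * (1 / ε) := by
  rw [abs_of_nonneg (regPotential_nonneg hε x)]
  have := Finset.sum_le_card_nsmul Finset.univ (fun j => 1 / (‖x - a j‖ ^ 2 + ε)) (1 / ε)
    fun j _ => one_div_le_one_div_of_le hε (by linarith [sq_nonneg ‖x - a j‖])
  simpa [regPotential] using this

theorem potential_nonneg {c : ℝ} (hc : 0 ≤ c) (x : E N) : 0 ≤ potential c a x :=
  Finset.sum_nonneg fun i _ => by positivity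

theorem measurable_potential (c : ℝ) : Measurable (potential c a) := by
  unfold potential
  fun_prop

theorem potential_eq (c : ℝ) (x : E N) : potential c a x = c * potential 1 a x := by
  simp only [potential, Finset.mul_sum, mul_one_div]

theorem cO_eq : cO N = (((N : ℝ) - 2) / 2) ^ 2 := rfl

theorem cO_pos (hN : 3 ≤ N) : 0 < cO N := by
  have : (3 : ℝ) ≤ N := by exact_mod_cast hN
  rw [cO_eq]
  have : 0 < ((N : ℝ) - 2) / 2 := by linarith
  positivity

variable [hA : Fact A.PosDef] [NeZero n]

/-- Subtracting half the drift from `G` cancels the products of `G` with the drift. What remains of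
the weight is the constant `-(n / 2) Tr A` and a nonnegative quarter of the squared drift, which is
dropped. -/
theorem hardy_regularized_test (hN : 3 ≤ N) (ha : Function.Injective a) {ε : ℝ} (hε : 0 < ε)
    {φ : E N → ℝ} (hφ : ContDiff ℝ 1 φ) (hc : HasCompactSupport φ) :
    cO N * ∫ x, regPotential a ε x * (φ x * φ x) ∂gaussMeasure A a ≤
      ∫ x, ‖gradient φ x‖ ^ 2 ∂gaussMeasure A a +
        hardyConst A a (cO N) 8 * ∫ x, ‖φ x‖ ^ 2 ∂gaussMeasure A a := by
  set m : ℝ := ((N : ℝ) - 2) / 2 with hm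
  have hm0 : 0 ≤ m := by
    have : (3 : ℝ) ≤ N := by exact_mod_cast hN
    rw [hm]; linarith
  have hNm : (N : ℝ) = 2 * m + 2 := by rw [hm]; ring
  set G : E N → E N := fun y => ∑ i, radialField m (invSqRadius a) ε (a i) y with hG
  have hGs : ContDiff ℝ 1 G := ContDiff.sum fun i _ => contDiff_radialField hε (a i)
  have hdr : ContDiff ℝ 1 (drift A a) := contDiff_drift
  have hds : ContDiff ℝ 1 fun y => (1 / 2 : ℝ) • drift A a y := hdr.const_smul _
  have hF : ContDiff ℝ 1 fun y => G y - (1 / 2 : ℝ) • drift A a y := hGs.sub hds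
  have h1 := integral_sq_mul_field_le (A := A) (a := a) hF hφ hc
  have hpt : ∀ x, φ x ^ 2 * (cO N * regPotential a ε x - hardyConst A a (cO N) 8) ≤
      φ x ^ 2 * (divergence (fun y => G y - (1 / 2 : ℝ) • drift A a y) x -
        inner ℝ (G x - (1 / 2 : ℝ) • drift A a x) (drift A a x) -
        ‖G x - (1 / 2 : ℝ) • drift A a x‖ ^ 2) := by
    intro x
    refine mul_le_mul_of_nonneg_left ?_ (sq_nonneg _)
    rw [divergence_sub (hGs.differentiable (by simp)).differentiableAt
      (hds.differentiable (by simp)).differentiableAt,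
      divergence_const_smul (hdr.differentiable (by simp)).differentiableAt, divergence_drift,
      hG, divergence_sum fun i => ((contDiff_radialField hε (a i)).differentiable
        (by simp)).differentiableAt, norm_sub_sq_real, inner_sub_left, real_inner_smul_left,
      real_inner_smul_right, real_inner_self_eq_norm_sq, norm_smul, mul_pow, hardyConst_eq]
    have h2 := le_sum_radialField ha hm0 hε hNm x
    have h3 : 0 ≤ ‖drift A a x‖ ^ 2 := sq_nonneg _
    have h4 : ‖(1 / 2 : ℝ)‖ ^ 2 = 1 / 4 := by norm_num
    rw [h4]
    have h5 : cO N = m ^ 2 := rfl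
    rw [h5]
    unfold regPotential
    linarith
  have hφ2 : HasCompactSupport fun x => φ x ^ 2 := hc.comp_left (g := fun t : ℝ => t ^ 2) (by simp)
  have hcont := continuous_regPotential (a := a) hε
  have hφc := hφ.continuous
  have i1 : Integrable (fun x => φ x ^ 2 * (cO N * regPotential a ε x - hardyConst A a (cO N) 8))
      (gaussMeasure A a) := Continuous.integrable_of_hasCompactSupport (by fun_prop) hφ2.mul_right
  have i2 := Continuous.integrable_of_hasCompactSupport (μ := gaussMeasure A a)
    ((hφc.pow 2).mul (((continuous_divergence hF).sub
      (hF.continuous.inner (𝕜 := ℝ) hdr.continuous)).sub (hF.continuous.norm.pow 2))) hφ2.mul_right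
  have h6 := (integral_mono i1 i2 hpt).trans h1
  have i3 : Integrable (fun x => regPotential a ε x * (φ x * φ x)) (gaussMeasure A a) :=
    Continuous.integrable_of_hasCompactSupport (by fun_prop) hc.mul_right.mul_left
  have i4 : Integrable (fun x => ‖φ x‖ ^ 2) (gaussMeasure A a) :=
    Continuous.integrable_of_hasCompactSupport (by fun_prop) (by simpa using hφ2)
  have e1 : ∫ x, φ x ^ 2 * (cO N * regPotential a ε x - hardyConst A a (cO N) 8) ∂gaussMeasure A a =
      cO N * ∫ x, regPotential a ε x * (φ x * φ x) ∂gaussMeasure A a -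
        hardyConst A a (cO N) 8 * ∫ x, ‖φ x‖ ^ 2 ∂gaussMeasure A a := by
    rw [← integral_const_mul, ← integral_const_mul, ← integral_sub (i3.const_mul _) (i4.const_mul _)]
    refine integral_congr_ae (Eventually.of_forall fun x => ?_)
    simp only [Real.norm_eq_abs, sq_abs]
    ring
  rw [e1] at h6
  linarith

theorem measurable_regPotential {ε : ℝ} (hε : 0 < ε) : Measurable (regPotential a ε) :=
  (continuous_regPotential hε).measurable

/-- The regularized potential is bounded, so both sides are continuous for the `H¹_μ` norm and
density of test functions suffices. -/
theorem hardy_regularized (hN : 3 ≤ N) (ha : Function.Injective a) {ε : ℝ} (hε : 0 < ε)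
    {u : L2 A a} (hu : u ∈ H1 A a) :
    cO N * ∫ x, regPotential a ε x * (u x * u x) ∂gaussMeasure A a ≤
      ‖weakGrad A a u‖ ^ 2 + hardyConst A a (cO N) 8 * ‖u‖ ^ 2 := by
  obtain ⟨φ, hφ, hc, -, h1, h2⟩ := exists_seq_testFun hN hu
  rw [← inner_mulOp (measurable_regPotential hε) (abs_regPotential_le hε)]
  set M := mulOp (gaussMeasure A a) (regPotential a ε) (measurable_regPotential hε) (n * (1 / ε))
    (abs_regPotential_le hε)
  refine le_of_tendsto_of_tendsto' (((((M.continuous.tendsto u).comp h1).inner h1)).const_mul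
    (cO N)) ((h2.norm.pow 2).add ((h1.norm.pow 2).const_mul _)) fun k => ?_
  have h3 := hardy_regularized_test (A := A) hN ha hε ((hφ k).of_le (by simp)) (hc k)
  rw [norm_sq_eq_integral, norm_sq_eq_integral, Function.comp_apply, inner_mulOp]
  have e0 := coeFn_testFun (A := A) (a := a) ((hφ k).of_le (by simp) : ContDiff ℝ 1 (φ k)) (hc k)
  have e0' := coeFn_testGrad (A := A) (a := a) ((hφ k).of_le (by simp) : ContDiff ℝ 1 (φ k)) (hc k)
  rw [integral_congr_ae (g := fun x => regPotential a ε x * (φ k x * φ k x))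
      (by filter_upwards [e0] with x hx; rw [hx]),
    integral_congr_ae (f := fun x => ‖testGrad A a (φ k) _ _ x‖ ^ 2)
      (g := fun x => ‖gradient (φ k) x‖ ^ 2)
      (by filter_upwards [e0'] with x hx; rw [hx]),
    integral_congr_ae (f := fun x => ‖testFun A a (φ k) _ _ x‖ ^ 2) (g := fun x => ‖φ k x‖ ^ 2)
      (by filter_upwards [e0] with x hx; rw [hx])]
  exact h3

variable (A) in
theorem ae_ne_pole (hN : 3 ≤ N) : ∀ᵐ x ∂gaussMeasure A a, ∀ i, x ≠ a i := by
  rw [ae_gaussMeasure_iff, ae_all_iff]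
  intro i
  have : Nonempty (Fin N) := ⟨⟨0, by omega⟩⟩
  have : Nontrivial (E N) := inferInstance
  exact compl_mem_ae_iff.2 (measure_singleton (a i))

/-- Fatou's lemma as `ε = 1 / (k + 1)` tends to zero, off the poles, which form a null set.
Integrability of `V u²` is obtained together with the bound. -/
theorem hardy_aux (hN : 3 ≤ N) (ha : Function.Injective a) {u : L2 A a} (hu : u ∈ H1 A a) :
    Integrable (fun x => potential 1 a x * (u x * u x)) (gaussMeasure A a) ∧
    cO N * ∫ x, potential 1 a x * (u x * u x) ∂gaussMeasure A a ≤
      ‖weakGrad A a u‖ ^ 2 + hardyConst A a (cO N) 8 * ‖u‖ ^ 2 := by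
  set B := ‖weakGrad A a u‖ ^ 2 + hardyConst A a (cO N) 8 * ‖u‖ ^ 2 with hB
  have hcO := cO_pos hN
  have hε : ∀ k : ℕ, (0 : ℝ) < 1 / ((k : ℝ) + 1) := fun k => by positivity
  have hk : ∀ k : ℕ, ∫ x, regPotential a (1 / ((k : ℝ) + 1)) x * (u x * u x) ∂gaussMeasure A a ≤
      B / cO N := fun k => by
    rw [le_div_iff₀' hcO]
    exact hardy_regularized hN ha (hε k) hu
  have hum : AEMeasurable u (gaussMeasure A a) := (Lp.memLp u).1.aemeasurable
  have hnn : ∀ x, 0 ≤ potential 1 a x * (u x * u x) := fun x =>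
    mul_nonneg (potential_nonneg zero_le_one x) (mul_self_nonneg _)
  have hl : ∫⁻ x, ENNReal.ofReal (potential 1 a x * (u x * u x)) ∂gaussMeasure A a ≤
      ENNReal.ofReal (B / cO N) := by
    calc _ = ∫⁻ x, liminf (fun k : ℕ => ENNReal.ofReal
          (regPotential a (1 / ((k : ℝ) + 1)) x * (u x * u x))) atTop ∂gaussMeasure A a := by
          refine lintegral_congr_ae ?_
          filter_upwards [ae_ne_pole A hN] with x hx
          refine (Tendsto.liminf_eq ?_).symm
          refine ENNReal.tendsto_ofReal (Tendsto.mul_const _ ?_)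
          refine tendsto_finsetSum _ fun i _ => ?_
          have hs : ‖x - a i‖ ^ 2 ≠ 0 := by
            have := norm_pos_iff.2 (sub_ne_zero.2 (hx i))
            positivity
          have h0 := (tendsto_one_div_add_atTop_nhds_zero_nat (𝕜 := ℝ)).const_add (‖x - a i‖ ^ 2)
          rw [add_zero] at h0
          exact tendsto_const_nhds.div h0 hs
      _ ≤ liminf (fun k : ℕ => ∫⁻ x, ENNReal.ofReal
          (regPotential a (1 / ((k : ℝ) + 1)) x * (u x * u x)) ∂gaussMeasure A a) atTop :=
          lintegral_liminf_le' fun k =>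
            ((measurable_regPotential (hε k)).aemeasurable.mul (hum.mul hum)).ennreal_ofReal
      _ ≤ liminf (fun _ : ℕ => ENNReal.ofReal (B / cO N)) atTop := by
          refine liminf_le_liminf (Eventually.of_forall fun k => ?_)
          rw [← ofReal_integral_eq_lintegral_ofReal (integrable_mulOp (measurable_regPotential (hε k))
            (abs_regPotential_le (hε k)) u u) (Eventually.of_forall fun x =>
              mul_nonneg (regPotential_nonneg (hε k) x) (mul_self_nonneg _))]
          exact ENNReal.ofReal_le_ofReal (hk k)
      _ = _ := liminf_const _
  have hB0 : 0 ≤ B / cO N := le_trans (integral_nonneg fun x =>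
    mul_nonneg (regPotential_nonneg (hε 0) x) (mul_self_nonneg _)) (hk 0)
  have hm : AEStronglyMeasurable (fun x => potential 1 a x * (u x * u x)) (gaussMeasure A a) :=
    ((measurable_potential 1).aemeasurable.mul (hum.mul hum)).aestronglyMeasurable
  refine ⟨⟨hm, ?_⟩, ?_⟩
  · rw [hasFiniteIntegral_iff_ofReal (Eventually.of_forall hnn)]
    exact hl.trans_lt ENNReal.ofReal_lt_top
  · rw [← le_div_iff₀' hcO, integral_eq_lintegral_of_nonneg_ae (Eventually.of_forall hnn) hm]
    exact ENNReal.toReal_le_of_le_ofReal hB0 hl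

theorem integrable_potential_mul (hN : 3 ≤ N) (ha : Function.Injective a) {u v : L2 A a}
    (hu : u ∈ H1 A a) (hv : v ∈ H1 A a) :
    Integrable (fun x => potential 1 a x * (u x * v x)) (gaussMeasure A a) := by
  refine ((hardy_aux hN ha hu).1.add (hardy_aux hN ha hv).1).mono' ?_
    (Eventually.of_forall fun x => ?_)
  · exact ((measurable_potential 1).aemeasurable.mul
      ((Lp.memLp u).1.aemeasurable.mul (Lp.memLp v).1.aemeasurable)).aestronglyMeasurable
  · have h := potential_nonneg (a := a) zero_le_one x
    rw [norm_mul, Real.norm_of_nonneg h, Pi.add_apply, ← mul_add]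
    refine mul_le_mul_of_nonneg_left ?_ h
    rw [norm_mul]
    have := two_mul_le_add_sq ‖u x‖ ‖v x‖
    simp only [Real.norm_eq_abs, sq_abs] at *
    nlinarith [abs_nonneg (u x), abs_nonneg (v x), sq_nonneg (u x), sq_nonneg (v x)]

theorem integrable_div_sq (hN : 3 ≤ N) (ha : Function.Injective a) {u v : L2 A a}
    (hu : u ∈ H1 A a) (hv : v ∈ H1 A a) (i : Fin n) :
    Integrable (fun x => u x * v x / ‖x - a i‖ ^ 2) (gaussMeasure A a) := by
  refine (integrable_potential_mul hN ha hu hv).norm.mono' ?_ (Eventually.of_forall fun x => ?_)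
  · exact (((Lp.memLp u).1.aemeasurable.mul (Lp.memLp v).1.aemeasurable).div
      (by fun_prop)).aestronglyMeasurable
  · rw [norm_div, norm_mul (potential 1 a x), mul_comm, div_eq_mul_one_div]
    rw [mul_comm]
    refine mul_le_mul_of_nonneg_right ?_ (norm_nonneg _)
    rw [Real.norm_of_nonneg (potential_nonneg zero_le_one x), Real.norm_of_nonneg (sq_nonneg _)]
    exact Finset.single_le_sum (f := fun i => 1 / ‖x - a i‖ ^ 2) (fun i _ => by positivity)
      (Finset.mem_univ i)

theorem hardyForm_val (hN : 3 ≤ N) (ha : Function.Injective a) (c : ℝ) {u v : L2 A a}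
    (hu : u ∈ H1 A a) (hv : v ∈ H1 A a) :
    (hardyForm A a c).val u v = inner ℝ (weakGrad A a u) (weakGrad A a v) -
      c * ∫ x, potential 1 a x * (u x * v x) ∂gaussMeasure A a := by
  rw [L2.inner_def]
  change _ - _ = _
  congr 2
  rw [← integral_finsetSum _ fun i _ => integrable_div_sq hN ha hu hv i]
  refine integral_congr_ae (Eventually.of_forall fun x => ?_)
  simp only [potential, Finset.sum_mul]
  exact Finset.sum_congr rfl fun i _ => by ring

theorem trace_nonneg : 0 ≤ A.trace := hA.out.posSemidef.trace_nonneg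

/-- Multiplication by `c / c_o` turns the term `(n + 1) c_o` exactly into `(n + 1) c` and only
decreases the terms in `k` and the trace. -/
theorem hardyConst_scale {c : ℝ} (hc' : c ≤ cO N) (hN : 3 ≤ N) :
    c / cO N * hardyConst A a (cO N) 8 ≤ hardyConst A a c 8 := by
  have h0 := cO_pos hN
  have ht : c / cO N ≤ 1 := (div_le_one h0).2 hc'
  have h1 : 0 ≤ invSqRadius a := invSqRadius_nonneg
  have h2 : 0 ≤ (n : ℝ) / 2 * A.trace := mul_nonneg (by positivity) trace_nonneg
  rw [hardyConst_eq, hardyConst_eq]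
  have e : c / cO N * (invSqRadius a * (8 + (n + 1) * cO N) + n / 2 * A.trace) =
      c / cO N * (invSqRadius a * 8 + n / 2 * A.trace) + invSqRadius a * ((n + 1) * c) := by
    field_simp
    ring
  rw [e]
  have := mul_le_of_le_one_left (add_nonneg (mul_nonneg h1 (by norm_num : (0 : ℝ) ≤ 8)) h2) ht
  linarith

theorem hardyConst_nonneg {c k : ℝ} (hc : 0 ≤ c) (hk : 0 ≤ k) : 0 ≤ hardyConst A a c k := by
  rw [hardyConst_eq]
  have h1 : 0 ≤ invSqRadius a := invSqRadius_nonneg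
  have h2 : 0 ≤ (n : ℝ) / 2 * A.trace := mul_nonneg (by positivity) trace_nonneg
  positivity

/-- The weighted Hardy inequality. -/
theorem hardy_inequality (hN : 3 ≤ N) (ha : Function.Injective a) {c : ℝ} (hc : 0 ≤ c)
    (hc' : c ≤ cO N) {u : L2 A a} (hu : u ∈ H1 A a) :
    c * ∫ x, potential 1 a x * (u x * u x) ∂gaussMeasure A a ≤
      c / cO N * ‖weakGrad A a u‖ ^ 2 + hardyConst A a c 8 * ‖u‖ ^ 2 := by
  have h0 := cO_pos hN
  have h1 := mul_le_mul_of_nonneg_left (hardy_aux hN ha hu).2 (div_nonneg hc h0.le)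
  have h2 := mul_le_mul_of_nonneg_right (hardyConst_scale (A := A) (a := a) hc' hN) (sq_nonneg ‖u‖)
  rw [← mul_assoc, div_mul_cancel₀ _ h0.ne', mul_add] at h1
  linarith

end HardyInequality

/-! ### The Dirichlet and Hardy forms -/

section Forms

/-- The identity `b(u, φ) = ⟨v, φ⟩` passes to limits in `φ`, so the operator of the closure extends
the operator of the form. -/
theorem FormOn.IsClosureOf.assoc {H : Type*} [NormedAddCommGroup H] [InnerProductSpace ℝ H]
    {b c : FormOn H} (h : c.IsClosureOf b) (hb : b.IsForm) {u v : H} (huv : b.Assoc u v) :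
    c.Assoc u v := by
  refine ⟨h.subset hb huv.1, fun φ hφ => ?_⟩
  obtain ⟨w, hw⟩ := (h.1 φ).1 hφ
  have h1 := h.2 u φ _ w (FormOn.approx_const hb huv.1) hw
  have h2 : Tendsto (fun n => inner ℝ v (w n)) atTop (𝓝 (inner ℝ v φ)) :=
    tendsto_const_nhds.inner hw.2.1
  exact tendsto_nhds_unique h1 (h2.congr fun n => (huv.2 _ (hw.1 n)).symm)

variable {N n : ℕ} {A : Matrix (Fin N) (Fin N) ℝ} {a : Fin n → E N} [hA : Fact A.PosDef] [NeZero n]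

/-- A perturbation of the form `∫ ∇u · ∇v dμ` by a symmetric bilinear expression is a form. -/
theorem isForm_of_val {b : FormOn (L2 A a)} (hd : b.domain = H1 A a) {P : L2 A a → L2 A a → ℝ}
    (hval : ∀ u ∈ H1 A a, ∀ v ∈ H1 A a,
      b.val u v = inner ℝ (weakGrad A a u) (weakGrad A a v) - P u v)
    (hadd : ∀ u ∈ H1 A a, ∀ v ∈ H1 A a, ∀ w ∈ H1 A a, P (u + v) w = P u w + P v w)
    (hsmul : ∀ r : ℝ, ∀ u ∈ H1 A a, ∀ w ∈ H1 A a, P (r • u) w = r * P u w)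
    (hsymm : ∀ u v, P u v = P v u) : b.IsForm := by
  unfold FormOn.IsForm
  rw [hd]
  refine ⟨⟨zero_mem_H1, fun u hu v hv => add_mem_H1 hu hv, fun r u hu => smul_mem_H1 r hu⟩,
    fun u hu v hv w hw => ?_, fun r u hu w hw => ?_, fun u hu w hw => ?_⟩
  · rw [hval _ (add_mem_H1 hu hv) _ hw, hval _ hu _ hw, hval _ hv _ hw, weakGrad_add hu hv,
      inner_add_left, hadd _ hu _ hv _ hw]
    ring
  · rw [hval _ (smul_mem_H1 r hu) _ hw, hval _ hu _ hw, weakGrad_smul r hu, real_inner_smul_left,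
      hsmul r _ hu _ hw]
    ring
  · rw [hval _ hu _ hw, hval _ hw _ hu, real_inner_comm, hsymm]

/-- A form on `H¹_μ` that is comparable with `∫ |∇u|² dμ` is closed. -/
theorem isClosed_of_bounds {b : FormOn (L2 A a)} (hd : b.domain = H1 A a) {α C : ℝ} (hα : 0 < α)
    (hlow : ∀ u ∈ H1 A a, α * ‖weakGrad A a u‖ ^ 2 ≤ b.val u u + C * ‖u‖ ^ 2)
    (hup : ∀ u ∈ H1 A a, b.val u u ≤ ‖weakGrad A a u‖ ^ 2) : b.IsClosed := by
  intro u x ⟨hmem, hlim, hc⟩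
  rw [hd] at hmem
  have hdiff : Tendsto (fun p : ℕ × ℕ => ‖u p.1 - u p.2‖ ^ 2) atTop (𝓝 0) := by
    have h1 := ((hlim.comp tendsto_fst).sub (hlim.comp tendsto_snd)).norm.pow 2
    rw [prod_atTop_atTop_eq] at h1
    simpa using h1
  have hg : Tendsto (fun p : ℕ × ℕ => ‖weakGrad A a (u p.1) - weakGrad A a (u p.2)‖ ^ 2)
      atTop (𝓝 0) := by
    have h1 := (hc.add (hdiff.const_mul C)).div_const α
    rw [mul_zero, add_zero, zero_div] at h1
    refine squeeze_zero (fun _ => sq_nonneg _) (fun p => ?_) h1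
    rw [← weakGrad_sub (hmem _) (hmem _), le_div_iff₀' hα]
    exact hlow _ (sub_mem_H1 (hmem _) (hmem _))
  have hcau : CauchySeq fun k => weakGrad A a (u k) := by
    rw [cauchySeq_iff_tendsto_dist_atTop_0]
    have h1 := hg.sqrt
    simpa [Real.sqrt_sq, dist_eq_norm] using h1
  obtain ⟨g, hgl⟩ := cauchySeq_tendsto_of_complete hcau
  have hgr : IsWeakGradient x g := isClosed_gradGraph.mem_of_tendsto (hlim.prodMk_nhds hgl)
    (Eventually.of_forall fun k => isWeakGradient_weakGrad (hmem k))
  have hx : x ∈ H1 A a := ⟨g, hgr⟩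
  refine ⟨hd ▸ hx, ?_⟩
  have h0 : Tendsto (fun k => ‖weakGrad A a (u k - x)‖ ^ 2) atTop (𝓝 0) := by
    have h1 := (hgl.sub_const g).norm.pow 2
    rw [sub_self, norm_zero, zero_pow two_ne_zero] at h1
    refine h1.congr fun k => ?_
    rw [weakGrad_sub (hmem k) hx, weakGrad_eq hgr]
  have h2 : Tendsto (fun k => -(C * ‖u k - x‖ ^ 2)) atTop (𝓝 0) := by
    have h1 := (((hlim.sub_const x).norm.pow 2).const_mul C).neg
    simpa using h1
  refine tendsto_of_tendsto_of_tendsto_of_le_of_le h2 h0 (fun k => ?_)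
    fun k => hup _ (sub_mem_H1 (hmem k) hx)
  have h3 := hlow _ (sub_mem_H1 (hmem k) hx)
  have h4 := mul_nonneg hα.le (sq_nonneg ‖weakGrad A a (u k - x)‖)
  dsimp only
  linarith

/-! ### The forms `a_c` -/

theorem isForm_hardyForm (hN : 3 ≤ N) (ha : Function.Injective a) (c : ℝ) : (hardyForm A a c).IsForm := by
  refine isForm_of_val rfl (P := fun u v => c * ∫ x, potential 1 a x * (u x * v x) ∂gaussMeasure A a)
    (fun u hu v hv => hardyForm_val hN ha c hu hv) (fun u hu v hv w hw => ?_)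
    (fun r u hu w hw => ?_) fun u v => ?_
  · rw [← mul_add, ← integral_add (integrable_potential_mul hN ha hu hw)
      (integrable_potential_mul hN ha hv hw)]
    congr 1
    refine integral_congr_ae ?_
    filter_upwards [Lp.coeFn_add u v] with x hx
    rw [hx, Pi.add_apply]
    ring
  · rw [mul_left_comm, ← integral_const_mul r]
    congr 1
    refine integral_congr_ae ?_
    filter_upwards [Lp.coeFn_smul r u] with x hx
    rw [hx, Pi.smul_apply, smul_eq_mul]
    ring
  · simp only [mul_comm (u _)]

theorem integral_potential_nonneg (u : L2 A a) :
    0 ≤ ∫ x, potential 1 a x * (u x * u x) ∂gaussMeasure A a :=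
  integral_nonneg fun x => mul_nonneg (potential_nonneg zero_le_one x) (mul_self_nonneg _)

theorem hardyForm_lower (hN : 3 ≤ N) (ha : Function.Injective a)
    {c : ℝ} (hc : 0 ≤ c) (hc' : c ≤ cO N) {u : L2 A a} (hu : u ∈ H1 A a) :
    (1 - c / cO N) * ‖weakGrad A a u‖ ^ 2 ≤
      (hardyForm A a c).val u u + hardyConst A a c 8 * ‖u‖ ^ 2 := by
  rw [hardyForm_val hN ha c hu hu, real_inner_self_eq_norm_sq]
  have := hardy_inequality hN ha hc hc' hu
  linarith

theorem hardyForm_upper (hN : 3 ≤ N) (ha : Function.Injective a)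
    {c : ℝ} (hc : 0 ≤ c) {u : L2 A a} (hu : u ∈ H1 A a) :
    (hardyForm A a c).val u u ≤ ‖weakGrad A a u‖ ^ 2 := by
  rw [hardyForm_val hN ha c hu hu, real_inner_self_eq_norm_sq]
  have := mul_nonneg hc (integral_potential_nonneg u)
  linarith

theorem isSemibounded_hardyForm (hN : 3 ≤ N) (ha : Function.Injective a) {c : ℝ} (hc : 0 ≤ c) (hc' : c ≤ cO N) :
    (hardyForm A a c).IsSemibounded (hardyConst A a c 8) := by
  intro u hu
  have h1 := hardyForm_lower hN ha hc hc' hu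
  have h2 : 0 ≤ (1 - c / cO N) * ‖weakGrad A a u‖ ^ 2 :=
    mul_nonneg (sub_nonneg.2 ((div_le_one (cO_pos hN)).2 hc')) (sq_nonneg _)
  linarith

theorem isClosed_hardyForm (hN : 3 ≤ N) (ha : Function.Injective a)
    {c : ℝ} (hc : 0 ≤ c) (hc' : c < cO N) : (hardyForm A a c).IsClosed :=
  isClosed_of_bounds rfl (sub_pos.2 ((div_lt_one (cO_pos hN)).2 hc'))
    (fun _ hu => hardyForm_lower hN ha hc hc'.le hu) fun _ hu => hardyForm_upper hN ha hc hu

/-! ### Test functions in the operator domain -/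

theorem dirichletForm_assoc_test {φ : E N → ℝ} (hφ : ContDiff ℝ ∞ φ) (hc : HasCompactSupport φ)
    {u v : L2 A a} (hu : u =ᵐ[gaussMeasure A a] φ)
    (hv : v =ᵐ[gaussMeasure A a] fun x => -ouOp A a φ x) : (dirichletForm A a).Assoc u v := by
  obtain rfl : u = testFun A a φ (hφ.of_le (by simp)) hc := Lp.ext (hu.trans (coeFn_testFun _ _).symm)
  refine ⟨testFun_mem_H1 _ _, fun ψ hψ => ?_⟩
  rw [dirichletForm_val, weakGrad_testFun,
    inner_testGrad_weakGrad hφ hc (isWeakGradient_weakGrad hψ), L2.inner_def, ← integral_neg]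
  refine integral_congr_ae ?_
  filter_upwards [hv] with x hx
  rw [hx]
  simp
  ring

theorem hardyForm_assoc_test (hN : 3 ≤ N) (ha : Function.Injective a)
    {c : ℝ} {φ : E N → ℝ} (hφ : ContDiff ℝ ∞ φ) (hc : HasCompactSupport φ)
    {u v : L2 A a} (hu : u =ᵐ[gaussMeasure A a] φ)
    (hv : v =ᵐ[gaussMeasure A a] fun x => -(ouOp A a φ x + potential c a x * φ x)) :
    (hardyForm A a c).Assoc u v := by
  obtain rfl : u = testFun A a φ (hφ.of_le (by simp)) hc := Lp.ext (hu.trans (coeFn_testFun _ _).symm)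
  have huH : testFun A a φ (hφ.of_le (by simp)) hc ∈ H1 A a := testFun_mem_H1 _ _
  refine ⟨huH, fun ψ hψ => ?_⟩
  rw [hardyForm_val hN ha c huH hψ, weakGrad_testFun,
    inner_testGrad_weakGrad hφ hc (isWeakGradient_weakGrad hψ), L2.inner_def]
  have i1 := L2.integrable_inner (𝕜 := ℝ) v ψ
  have i2 := (integrable_potential_mul hN ha huH hψ).const_mul c
  have e : ∫ x, ouOp A a φ x * ψ x ∂gaussMeasure A a = ∫ x, (-inner ℝ (v x) (ψ x) -
      c * (potential 1 a x * (testFun A a φ (hφ.of_le (by simp)) hc x * ψ x))) ∂gaussMeasure A a := by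
    refine integral_congr_ae ?_
    filter_upwards [hv, hu] with x hx hx'
    rw [hx, hx', potential_eq]
    simp
    ring
  rw [e, integral_sub i1.fun_neg i2, integral_neg, integral_const_mul]
  ring

theorem ouOp_eq_zero {φ : E N → ℝ} (hφ : ContDiff ℝ ∞ φ) {x : E N} (hx : x ∉ tsupport φ) :
    ouOp A a φ x = 0 := by
  have h := ouOp_eq (A := A) (a := a) hφ x
  rw [Finset.sum_eq_zero fun l _ => ?_] at h
  · exact (mul_eq_zero.1 h).resolve_left (density_pos x).ne'
  · rw [fderiv_of_notMem_tsupport ℝ, zero_apply]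
    exact fun h' => hx (tsupport_fderiv_apply_subset ℝ _ (tsupport_mul_subset_right h'))

theorem continuous_ouOp {φ : E N → ℝ} (hφ : ContDiff ℝ ∞ φ) : Continuous (ouOp A a φ) := by
  have h : ouOp A a φ = fun x => (density A a x)⁻¹ * ∑ l, fderiv ℝ (fun y => density A a y *
      fderiv ℝ φ y (EuclideanSpace.basisFun (Fin N) ℝ l)) x
      (EuclideanSpace.basisFun (Fin N) ℝ l) := by
    ext x
    rw [← ouOp_eq hφ, inv_mul_cancel_left₀ (density_pos x).ne']
  rw [h]
  refine (continuous_density.inv₀ fun x => (density_pos x).ne').mul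
    (continuous_finsetSum _ fun l _ => ?_)
  exact continuous_fderiv_apply (contDiff_density.mul
    ((hφ.fderiv_right (m := ∞) (by simp)).clm_apply contDiff_const)) _

theorem continuous_potential_mul {N n : ℕ} {a : Fin n → E N} {φ : E N → ℝ} (hφ : Continuous φ) (hs : ∀ i, a i ∉ tsupport φ)
    (c : ℝ) : Continuous fun x => potential c a x * φ x := by
  refine continuous_iff_continuousAt.2 fun x => ?_
  by_cases hx : x ∈ tsupport φ
  · have hne : ∀ i, x ≠ a i := fun i h => hs i (h ▸ hx)
    refine ContinuousAt.mul ?_ hφ.continuousAt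
    refine tendsto_finsetSum _ fun i _ => ?_
    have : ContinuousAt (fun y => c / ‖y - a i‖ ^ 2) x := by
      refine ContinuousAt.div continuousAt_const (by fun_prop) ?_
      have := norm_pos_iff.2 (sub_ne_zero.2 (hne i))
      positivity
    exact this
  · refine (continuousAt_const (y := (0 : ℝ))).congr ?_
    filter_upwards [notMem_tsupport_iff_eventuallyEq.1 hx] with y hy
    simp [hy]

theorem exists_hardyForm_assoc_test (hN : 3 ≤ N) (ha : Function.Injective a) {c : ℝ} {φ : E N → ℝ} (hφ : ContDiff ℝ ∞ φ)
    (hc : HasCompactSupport φ) (hs : ∀ i, a i ∉ tsupport φ) :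
    ∃ v, (hardyForm A a c).Assoc (testFun A a φ (hφ.of_le (by simp)) hc) v := by
  have h1 : Continuous fun x => -(ouOp A a φ x + potential c a x * φ x) :=
    ((continuous_ouOp hφ).add (continuous_potential_mul hφ.continuous hs c)).neg
  have h2 : HasCompactSupport fun x => -(ouOp A a φ x + potential c a x * φ x) :=
    HasCompactSupport.intro hc fun x hx => by
      rw [ouOp_eq_zero hφ hx, image_eq_zero_of_notMem_tsupport hx]
      simp
  exact ⟨(memLp_of_compact h1 h2).toLp _, hardyForm_assoc_test hN ha hφ hc (coeFn_testFun _ _)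
    (MemLp.coeFn_toLp _)⟩

/-- For test functions vanishing near the poles, `V φ` is continuous with compact support, so they
lie in the operator domain. They are dense for the form: their form distance to `u` lies between `-K
‖·‖²` and the squared norm of the gradient difference, both tending to zero. -/
theorem isClosable_hardyForm (hN : 3 ≤ N) (ha : Function.Injective a) : (hardyForm A a (cO N)).IsClosable := by
  have hK := isSemibounded_hardyForm (A := A) hN ha (cO_pos hN).le le_rfl
  refine FormOn.isClosable_of_dense_operator_domain (isForm_hardyForm hN ha _) hK fun u hu => ?_
  obtain ⟨φ, hφ, hc, hs, h1, h2⟩ := exists_seq_testFun hN hu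
  refine ⟨_, fun k => exists_hardyForm_assoc_test hN ha (hφ k) (hc k) (hs k), h1, ?_⟩
  have hm : ∀ k, testFun A a (φ k) ((hφ k).of_le (by simp)) (hc k) - u ∈ H1 A a := fun k =>
    sub_mem_H1 (testFun_mem_H1 _ _) hu
  have t1 : Tendsto (fun k => -hardyConst A a (cO N) 8 *
      ‖testFun A a (φ k) ((hφ k).of_le (by simp)) (hc k) - u‖ ^ 2) atTop (𝓝 0) := by
    have := ((h1.sub_const u).norm.pow 2).const_mul (-hardyConst A a (cO N) 8)
    simpa using this
  have t2 : Tendsto (fun k => ‖weakGrad A a (testFun A a (φ k) ((hφ k).of_le (by simp)) (hc k) - u)‖ ^ 2)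
      atTop (𝓝 0) := by
    have h3 := (h2.sub_const (weakGrad A a u)).norm.pow 2
    rw [sub_self, norm_zero, zero_pow two_ne_zero] at h3
    refine h3.congr fun k => ?_
    rw [weakGrad_sub (testFun_mem_H1 _ _) hu, weakGrad_testFun]
  exact tendsto_of_tendsto_of_tendsto_of_le_of_le t1 t2 (fun k => hK _ (hm k))
    fun k => hardyForm_upper hN ha (cO_pos hN).le (hm k)

/-- The closure of `a_c` for `0 < c ≤ c_o`. -/
theorem exists_closure_hardyForm (hN : 3 ≤ N) (ha : Function.Injective a) {c : ℝ} (hc : 0 ≤ c) (hc' : c ≤ cO N) :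
    ∃ b : FormOn (L2 A a), (c < cO N → b = hardyForm A a c) ∧ b.IsClosureOf (hardyForm A a c) ∧
      b.IsForm ∧ b.IsClosed := by
  have hF := isForm_hardyForm (A := A) hN ha c
  have hK := isSemibounded_hardyForm (A := A) hN ha hc hc'
  rcases hc'.lt_or_eq with h | rfl
  · have hcl := isClosed_hardyForm (A := A) hN ha hc h
    exact ⟨_, fun _ => rfl, hcl.isClosureOf_self hF hK, hF, hcl⟩
  · obtain ⟨b, h1, h2, h3⟩ := FormOn.exists_closure hF hK (isClosable_hardyForm hN ha)
    exact ⟨b, fun h => (lt_irrefl _ h).elim, h1, h2, h3⟩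

end Forms

/-! ### The weak maximum principle -/

section Positivity

variable {N n : ℕ} {A : Matrix (Fin N) (Fin N) ℝ} {a : Fin n → E N} [hA : Fact A.PosDef] [NeZero n]

/-- A nonincreasing `C¹` function with bounded derivative, positive exactly on the negative
half-line. -/
def negPart (t : ℝ) : ℝ := Real.sqrt (1 + posSq (-t)) - 1

theorem one_add_posSq_pos (t : ℝ) : 0 < 1 + posSq t := by
  have : 0 ≤ posSq t := sq_nonneg _
  linarith

theorem hasDerivAt_negPart (t : ℝ) :
    HasDerivAt negPart (-(max (-t) 0 / Real.sqrt (1 + posSq (-t)))) t := by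
  have h1 := (hasDerivAt_posSq (-t)).comp t (hasDerivAt_neg t)
  have h2 := ((h1.const_add 1).sqrt (one_add_posSq_pos _).ne').sub_const 1
  refine h2.congr_deriv ?_
  have := Real.sqrt_pos.2 (one_add_posSq_pos (-t))
  simp only [Function.comp_apply]
  field_simp

theorem deriv_negPart_nonpos (t : ℝ) : deriv negPart t ≤ 0 := by
  rw [(hasDerivAt_negPart t).deriv]
  exact neg_nonpos.2 (div_nonneg (le_max_right _ _) (Real.sqrt_nonneg _))

theorem abs_deriv_negPart_le (t : ℝ) : |deriv negPart t| ≤ 1 := by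
  have h0 : 0 ≤ max (-t) 0 := le_max_right _ _
  rw [(hasDerivAt_negPart t).deriv, abs_neg, abs_of_nonneg (div_nonneg h0 (Real.sqrt_nonneg _)),
    div_le_one (Real.sqrt_pos.2 (one_add_posSq_pos _))]
  refine Real.le_sqrt_of_sq_le ?_
  simp [posSq]

theorem contDiff_negPart : ContDiff ℝ 1 negPart := by
  unfold negPart
  refine ContDiff.sub (ContDiff.sqrt (contDiff_const.add (contDiff_posSq.comp contDiff_neg))
    fun t => (one_add_posSq_pos _).ne') contDiff_const

theorem negPart_of_nonneg {t : ℝ} (ht : 0 ≤ t) : negPart t = 0 := by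
  simp [negPart, posSq, ht]

theorem negPart_nonneg (t : ℝ) : 0 ≤ negPart t := by
  rw [negPart, sub_nonneg, Real.one_le_sqrt]
  have : 0 ≤ posSq (-t) := sq_nonneg _
  linarith

theorem negPart_pos {t : ℝ} (ht : t < 0) : 0 < negPart t := by
  rw [negPart, sub_pos, Real.lt_sqrt zero_le_one]
  have : 0 < posSq (-t) := by
    rw [posSq, max_eq_left (by linarith)]
    exact pow_pos (by linarith) 2
  linarith

theorem negPart_zero : negPart 0 = 0 := negPart_of_nonneg le_rfl

theorem lipschitzWith_negPart : LipschitzWith 1 negPart :=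
  lipschitzWith_of_nnnorm_deriv_le (contDiff_negPart.differentiable (by simp)) fun t =>
    NNReal.coe_le_coe.1 (by simpa using abs_deriv_negPart_le t)

theorem gradient_comp {ψ : ℝ → ℝ} {φ : E N → ℝ} {x : E N} (hψ : DifferentiableAt ℝ ψ (φ x))
    (hφ : DifferentiableAt ℝ φ x) :
    gradient (fun y => ψ (φ y)) x = deriv ψ (φ x) • gradient φ x := by
  have h := (hψ.hasDerivAt.comp_hasFDerivAt x hφ.hasFDerivAt).fderiv
  rw [gradient, gradient, show (fun y => ψ (φ y)) = ψ ∘ φ from rfl, h, map_smulₛₗ, conj_trivial]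

/-- The weak maximum principle. -/
theorem nonneg_of_weak_solution (hN : 3 ≤ N) {q : E N → ℝ} (hq : Measurable q) {C : ℝ}
    (hC : ∀ x, |q x| ≤ C) (hq0 : ∀ x, 0 < q x) {u g : L2 A a} (hu : u ∈ H1 A a) (hg : 0 ≤ g)
    (h : ∀ φ ∈ H1 A a, inner ℝ (weakGrad A a u) (weakGrad A a φ) +
      inner ℝ (mulOp (gaussMeasure A a) q hq C hC u) φ = inner ℝ g φ) : 0 ≤ u := by
  obtain ⟨φ, hφ, hc, -, h1, h2⟩ := exists_seq_testFun hN hu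
  have hφ1 : ∀ k, ContDiff ℝ 1 (φ k) := fun k => (hφ k).of_le (by simp)
  have hψ : ∀ k, ContDiff ℝ 1 fun x => negPart (φ k x) := fun k => contDiff_negPart.comp (hφ1 k)
  have hψc : ∀ k, HasCompactSupport fun x => negPart (φ k x) := fun k =>
    (hc k).comp_left negPart_zero
  set T := fun k => testFun A a (φ k) (hφ1 k) (hc k) with hT
  set G := fun k => testGrad A a (φ k) (hφ1 k) (hc k) with hG
  set Ψ := fun k => testFun A a _ (hψ k) (hψc k) with hΨ
  set Γ := fun k => testGrad A a _ (hψ k) (hψc k) with hΓ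
  have hgrad : ∀ k x, gradient (fun x => negPart (φ k x)) x =
      deriv negPart (φ k x) • gradient (φ k) x := fun k x =>
    gradient_comp ((contDiff_negPart.differentiable (by simp)).differentiableAt)
      (((hφ1 k).differentiable (by simp)).differentiableAt)
  -- The chain rule is needed only for the smooth approximants: `∇φ · ∇(negPart ∘ φ)` is `|∇φ|²`
  -- times a nonpositive derivative.
  have hGΓ : ∀ k, inner ℝ (G k) (Γ k) ≤ 0 := fun k => by
    rw [L2.inner_def]
    refine integral_nonpos_of_ae ?_
    filter_upwards [coeFn_testGrad (A := A) (a := a) (hφ1 k) (hc k),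
      coeFn_testGrad (A := A) (a := a) (hψ k) (hψc k)] with x hx hx'
    simp only [hG, hΓ, hx, hx', hgrad, real_inner_smul_right, real_inner_self_eq_norm_sq,
      Pi.zero_apply]
    exact mul_nonpos_of_nonpos_of_nonneg (deriv_negPart_nonpos _) (sq_nonneg _)
  have hΓn : ∀ k, ‖Γ k‖ ≤ ‖G k‖ := fun k => by
    refine Lp.norm_le_norm_of_ae_le ?_
    filter_upwards [coeFn_testGrad (A := A) (a := a) (hφ1 k) (hc k),
      coeFn_testGrad (A := A) (a := a) (hψ k) (hψc k)] with x hx hx'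
    simp only [hG, hΓ, hx, hx', hgrad, norm_smul]
    exact mul_le_of_le_one_left (norm_nonneg _) (abs_deriv_negPart_le _)
  have hΨe : ∀ k, Ψ k = lipschitzWith_negPart.compLp negPart_zero (T k) := fun k => by
    refine Lp.ext ?_
    filter_upwards [coeFn_testFun (A := A) (a := a) (hφ1 k) (hc k),
      coeFn_testFun (A := A) (a := a) (hψ k) (hψc k),
      lipschitzWith_negPart.coeFn_compLp negPart_zero (T k)] with x hx hx' hx''
    rw [hx'', Function.comp_apply]
    simp only [hΨ, hT, hx, hx']
  set v := lipschitzWith_negPart.compLp negPart_zero u with hv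
  have hΨl : Tendsto Ψ atTop (𝓝 v) := by
    have := ((lipschitzWith_negPart.continuous_compLp (μ := gaussMeasure A a) (p := 2)
      negPart_zero).tendsto u).comp h1
    exact this.congr fun k => (hΨe k).symm
  set z := g - mulOp (gaussMeasure A a) q hq C hC u with hz
  -- The equation is tested with `Ψ k` instead of `negPart u`. The error of replacing `∇u` by `G k`
  -- is at most `‖∇u - G k‖ ‖G k‖`, since `negPart` is 1-Lipschitz.
  have hle : inner ℝ z v ≤ 0 := by
    have l1 : Tendsto (fun k => inner ℝ z (Ψ k)) atTop (𝓝 (inner ℝ z v)) :=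
      tendsto_const_nhds.inner hΨl
    have l2 : Tendsto (fun k => ‖weakGrad A a u - G k‖ * ‖G k‖) atTop (𝓝 0) := by
      have := (h2.const_sub (weakGrad A a u)).norm.mul h2.norm
      rwa [sub_self, norm_zero, zero_mul] at this
    refine le_of_tendsto_of_tendsto' l1 l2 fun k => ?_
    have h3 := h (Ψ k) (testFun_mem_H1 _ _)
    rw [hΨ, weakGrad_testFun] at h3
    have h4 : inner ℝ z (Ψ k) = inner ℝ (weakGrad A a u) (Γ k) := by
      rw [hz, inner_sub_left, ← h3]
      simp only [hΓ]
      ring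
    have h5 : inner ℝ (weakGrad A a u) (Γ k) =
        inner ℝ (G k) (Γ k) + inner ℝ (weakGrad A a u - G k) (Γ k) := by
      rw [inner_sub_left]; ring
    have h6 := (real_inner_le_norm (weakGrad A a u - G k) (Γ k)).trans
      (mul_le_mul_of_nonneg_left (hΓn k) (norm_nonneg _))
    rw [h4, h5]
    linarith [hGΓ k]
  have hzv : ∀ᵐ x ∂gaussMeasure A a, z x * v x = (g x - q x * u x) * negPart (u x) := by
    filter_upwards [Lp.coeFn_sub g (mulOp (gaussMeasure A a) q hq C hC u), coeFn_mulOp hq hC u,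
      lipschitzWith_negPart.coeFn_compLp negPart_zero u] with x hx hx' hx''
    rw [hz, hx, Pi.sub_apply, hx', hv, hx'', Function.comp_apply]
  have hg' := (Lp.coeFn_nonneg g).2 hg
  -- Pointwise the sign is the opposite one, strictly so where `u < 0`; with `hle` the product
  -- vanishes almost everywhere, which excludes negative values.
  have hnn : ∀ᵐ x ∂gaussMeasure A a, 0 ≤ z x * v x := by
    filter_upwards [hzv, hg'] with x hx hx'
    rw [hx]
    rcases le_or_gt 0 (u x) with h0 | h0
    · rw [negPart_of_nonneg h0, mul_zero]
    · refine mul_nonneg ?_ (negPart_nonneg _)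
      have := mul_neg_of_pos_of_neg (hq0 x) h0
      have h7 : 0 ≤ g x := hx'
      linarith
  have hint : Integrable (fun x => z x * v x) (gaussMeasure A a) :=
    (Lp.memLp z).integrable_mul (Lp.memLp v)
  have hzero : ∫ x, z x * v x ∂gaussMeasure A a = 0 := by
    refine le_antisymm ?_ (integral_nonneg_of_ae hnn)
    rw [L2.inner_def] at hle
    simpa [mul_comm] using hle
  rw [integral_eq_zero_iff_of_nonneg_ae hnn hint] at hzero
  rw [← Lp.coeFn_nonneg]
  filter_upwards [hzero, hzv, hg'] with x hx hx' hx''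
  rw [hx'] at hx
  by_contra h0
  have h0' : u x < 0 := not_le.1 h0
  have h8 := mul_neg_of_pos_of_neg (hq0 x) h0'
  have h7 : 0 ≤ g x := hx''
  have h9 := mul_pos (show 0 < g x - q x * u x by linarith) (negPart_pos h0')
  exact h9.ne' hx

end Positivity

/-! ### The forms with truncated potential -/

section CutForm

variable {N n : ℕ} {A : Matrix (Fin N) (Fin N) ℝ} {a : Fin n → E N} [hA : Fact A.PosDef] [NeZero n]

variable (a) in
/-- The potential `V` cut off at the level `c j`. -/
def cutPotential (c : ℝ) (j : ℕ) (x : E N) : ℝ := min (potential c a x) (c * j)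

theorem measurable_cutPotential (c : ℝ) (j : ℕ) : Measurable (cutPotential a c j) :=
  (measurable_potential c).min measurable_const

theorem cutPotential_nonneg {c : ℝ} (hc : 0 ≤ c) (j : ℕ) (x : E N) : 0 ≤ cutPotential a c j x :=
  le_min (potential_nonneg hc x) (by positivity)

theorem cutPotential_le (c : ℝ) (j : ℕ) (x : E N) : cutPotential a c j x ≤ c * j := min_le_right _ _

theorem abs_cutPotential_le {c : ℝ} (hc : 0 ≤ c) (j : ℕ) (x : E N) :
    |cutPotential a c j x| ≤ c * j := by
  rw [abs_of_nonneg (cutPotential_nonneg hc j x)]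
  exact cutPotential_le c j x

theorem cutPotential_le_succ {c : ℝ} (hc : 0 ≤ c) (j : ℕ) (x : E N) :
    cutPotential a c j x ≤ cutPotential a c (j + 1) x := by
  refine min_le_min_left _ ?_
  push_cast
  linarith

variable (A a) in
/-- Multiplication by the cut-off potential. -/
def cutOp {c : ℝ} (hc : 0 ≤ c) (j : ℕ) : L2 A a →L[ℝ] L2 A a :=
  mulOp (gaussMeasure A a) (cutPotential a c j) (measurable_cutPotential c j) (c * j)
    (abs_cutPotential_le hc j)

theorem coeFn_cutOp {c : ℝ} (hc : 0 ≤ c) (j : ℕ) (u : L2 A a) :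
    cutOp A a hc j u =ᵐ[gaussMeasure A a] fun x => cutPotential a c j x * u x :=
  coeFn_mulOp _ _ u

theorem inner_cutOp {c : ℝ} (hc : 0 ≤ c) (j : ℕ) (u v : L2 A a) : inner ℝ (cutOp A a hc j u) v =
    ∫ x, cutPotential a c j x * (u x * v x) ∂gaussMeasure A a := inner_mulOp _ _ u v

variable (A a) in
/-- The form `∫ ∇u · ∇v dμ - ∫ min(V, c j) u v dμ`. -/
def cutForm {c : ℝ} (hc : 0 ≤ c) (j : ℕ) : FormOn (L2 A a) where
  domain := H1 A a
  val u v := inner ℝ (weakGrad A a u) (weakGrad A a v) - inner ℝ (cutOp A a hc j u) v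

theorem isForm_cutForm {c : ℝ} (hc : 0 ≤ c) (j : ℕ) : (cutForm A a hc j).IsForm := by
  refine isForm_of_val rfl (P := fun u v => inner ℝ (cutOp A a hc j u) v) (fun _ _ _ _ => rfl)
    (fun u _ v _ w _ => ?_) (fun r u _ w _ => ?_) fun u v => ?_
  · rw [map_add, inner_add_left]
  · rw [map_smul, real_inner_smul_left]
  · simp only [inner_cutOp, mul_comm (u _)]

theorem cutForm_upper {c : ℝ} (hc : 0 ≤ c) (j : ℕ) (u : L2 A a) :
    (cutForm A a hc j).val u u ≤ ‖weakGrad A a u‖ ^ 2 := by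
  have h : 0 ≤ inner ℝ (cutOp A a hc j u) u := by
    rw [inner_cutOp]
    exact integral_nonneg fun x => mul_nonneg (cutPotential_nonneg hc j x) (mul_self_nonneg _)
  simp only [cutForm, real_inner_self_eq_norm_sq]
  linarith

theorem isClosed_cutForm {c : ℝ} (hc : 0 ≤ c) (j : ℕ) : (cutForm A a hc j).IsClosed := by
  refine isClosed_of_bounds rfl one_pos (C := ‖cutOp A a hc j‖) (fun u _ => ?_)
    fun u _ => cutForm_upper hc j u
  have h := (real_inner_le_norm (cutOp A a hc j u) u).trans
    (mul_le_mul_of_nonneg_right ((cutOp A a hc j).le_opNorm u) (norm_nonneg u))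
  simp only [cutForm, real_inner_self_eq_norm_sq]
  rw [mul_assoc, ← sq] at h
  linarith

theorem hardyForm_le_cutForm (hN : 3 ≤ N) (ha : Function.Injective a) {c : ℝ} (hc : 0 ≤ c) (j : ℕ)
    {u : L2 A a} (hu : u ∈ H1 A a) : (hardyForm A a c).val u u ≤ (cutForm A a hc j).val u u := by
  rw [hardyForm_val hN ha c hu hu]
  simp only [cutForm, inner_cutOp]
  rw [← integral_const_mul]
  refine sub_le_sub_left (integral_mono (integrable_mulOp (measurable_cutPotential c j)
    (abs_cutPotential_le hc j) u u) ((integrable_potential_mul hN ha hu hu).const_mul c) fun x => ?_) _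
  dsimp only
  rw [← mul_assoc c, ← potential_eq]
  exact mul_le_mul_of_nonneg_right (min_le_left _ _) (mul_self_nonneg _)

theorem isSemibounded_cutForm (hN : 3 ≤ N) (ha : Function.Injective a) {c : ℝ} (hc : 0 ≤ c)
    (hc' : c ≤ cO N) (j : ℕ) : (cutForm A a hc j).IsSemibounded (hardyConst A a c 8) := fun _ hu =>
  (isSemibounded_hardyForm hN ha hc hc' _ hu).trans (hardyForm_le_cutForm hN ha hc j hu)

theorem tendsto_cutForm (hN : 3 ≤ N) (ha : Function.Injective a) {c : ℝ} (hc : 0 < c)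
    {u : L2 A a} (hu : u ∈ H1 A a) :
    Tendsto (fun j => (cutForm A a hc.le j).val u u) atTop (𝓝 ((hardyForm A a c).val u u)) := by
  rw [hardyForm_val hN ha c hu hu]
  simp only [cutForm, inner_cutOp]
  refine Tendsto.const_sub _ ?_
  rw [← integral_const_mul]
  have hi := (integrable_potential_mul hN ha hu hu).const_mul c
  refine tendsto_integral_of_dominated_convergence _ (fun j => (integrable_mulOp
    (measurable_cutPotential c j) (abs_cutPotential_le hc.le j) u u).1) hi
    (fun j => Eventually.of_forall fun x => ?_) (Eventually.of_forall fun x => ?_)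
  · rw [Real.norm_of_nonneg (mul_nonneg (cutPotential_nonneg hc.le j x) (mul_self_nonneg _)),
      ← mul_assoc c, ← potential_eq]
    exact mul_le_mul_of_nonneg_right (min_le_left _ _) (mul_self_nonneg _)
  · rw [← mul_assoc c, ← potential_eq]
    refine Tendsto.mul_const _ (tendsto_const_nhds.congr' ?_)
    filter_upwards [eventually_ge_atTop ⌈potential c a x / c⌉₊] with j hj
    have h1 := (Nat.le_ceil _).trans (Nat.cast_le (α := ℝ).2 hj)
    rw [div_le_iff₀' hc] at h1
    exact (min_eq_left h1).symm

theorem cutForm_assoc_iff {c : ℝ} (hc : 0 ≤ c) (j : ℕ) (u z : L2 A a) :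
    (cutForm A a hc j).Assoc u z ↔ (dirichletForm A a).Assoc u (z + cutOp A a hc j u) := by
  refine and_congr Iff.rfl (forall₂_congr fun φ _ => ?_)
  rw [dirichletForm_val, inner_add_left]
  exact sub_eq_iff_eq_add

/-- Subtracting a bounded multiplication does not change the operator domain, so the operator of the
truncated form is minus `L + min(V, cj)` on `D(L)`. -/
theorem cutForm_assoc_neg_iff {c : ℝ} (hc : 0 ≤ c) (j : ℕ) (u w : L2 A a) :
    (cutForm A a hc j).Assoc u (-w) ↔ ∃ v, (dirichletForm A a).Assoc u (-v) ∧
      w =ᵐ[gaussMeasure A a] fun x => v x + min (potential c a x) (c * j) * u x := by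
  rw [cutForm_assoc_iff]
  have key : ∀ v : L2 A a, (w =ᵐ[gaussMeasure A a] fun x => v x +
      min (potential c a x) (c * j) * u x) ↔ w = v + cutOp A a hc j u := fun v => by
    have h1 : (v + cutOp A a hc j u : L2 A a) =ᵐ[gaussMeasure A a] fun x => v x +
        min (potential c a x) (c * j) * u x := by
      filter_upwards [Lp.coeFn_add v (cutOp A a hc j u), coeFn_cutOp hc j u] with x hx hx'
      rw [hx, Pi.add_apply, hx']
      rfl
    exact ⟨fun h => Lp.ext (h.trans h1.symm), fun h => h ▸ h1⟩
  constructor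
  · intro h
    refine ⟨w - cutOp A a hc j u, ?_, (key _).2 (sub_add_cancel _ _).symm⟩
    rwa [neg_sub, sub_eq_neg_add]
  · rintro ⟨v, hv, hw⟩
    obtain rfl := (key v).1 hw
    rwa [neg_add, neg_add_cancel_right]

end CutForm

/-! ### Energy minimization and resolvent convergence -/

section Energy

variable {H : Type*} [NormedAddCommGroup H] [InnerProductSpace ℝ H]

theorem FormOn.IsForm.val_sub_sub {b : FormOn H} (h : b.IsForm) {u v : H} (hu : u ∈ b.domain)
    (hv : v ∈ b.domain) :
    b.val (v - u) (v - u) = b.val v v - 2 * b.val u v + b.val u u := by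
  have hn : -u ∈ b.domain := h.submodule.neg_mem hu
  have e : ∀ w ∈ b.domain, b.val (v - u) w = b.val v w - b.val u w := fun w hw => by
    have := h.2.2.1 (-1) u hu w hw
    rw [neg_one_smul] at this
    rw [sub_eq_add_neg, h.2.1 v hv _ hn w hw, this]
    ring
  rw [e _ (h.sub_mem hv hu), h.2.2.2 v hv _ (h.sub_mem hv hu), h.2.2.2 u hu _ (h.sub_mem hv hu),
    e v hv, e u hu, h.2.2.2 v hv u hu]
  ring

/-- The energy functional whose minimizer is the solution of `(𝒜 + λ) u = f`. -/
def FormOn.energy (b : FormOn H) (lam : ℝ) (f v : H) : ℝ :=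
  b.val v v + lam * ‖v‖ ^ 2 - 2 * inner ℝ f v

/-- The solution is a critical point of a quadratic functional, so the excess energy is exactly the
quadratic form of the deviation. -/
theorem FormOn.IsForm.energy_sub {b : FormOn H} (h : b.IsForm) {lam : ℝ} {f u v : H}
    (hu : b.Assoc u (f - lam • u)) (hv : v ∈ b.domain) :
    b.energy lam f v - b.energy lam f u = b.val (v - u) (v - u) + lam * ‖v - u‖ ^ 2 := by
  have h1 := hu.2 v hv
  have h2 := hu.2 u hu.1
  rw [inner_sub_left, real_inner_smul_left] at h1 h2
  rw [real_inner_self_eq_norm_sq] at h2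
  rw [h.val_sub_sub hu.1 hv, norm_sub_sq_real, h1, FormOn.energy, FormOn.energy,
    real_inner_comm u v]
  linarith

theorem FormOn.IsForm.sq_norm_sub_le {b : FormOn H} (h : b.IsForm) {K : ℝ}
    (hK : b.IsSemibounded K) {f u v : H} (hu : b.Assoc u (f - (K + 1) • u)) (hv : v ∈ b.domain) :
    ‖v - u‖ ^ 2 ≤ b.energy (K + 1) f v - b.energy (K + 1) f u := by
  rw [h.energy_sub hu hv]
  have := hK _ (h.sub_mem hv hu.1)
  linarith

/-- Resolvents of forms that decrease to `b` on a core converge strongly. -/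
theorem tendsto_of_energy {b h : FormOn H} {bj : ℕ → FormOn H} {K : ℝ}
    (hb : b.IsForm) (hbc : b.IsClosed) (hcl : b.IsClosureOf h) (hh : h.IsForm)
    (hK : b.IsSemibounded K) (hKj : ∀ j, (bj j).IsSemibounded K)
    (hbj : ∀ j, (bj j).IsForm) (hdom : ∀ j, (bj j).domain = h.domain)
    (hle : ∀ j, ∀ v ∈ h.domain, h.val v v ≤ (bj j).val v v)
    (hlim : ∀ v ∈ h.domain, Tendsto (fun j => (bj j).val v v) atTop (𝓝 (h.val v v)))
    {f u : H} {uj : ℕ → H} (hu : b.Assoc u (f - (K + 1) • u))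
    (huj : ∀ j, (bj j).Assoc (uj j) (f - (K + 1) • uj j)) : Tendsto uj atTop (𝓝 u) := by
  have hmem : ∀ j, uj j ∈ h.domain := fun j => hdom j ▸ (huj j).1
  -- Chain of inequalities: `‖uj - u‖²` is at most the excess energy of `uj` for `b`, this energy
  -- increases on passing to `bj`, and `uj` minimizes the latter. Afterwards `v` is taken close to
  -- `u` first, then `j` large.
  have key : ∀ v ∈ h.domain, ∀ j, ‖uj j - u‖ ^ 2 ≤
      (bj j).energy (K + 1) f v - b.energy (K + 1) f u := by
    intro v hv j
    have h1 := hb.sq_norm_sub_le hK hu (hcl.subset hh (hmem j))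
    have h2 := (hbj j).sq_norm_sub_le (hKj j) (huj j) (v := v) (by rw [hdom]; exact hv)
    have h3 := hle j _ (hmem j)
    have h4 : b.energy (K + 1) f (uj j) ≤ (bj j).energy (K + 1) f (uj j) := by
      rw [FormOn.energy, FormOn.energy, hcl.val_eq hh (hmem j) (hmem j)]
      linarith
    linarith [sq_nonneg ‖v - uj j‖]
  obtain ⟨w, hw⟩ := (hcl.1 u).1 hu.1
  have hwb : b.Approx w u := by
    refine ⟨fun n => hcl.subset hh (hw.1 n), hw.2.1, hw.2.2.congr fun p => ?_⟩
    have := hh.sub_mem (hw.1 p.1) (hw.1 p.2)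
    exact (hcl.val_eq hh this this).symm
  have hE : Tendsto (fun n => b.energy (K + 1) f (w n) - b.energy (K + 1) f u) atTop (𝓝 0) := by
    have h1 := (hbc w u hwb).2.add (((hw.2.1.sub_const u).norm.pow 2).const_mul (K + 1))
    rw [sub_self, norm_zero, zero_pow two_ne_zero, mul_zero, add_zero] at h1
    exact h1.congr fun n => (hb.energy_sub hu (hwb.1 n)).symm
  rw [tendsto_iff_norm_sub_tendsto_zero, Metric.tendsto_atTop]
  intro ε hε
  have hε2 : 0 < ε ^ 2 := pow_pos hε 2
  obtain ⟨n, hn⟩ := (hE.eventually_lt_const hε2).exists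
  have hj : Tendsto (fun j => (bj j).energy (K + 1) f (w n) - b.energy (K + 1) f u) atTop
      (𝓝 (b.energy (K + 1) f (w n) - b.energy (K + 1) f u)) := by
    refine Tendsto.sub_const ?_ _
    unfold FormOn.energy
    rw [hcl.val_eq hh (hw.1 n) (hw.1 n)]
    exact ((hlim _ (hw.1 n)).add_const _).sub_const _
  obtain ⟨J, hJ⟩ := eventually_atTop.1 (hj.eventually_lt_const hn)
  refine ⟨J, fun j hjJ => ?_⟩
  have h5 := (key _ (hw.1 n) j).trans_lt (hJ j hjJ)
  rw [Real.dist_0_eq_abs, abs_norm]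
  exact lt_of_pow_lt_pow_left₀ 2 hε.le h5

end Energy

/-! ### Comparison of the truncated resolvents -/

section Comparison

variable {N n : ℕ} {A : Matrix (Fin N) (Fin N) ℝ} {a : Fin n → E N} [hA : Fact A.PosDef] [NeZero n]

theorem smul_nonneg_of_nonneg_L2 {α : Type*} [MeasurableSpace α] {ν : Measure α} {r : ℝ}
    (hr : 0 ≤ r) {f : Lp ℝ 2 ν} (hf : 0 ≤ f) : 0 ≤ r • f := by
  rw [← Lp.coeFn_nonneg]
  filter_upwards [Lp.coeFn_smul r f, (Lp.coeFn_nonneg f).2 hf] with x h1 h2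
  rw [h1]
  exact mul_nonneg hr h2

/-- The weak maximum principle for the cut-off forms. -/
theorem nonneg_of_cutForm (hN : 3 ≤ N) {c : ℝ} (hc : 0 ≤ c) (j : ℕ) {r : ℝ} (hr : c * j < r)
    {u g : L2 A a} (hu : u ∈ H1 A a) (hg : 0 ≤ g)
    (h : ∀ φ ∈ H1 A a, (cutForm A a hc j).val u φ + r * inner ℝ u φ = inner ℝ g φ) : 0 ≤ u := by
  have hq : Measurable fun x => r - cutPotential a c j x :=
    measurable_const.sub (measurable_cutPotential c j)
  have hC : ∀ x, |r - cutPotential a c j x| ≤ r := fun x => by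
    have h1 := cutPotential_nonneg (a := a) hc j x
    have h2 := cutPotential_le (a := a) c j x
    rw [abs_of_nonneg (by linarith)]
    linarith
  refine nonneg_of_weak_solution hN hq hC (fun x => ?_) hu hg fun φ hφ => ?_
  · have h2 := cutPotential_le (a := a) c j x
    linarith
  · have e : mulOp (gaussMeasure A a) _ hq r hC u = r • u - cutOp A a hc j u := by
      refine Lp.ext ?_
      filter_upwards [coeFn_mulOp hq hC u, Lp.coeFn_sub (r • u) (cutOp A a hc j u),
        Lp.coeFn_smul r u, coeFn_cutOp hc j u] with x h1 h2 h3 h4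
      rw [h1, h2, Pi.sub_apply, h3, h4, Pi.smul_apply, smul_eq_mul, sub_mul]
    rw [e, inner_sub_left, real_inner_smul_left, ← h φ hφ]
    simp only [cutForm]
    ring

/-- The step equations say that `u` and `u'` solve the weak problems with spectral parameter `1 / s
+ lam` and data `f / s`, `f' / s`. The bound on `s` makes this parameter exceed `c (j + 1)`, so the
zero order coefficients are positive and the maximum principle applies. -/
theorem resolvent_mono (hN : 3 ≤ N) {c : ℝ} (hc : 0 ≤ c) (j : ℕ) {lam : ℝ} (hlam : 0 ≤ lam)
    {R R' : L2 A a →L[ℝ] L2 A a}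
    (hR : ∀ u v, (cutForm A a hc j).Assoc u v ↔ R (v + lam • u) = u)
    (hR' : ∀ u v, (cutForm A a hc (j + 1)).Assoc u v ↔ R' (v + lam • u) = u) {s : ℝ} (hs : 0 < s)
    (hs' : s < 1 / (c * (j + 1) + 1)) {u u' f f' : L2 A a} (hu : R u + s • u = R f)
    (hu' : R' u' + s • u' = R' f') (hf : 0 ≤ f) (hff' : f ≤ f') : 0 ≤ u ∧ u ≤ u' := by
  have weak : ∀ (i : ℕ) (Q : L2 A a →L[ℝ] L2 A a) (w g : L2 A a),
      (∀ u v, (cutForm A a hc i).Assoc u v ↔ Q (v + lam • u) = u) → Q w + s • w = Q g →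
      w ∈ H1 A a ∧ ∀ φ ∈ H1 A a, (cutForm A a hc i).val w φ + (1 / s + lam) * inner ℝ w φ =
        inner ℝ ((1 / s) • g) φ := by
    intro i Q w g hQ hw
    -- The step equation reads `s w = Q (g - w)`, which puts `s w` in the range of the resolvent,
    -- hence in the operator domain.
    have h1 : (cutForm A a hc i).Assoc (s • w) (g - w - lam • s • w) := by
      rw [hQ, sub_add_cancel, map_sub, ← hw, add_sub_cancel_left]
    have hmem : w ∈ H1 A a := by
      have := smul_mem_H1 (1 / s) h1.1
      rwa [smul_smul, one_div_mul_cancel hs.ne', one_smul] at this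
    refine ⟨hmem, fun φ hφ => ?_⟩
    have h2 := h1.2 φ hφ
    rw [(isForm_cutForm hc i).2.2.1 s w hmem φ hφ, inner_sub_left, inner_sub_left,
      real_inner_smul_left, real_inner_smul_left] at h2
    rw [real_inner_smul_left]
    field_simp
    linarith
  have hr : c * ((j : ℝ) + 1) < 1 / s + lam := by
    have h0 : 0 ≤ c * ((j : ℝ) + 1) := by positivity
    have : c * ((j : ℝ) + 1) + 1 < 1 / s := by
      rw [lt_one_div (by positivity) hs]
      exact hs'
    linarith
  obtain ⟨hm, hw⟩ := weak j R u f hR hu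
  obtain ⟨hm', hw'⟩ := weak (j + 1) R' u' f' hR' hu'
  have hs1 : 0 ≤ 1 / s := by positivity
  have hu0 : 0 ≤ u := by
    refine nonneg_of_cutForm hN hc j (r := 1 / s + lam) ?_ hm (g := (1 / s) • f)
      (smul_nonneg_of_nonneg_L2 hs1 hf) hw
    have : c * (j : ℝ) ≤ c * ((j : ℝ) + 1) := by linarith
    linarith
  refine ⟨hu0, ?_⟩
  rw [← sub_nonneg]
  refine nonneg_of_cutForm hN hc (j + 1) (r := 1 / s + lam) (by push_cast; exact hr)
    (sub_mem_H1 hm' hm)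
    -- The difference `u' - u` solves the problem of index `j + 1`; its right side gains the
    -- increase of the potential times `u`, nonnegative by the first part.
    (g := (1 / s) • (f' - f) + (cutOp A a hc (j + 1) u - cutOp A a hc j u)) ?_ fun φ hφ => ?_
  · refine add_nonneg (smul_nonneg_of_nonneg_L2 hs1 (sub_nonneg.2 hff')) ?_
    rw [← Lp.coeFn_nonneg]
    filter_upwards [Lp.coeFn_sub (cutOp A a hc (j + 1) u) (cutOp A a hc j u), coeFn_cutOp hc j u,
      coeFn_cutOp hc (j + 1) u, (Lp.coeFn_nonneg u).2 hu0] with x h1 h2 h3 h4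
    rw [h1, Pi.sub_apply, h2, h3, Pi.zero_apply, sub_nonneg]
    exact mul_le_mul_of_nonneg_right (cutPotential_le_succ hc j x) h4
  · have h1 := hw φ hφ
    have h2 := hw' φ hφ
    simp only [cutForm] at h1 h2 ⊢
    rw [weakGrad_sub hm' hm, map_sub]
    simp only [inner_sub_left, inner_add_left, real_inner_smul_left] at h1 h2 ⊢
    linarith

end Comparison

end Multipolar

end

theorem proposition5p2 (N n : ℕ) (hN : 3 ≤ N) (hn : 1 ≤ n)
    (A : Matrix (Fin N) (Fin N) ℝ) (hA : A.PosDef)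
    (a : Fin n → E N) (ha : Function.Injective a) :
    -- the forms are well defined on the weighted Sobolev space
    (∀ u ∈ H1 A a, ∀ v ∈ H1 A a, ∀ i,
      Integrable (fun x => u x * v x / ‖x - a i‖ ^ 2) (gaussMeasure A a)) ∧
    (∀ c : ℝ, 0 < c → (hardyForm A a c).IsForm) ∧
    -- closedness and closability
    (∀ c : ℝ, 0 < c → c < cO N → (hardyForm A a c).IsClosed) ∧
    (hardyForm A a (cO N)).IsClosable ∧
    -- the operator `L` of the form `a_μ` is the Ornstein-Uhlenbeck operator on test functions
    (∀ φ : E N → ℝ, ContDiff ℝ ∞ φ → HasCompactSupport φ → ∀ u v : L2 A a,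
      u =ᵐ[gaussMeasure A a] φ → v =ᵐ[gaussMeasure A a] (fun x => -ouOp A a φ x) →
      (dirichletForm A a).Assoc u v) ∧
    ∀ c : ℝ, 0 < c → c ≤ cO N → ∃ k : ℝ, 0 ≤ k ∧ k < Real.pi ^ 2 ∧
      -- quasi-accretivity
      (∀ u ∈ H1 A a, -hardyConst A a c k * ‖u‖ ^ 2 ≤ (hardyForm A a c).val u u) ∧
      -- the form `b` is `a_c` below the critical constant, and its closure at the critical constant
      ∃ b : FormOn (L2 A a),
        (c < cO N → b = hardyForm A a c) ∧
        (c = cO N → b.IsClosureOf (hardyForm A a c)) ∧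
        b.IsForm ∧ b.IsClosed ∧
        -- the operator of `b` is `-(L + V)` on test functions
        (∀ φ : E N → ℝ, ContDiff ℝ ∞ φ → HasCompactSupport φ → ∀ u v : L2 A a,
          u =ᵐ[gaussMeasure A a] φ →
          v =ᵐ[gaussMeasure A a] (fun x => -(ouOp A a φ x + potential c a x * φ x)) →
          b.Assoc u v) ∧
        -- minus the operator of `b` generates an analytic semigroup
        ∃ S : C0Semigroup (L2 A a),
          (∀ u w, S.Generator u w ↔ b.Assoc u (-w)) ∧
          IsAnalyticSemigroup S ∧
          (∀ t : ℝ≥0, ‖S.op t‖ ≤ Real.exp (hardyConst A a c k * t)) ∧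
          -- positivity, and approximation by the semigroups of the cut-off potentials
          (∀ (t : ℝ≥0) (f : L2 A a), 0 ≤ f → 0 ≤ S.op t f) ∧
          ∃ Sk : ℕ → C0Semigroup (L2 A a),
            (∀ j u w, (Sk j).Generator u w ↔ ∃ v, (dirichletForm A a).Assoc u (-v) ∧
              w =ᵐ[gaussMeasure A a] fun x => v x + min (potential c a x) (c * j) * u x) ∧
            (∀ j (t : ℝ≥0) (f : L2 A a), 0 ≤ f →
              0 ≤ (Sk j).op t f ∧ (Sk j).op t f ≤ (Sk (j + 1)).op t f) ∧
            ∀ (t : ℝ≥0) (f : L2 A a),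
              Tendsto (fun j => (Sk j).op t f) atTop (𝓝 (S.op t f)) := by
  have : Fact A.PosDef := ⟨hA⟩
  have : NeZero n := ⟨by omega⟩
  refine ⟨fun u hu v hv i => integrable_div_sq hN ha hu hv i, fun c _ => isForm_hardyForm hN ha c,
    fun c hc hc' => isClosed_hardyForm hN ha hc.le hc', isClosable_hardyForm hN ha,
    fun φ hφ hφc u v hu hv => dirichletForm_assoc_test hφ hφc hu hv, fun c hc hc' => ?_⟩
  have hK := isSemibounded_hardyForm (A := A) hN ha hc.le hc'
  have hK0 : 0 ≤ hardyConst A a c 8 := hardyConst_nonneg hc.le (by norm_num)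
  obtain ⟨b, hb1, hb2, hb3, hb4⟩ := exists_closure_hardyForm (A := A) hN ha hc.le hc'
  have hF := isForm_hardyForm (A := A) hN ha c
  have hbK := hb2.isSemibounded hK
  have hKj := isSemibounded_cutForm (A := A) hN ha hc.le hc'
  obtain ⟨R, r1, r2, r3, r4, hR⟩ := FormOn.exists_resolvent hb3 hbK hb4
    (dense_H1.mono (hb2.subset hF))
  choose Rj q1 q2 q3 q4 hRj using fun j => FormOn.exists_resolvent (isForm_cutForm hc.le j) (hKj j)
    (isClosed_cutForm hc.le j) dense_H1
  have hres : IsResolvent R := ⟨r1, r2, r3, r4⟩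
  have hresj : ∀ j, IsResolvent (Rj j) := fun j => ⟨q1 j, q2 j, q3 j, q4 j⟩
  -- The resolvents are taken at `K + 1`, the same point for all `j`; `exp (-t R⁻¹)` decays like
  -- `exp (-t)`, so removing this shift leaves the growth bound `exp (K t)`.
  set lam := hardyConst A a c 8 + 1 with hlam
  have hlim : ∀ f, Tendsto (fun j => Rj j f) atTop (𝓝 (R f)) := fun f =>
    tendsto_of_energy hb3 hb4 hb2 hF hbK hKj (fun j => isForm_cutForm hc.le j) (fun _ => rfl)
      (fun j v hv => hardyForm_le_cutForm hN ha hc.le j hv)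
      (fun v hv => tendsto_cutForm hN ha hc hv) (f := f)
      (by rw [hR, sub_add_cancel]) fun j => by rw [hRj, sub_add_cancel]
  have hmono : ∀ j (t : ℝ≥0) (f : L2 A a), 0 ≤ f → 0 ≤ ((hresj j).semigroup lam).op t f ∧
      ((hresj j).semigroup lam).op t f ≤ ((hresj (j + 1)).semigroup lam).op t f := fun j t f hf =>
    (hresj j).semigroup_mono (hresj (j + 1)) (s₀ := 1 / (c * ((j : ℝ) + 1) + 1)) (by positivity)
      (fun s hs hs' u u' f f' hu hu' hf hff' => resolvent_mono hN hc.le j (by linarith)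
        (hRj j) (hRj (j + 1)) hs hs' hu hu' hf hff') lam t hf
  have hconv : ∀ (t : ℝ≥0) (f : L2 A a), Tendsto (fun j => ((hresj j).semigroup lam).op t f) atTop
      (𝓝 ((hres.semigroup lam).op t f)) := fun t f =>
    IsResolvent.tendsto_semigroup hresj hres hlim lam t f
  refine ⟨8, by norm_num, ?_, hK, b, hb1, fun _ => hb2, hb3, hb4,
    fun φ hφ hφc u v hu hv => hb2.assoc hF (hardyForm_assoc_test hN ha hφ hφc hu hv),
    hres.semigroup lam, fun u w => ?_, hres.isAnalyticSemigroup lam, fun t => ?_,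
    fun t f hf => ge_of_tendsto' (hconv t f) fun j => (hmono j t f hf).1,
    fun j => (hresj j).semigroup lam, fun j u w => ?_, hmono, hconv⟩
  -- `8 < 9 < π²`.
  · nlinarith [Real.pi_gt_three]
  · rw [IsResolvent.semigroup_generator_iff, hR, neg_add_eq_sub]
  · have := hres.norm_semigroup_le lam t
    rwa [hlam, add_sub_cancel_right] at this
  · rw [IsResolvent.semigroup_generator_iff, ← cutForm_assoc_neg_iff hc.le, hRj, neg_add_eq_sub]
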